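/- **Setting.** Let $\varphi:\mathbb R\to[0,\infty)$ and $\psi:\mathbb R^2\to[0,\infty)$ be smooth, $\varphi$ supported in $[0,1]$, $\psi$ supported in $\{|x|\le 1/2\}$ with $\psi(-x)=\psi(x)$, and put $R(s,y)=(\varphi\star\tilde\varphi)(s)\,(\psi\star\psi)(y)$ with $\tilde\varphi(s)=\varphi(-s)$. Let $\hat\beta,h\in\mathbb R$, $\gamma\in(0,1)$ and, for $\epsilon\in(0,1)$, $\beta_\epsilon=\hat\beta/\sqrt{\log\frac1\epsilon}$. Let $W_1$ be the Wiener measure on $\Omega_1=\{x\in C([0,1],\mathbb R^2): x(0)=0\}$, and $$\hat{\mathbb P}^{(\epsilon)}_1(dx)=\exp\Big(\tfrac{\beta_\epsilon^2}{2}\int_{[0,1]^2}R(s-u,x(s)-x(u))\,ds\,du-\zeta^{(\epsilon)}\Big)W_1(dx),$$ where $\zeta^{(\epsilon)}$ makes this a probability measure. Put $$I^{(\epsilon)}(x,y)=\beta_\epsilon^2\int_{[0,1]^2}R(s-u+h,\,y(s)+x(1)-x(u))\,ds\,du .$$ Let $\rho^{(\epsilon)}>0$ be the largest eigenvalue of $f\mapsto\int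 e^{I^{(\epsilon)}(\cdot,y)}f(y)\,\hat{\mathbb P}^{(\epsilon)}_1(dy)$ on bounded measurable functions and $\Psi^{(\epsilon)}$ its eigenfunction, which is bounded above and below by positive constants and normalized by $\int\Psi^{(\epsilon)}d\hat{\mathbb P}^{(\epsilon)}_1=1$ (this pair exists and is unique). Define $$\hat\pi^{(\epsilon)}(x,dy)=\frac{e^{I^{(\epsilon)}(x,y)}\Psi^{(\epsilon)}(y)\,\hat{\mathbb P}^{(\epsilon)}_1(dy)}{\rho^{(\epsilon)}\Psi^{(\epsilon)}(x)},\qquad \hat{\boldsymbol\pi}^{(\epsilon)}((x,y),\cdot)=\hat\pi^{(\epsilon)}(x,\cdot)\times\hat\pi^{(\epsilon)}(y,\cdot).$$ For all sufficiently small $\epsilon$ let $(X_j,Y_j)_{j\ge0}$ be the Markov chain on $\Omega_1\times\Omega_1$ with $(X_0,Y_0)\sim W_1\times W_1$ and transition probability $\hat{\boldsymbol\pi}^{(\epsilon)}$, coupled to Bernoulli($\gamma$) variables $(\eta_j)_{j\ge1}$ through $\hat{\boldsymbol\pi}^{(\epsilon)}(z,\cdot)=\gamma\,W_1\times W_1+(1-\gamma)\,r^{(\epsilon)}(z,\cdot)$: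 at step $j$, $\eta_j$ is tossed independently of the past; given the past and $\eta_j$, the pair $(X_j,Y_j)$ has law $W_1\times W_1$ if $\eta_j=1$ and law $r^{(\epsilon)}((X_{j-1},Y_{j-1}),\cdot)$ if $\eta_j=0$. (For all small $\epsilon$ the kernel $r^{(\epsilon)}$ defined by this identity is a probability kernel.) Let $T_0=0$, $T_i=\inf\{j>T_{i-1}:\eta_j=1\}$, let $\omega_{X_0},\omega_{Y_0}:[0,\infty)\to\mathbb R^2$ be the continuous paths obtained by gluing the segments $(X_j)_{j\ge0}$ and $(Y_j)_{j\ge0}$ respectively, and let $$S_n=\omega_{X_0}(T_n)-\omega_{Y_0}(T_n).$$ **Proposition.** Let $M(\epsilon)>0$ (for small $\epsilon$) satisfy $\log M(\epsilon)/\log\frac1\epsilon\to0$ as $\epsilon\to0^+$. Let $p\in\mathbb N$, $A\in\mathbb R$, and let $(H_\epsilon)_{\epsilon\in(0,1)}\subseteq L^1(\mathbb R^{2p})$ be a family of non-negative functions, each of them bounded (not necessarily uniformly in $\epsilon$), with $\|H_\epsilon\|_1=A$ for all $\epsilon$ and $$\lim_{L\to\infty}\ \sup_{\epsilon\in(0,1)}\int_{|\mathbf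 x|\ge L}H_\epsilon(\mathbf x)\,d\mathbf x=0 .$$ Then, as $\epsilon\to0^+$, $$\Big(\frac{2\pi}{\gamma\log\frac1\epsilon}\Big)^p\sum_{1\le k_1<\dots<k_p\le\lfloor M(\epsilon)/\epsilon^2\rfloor}\mathbb E\big[H_\epsilon(S_{k_1},\dots,S_{k_p})\big]\longrightarrow A .$$ -/

import Mathlib

open MeasureTheory ProbabilityTheory Filter Topology Set
open scoped ENNReal Convolution

/-! ### Principal eigenpairs of positive integral kernels -/

/-- `(ρ, Ψ)` is the principal eigenpair of the integral operator
`f ↦ ∫ k(·, y) f(y) μ(dy)` on bounded measurable functions: `Ψ` is bounded above and below by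
positive constants and has total mass one, it is an eigenfunction for `ρ > 0`, the number `ρ` is
the largest eigenvalue, and every eigenfunction for `ρ` is a multiple of `Ψ`. -/
structure IsPrincipalEigenpair {α : Type*} [MeasurableSpace α] (μ : Measure α) (k : α → α → ℝ)
    (ρ : ℝ) (Ψ : α → ℝ) : Prop where
  eigenvalue_pos : 0 < ρ
  measurable : Measurable Ψ
  bounds : ∃ c C : ℝ, 0 < c ∧ ∀ x, c ≤ Ψ x ∧ Ψ x ≤ C
  total_mass : ∫ x, Ψ x ∂μ = 1
  eigen : ∀ x, ∫ y, k x y * Ψ y ∂μ = ρ * Ψ x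
  largest : ∀ (r : ℝ) (f : α → ℝ), Measurable f → (∃ C, ∀ x, |f x| ≤ C) → (∃ x, f x ≠ 0) →
    (∀ x, ∫ y, k x y * f y ∂μ = r * f x) → r ≤ ρ
  unique : ∀ f : α → ℝ, Measurable f → (∃ C, ∀ x, |f x| ≤ C) →
    (∀ x, ∫ y, k x y * f y ∂μ = ρ * f x) → ∃ t : ℝ, ∀ x, f x = t * Ψ x

/-- A measurable kernel bounded above and below by positive constants has a principal
eigenpair. -/
theorem exists_isPrincipalEigenpair {α : Type*} [MeasurableSpace α] (μ : Measure α)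
    [IsProbabilityMeasure μ] (k : α → α → ℝ) (hk : Measurable (Function.uncurry k))
    (a b : ℝ) (ha : 0 < a) (hab : ∀ x y, a ≤ k x y ∧ k x y ≤ b) :
    ∃ (ρ : ℝ) (Ψ : α → ℝ), IsPrincipalEigenpair μ k ρ Ψ := by
  have : Nonempty α := by
    by_contra h
    rw [not_nonempty_iff] at h
    exact (IsProbabilityMeasure.ne_zero μ) (Measure.eq_zero_of_isEmpty μ)
  have hab' : a ≤ b := (hab (Classical.arbitrary α) (Classical.arbitrary α)).1.trans
    (hab _ _).2
  have hb : 0 < b := ha.trans_le hab'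
  have hkx : ∀ x, Measurable (k x) := fun x => hk.comp measurable_prodMk_left
  -- the integral operator
  set K : (α → ℝ) → α → ℝ := fun f x => ∫ y, k x y * f y ∂μ with hK
  have Kmeas : ∀ f, Measurable f → Measurable (K f) := by
    intro f hf
    have : StronglyMeasurable (Function.uncurry fun x y => k x y * f y) :=
      (hk.mul (hf.comp measurable_snd)).stronglyMeasurable
    exact this.integral_prod_right.measurable
  -- integrability of bounded measurable functions
  have bint : ∀ f : α → ℝ, Measurable f → (∃ C, ∀ x, |f x| ≤ C) → Integrable f μ := by
    rintro f hf ⟨C, hC⟩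
    exact Integrable.of_bound hf.aestronglyMeasurable C (ae_of_all _ hC)
  have kint : ∀ f : α → ℝ, Measurable f → (∃ C, ∀ x, |f x| ≤ C) → ∀ x,
      Integrable (fun y => k x y * f y) μ := by
    rintro f hf ⟨C, hC⟩ x
    refine bint _ ((hkx x).mul hf) ⟨b * C, fun y => ?_⟩
    rw [abs_mul]
    have h1 : |k x y| ≤ b := abs_le.2 ⟨by linarith [(hab x y).1], (hab x y).2⟩
    exact mul_le_mul h1 (hC y) (abs_nonneg _) hb.le
  have Kmono : ∀ f g : α → ℝ, Measurable f → Measurable g → (∃ C, ∀ x, |f x| ≤ C) →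
      (∃ C, ∀ x, |g x| ≤ C) → (∀ y, f y ≤ g y) → ∀ x, K f x ≤ K g x := by
    intro f g hf hg hf' hg' h x
    refine integral_mono (kint f hf hf' x) (kint g hg hg' x) fun y => ?_
    exact mul_le_mul_of_nonneg_left (h y) (ha.le.trans (hab x y).1)
  have Ksmul : ∀ (c : ℝ) (f : α → ℝ) x, K (fun y => c * f y) x = c * K f x := by
    intro c f x
    simp only [hK]
    rw [← integral_const_mul]
    congr 1; ext y; ring
  -- two-sided bound by the mass
  have Kbd : ∀ f : α → ℝ, Measurable f → (∃ C, ∀ x, |f x| ≤ C) → (∀ y, 0 ≤ f y) → ∀ x,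
      a * ∫ y, f y ∂μ ≤ K f x ∧ K f x ≤ b * ∫ y, f y ∂μ := by
    intro f hf hf' h0 x
    constructor
    · rw [← integral_const_mul]
      exact integral_mono ((bint f hf hf').const_mul a) (kint f hf hf' x)
        fun y => mul_le_mul_of_nonneg_right (hab x y).1 (h0 y)
    · rw [← integral_const_mul]
      exact integral_mono (kint f hf hf' x) ((bint f hf hf').const_mul b)
        fun y => mul_le_mul_of_nonneg_right (hab x y).2 (h0 y)
  -- normalized iterates
  set c : (α → ℝ) → ℝ := fun f => ∫ x, K f x ∂μ with hc
  let G : (α → ℝ) → (α → ℝ) := fun f x => K f x / c f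
  let h : ℕ → α → ℝ := fun n => G^[n] (fun _ => 1)
  have hsucc : ∀ n, h (n + 1) = fun x => K (h n) x / c (h n) := by
    intro n
    change G^[n + 1] _ = _
    rw [Function.iterate_succ_apply']
  set δ := a / b with hδ
  have hδ0 : 0 < δ := div_pos ha hb
  have hδ1 : δ ≤ 1 := (div_le_one hb).2 hab'
  have hδi : δ⁻¹ = b / a := by rw [hδ, inv_div]
  have hinv : ∀ n, Measurable (h n) ∧ (∀ x, δ ≤ h n x ∧ h n x ≤ δ⁻¹) ∧ ∫ x, h n x ∂μ = 1 := by
    intro n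
    induction n with
    | zero =>
      refine ⟨measurable_const, fun x => ⟨hδ1, ?_⟩, by simp [h]⟩
      exact (one_le_inv₀ hδ0).2 hδ1
    | succ n ih =>
      obtain ⟨hm, hB, hI⟩ := ih
      have hbd : ∃ C, ∀ x, |h n x| ≤ C :=
        ⟨δ⁻¹, fun x => abs_le.2 ⟨by linarith [(hB x).1, (hB x).2], (hB x).2⟩⟩
      have hKb := Kbd (h n) hm hbd (fun y => hδ0.le.trans (hB y).1)
      rw [hI, mul_one, mul_one] at hKb
      have hKi : Integrable (K (h n)) μ := bint _ (Kmeas _ hm)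
        ⟨b, fun x => abs_le.2 ⟨by linarith [(hKb x).1], (hKb x).2⟩⟩
      have hca : a ≤ c (h n) := by
        have := integral_mono (integrable_const a) hKi (fun x => (hKb x).1)
        simpa using this
      have hcb : c (h n) ≤ b := by
        have := integral_mono hKi (integrable_const b) (fun x => (hKb x).2)
        simpa using this
      have hc0 : 0 < c (h n) := ha.trans_le hca
      rw [hsucc]
      refine ⟨(Kmeas _ hm).div_const _, fun x => ⟨?_, ?_⟩, ?_⟩
      · exact div_le_div₀ (ha.le.trans (hKb x).1) (hKb x).1 hc0 hcb
      · rw [hδi]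
        exact div_le_div₀ hb.le (hKb x).2 ha hca
      · rw [integral_div]
        exact div_self hc0.ne'
  have hmeas n := (hinv n).1
  have hB n := (hinv n).2.1
  have hI n := (hinv n).2.2
  have hbd n : ∃ C, ∀ x, |h n x| ≤ C :=
    ⟨δ⁻¹, fun x => abs_le.2 ⟨by linarith [(hB n x).1, (hB n x).2], (hB n x).2⟩⟩
  have hpos n x : 0 < h n x := hδ0.trans_le (hB n x).1
  have hKb n x : a ≤ K (h n) x ∧ K (h n) x ≤ b := by
    have := Kbd (h n) (hmeas n) (hbd n) (fun y => (hpos n y).le) x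
    rwa [hI, mul_one, mul_one] at this
  have hKi n : Integrable (K (h n)) μ := bint _ (Kmeas _ (hmeas n))
    ⟨b, fun x => abs_le.2 ⟨by linarith [(hKb n x).1], (hKb n x).2⟩⟩
  -- bounds on the ratios `K (h n) / h n`
  have hratio : ∀ n, ∃ m M : ℝ, a * δ ≤ m ∧ M - m = (1 - δ) ^ n * (b / δ - a * δ) ∧
      ∀ x, m * h n x ≤ K (h n) x ∧ K (h n) x ≤ M * h n x := by
    intro n
    induction n with
    | zero =>
      refine ⟨a * δ, b / δ, le_rfl, by simp, fun x => ⟨?_, ?_⟩⟩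
      · have h1 : a * δ * h 0 x ≤ a := by
          have : h 0 x = 1 := rfl
          rw [this]; nlinarith
        exact h1.trans (hKb 0 x).1
      · have : h 0 x = 1 := rfl
        rw [this, mul_one]
        refine (hKb 0 x).2.trans ?_
        rw [le_div_iff₀ hδ0]; nlinarith
    | succ n ih =>
      obtain ⟨m, M, hm, hMm, hx⟩ := ih
      have hc0 : 0 < c (h n) := by
        have := integral_mono (integrable_const a) (hKi n) (fun x => (hKb n x).1)
        have h2 : a ≤ c (h n) := by simpa using this
        exact ha.trans_le h2
      -- `r = c (h n)` is the average of the ratio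
      have hmc : m ≤ c (h n) ∧ c (h n) ≤ M := by
        have hi := bint _ (hmeas n) (hbd n)
        constructor
        · have := integral_mono (hi.const_mul m) (hKi n) (fun x => (hx x).1)
          rwa [integral_const_mul, hI, mul_one] at this
        · have := integral_mono (hKi n) (hi.const_mul M) (fun x => (hx x).2)
          rwa [integral_const_mul, hI, mul_one] at this
      set r := c (h n) with hr
      have key : ∀ x, (δ * r + (1 - δ) * m) * K (h n) x ≤ K (K (h n)) x ∧
          K (K (h n)) x ≤ (δ * r + (1 - δ) * M) * K (h n) x := by
        intro x
        have hKK : ∃ C, ∀ x, |K (h n) x| ≤ C :=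
          ⟨b, fun x => abs_le.2 ⟨by linarith [(hKb n x).1], (hKb n x).2⟩⟩
        have i1 := kint _ (Kmeas _ (hmeas n)) hKK x
        have i2 := kint _ (hmeas n) (hbd n) x
        have i3 := hKi n
        have i4 := bint _ (hmeas n) (hbd n)
        constructor
        · have e : ∫ y, a * (K (h n) y - m * h n y) ∂μ ≤
              ∫ y, (k x y * K (h n) y - m * (k x y * h n y)) ∂μ := by
            refine integral_mono ((i3.sub (i4.const_mul m)).const_mul a)
              (i1.sub (i2.const_mul m)) fun y => ?_
            have h1 := (hab x y).1
            have h2 := (hx y).1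
            change a * (K (h n) y - m * h n y) ≤ k x y * K (h n) y - m * (k x y * h n y)
            nlinarith
          rw [integral_const_mul, integral_sub i3 (i4.const_mul m), integral_const_mul, hI,
            integral_sub i1 (i2.const_mul m), integral_const_mul, mul_one] at e
          change a * (r - m) ≤ K (K (h n)) x - m * K (h n) x at e
          have h3 : δ * K (h n) x ≤ a := by
            have := mul_le_mul_of_nonneg_left (hKb n x).2 hδ0.le
            rwa [hδ, div_mul_cancel₀ _ hb.ne'] at this
          nlinarith [mul_le_mul_of_nonneg_right h3 (sub_nonneg.2 hmc.1)]
        · have e : ∫ y, a * (M * h n y - K (h n) y) ∂μ ≤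
              ∫ y, (M * (k x y * h n y) - k x y * K (h n) y) ∂μ := by
            refine integral_mono (((i4.const_mul M).sub i3).const_mul a)
              ((i2.const_mul M).sub i1) fun y => ?_
            have h1 := (hab x y).1
            have h2 := (hx y).2
            change a * (M * h n y - K (h n) y) ≤ M * (k x y * h n y) - k x y * K (h n) y
            nlinarith
          rw [integral_const_mul, integral_sub (i4.const_mul M) i3, integral_const_mul, hI,
            integral_sub (i2.const_mul M) i1, integral_const_mul, mul_one] at e
          change a * (M - r) ≤ M * K (h n) x - K (K (h n)) x at e
          have h3 : δ * K (h n) x ≤ a := by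
            have := mul_le_mul_of_nonneg_left (hKb n x).2 hδ0.le
            rwa [hδ, div_mul_cancel₀ _ hb.ne'] at this
          nlinarith [mul_le_mul_of_nonneg_right h3 (sub_nonneg.2 hmc.2)]
      refine ⟨δ * r + (1 - δ) * m, δ * r + (1 - δ) * M, by nlinarith [hmc.1], ?_, fun x => ?_⟩
      · rw [pow_succ]
        have : δ * r + (1 - δ) * M - (δ * r + (1 - δ) * m) = (1 - δ) * (M - m) := by ring
        rw [this, hMm]; ring
      · have e1 : h (n + 1) = fun x => r⁻¹ * K (h n) x := by
          rw [hsucc]; ext x; rw [div_eq_inv_mul]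
        have e2 : K (h (n + 1)) x = r⁻¹ * K (K (h n)) x := by rw [e1, Ksmul]
        rw [e2, e1]
        have hri : 0 < r⁻¹ := inv_pos.2 hc0
        constructor
        · nlinarith [mul_le_mul_of_nonneg_left (key x).1 hri.le]
        · nlinarith [mul_le_mul_of_nonneg_left (key x).2 hri.le]
  have hca n : a ≤ c (h n) := by
    have := integral_mono (integrable_const a) (hKi n) (fun x => (hKb n x).1)
    simpa using this
  have hcb n : c (h n) ≤ b := by
    have := integral_mono (hKi n) (integrable_const b) (fun x => (hKb n x).2)
    simpa using this
  -- geometric decay of the increments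
  set D := b / δ - a * δ with hD
  have hD0 : 0 ≤ D := by
    have : b ≤ b / δ := by rw [le_div_iff₀ hδ0]; nlinarith
    nlinarith
  have hcauchy : ∀ x n, dist (h n x) (h (n + 1) x) ≤ (δ⁻¹ * D / a) * (1 - δ) ^ n := by
    intro x n
    obtain ⟨m, M, hm, hMm, hx⟩ := hratio n
    have hmc : m ≤ c (h n) ∧ c (h n) ≤ M := by
      have hi := bint _ (hmeas n) (hbd n)
      constructor
      · have := integral_mono (hi.const_mul m) (hKi n) (fun x => (hx x).1)
        rwa [integral_const_mul, hI, mul_one] at this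
      · have := integral_mono (hKi n) (hi.const_mul M) (fun x => (hx x).2)
        rwa [integral_const_mul, hI, mul_one] at this
    have hc0 : 0 < c (h n) := ha.trans_le (hca n)
    have e : h n x - h (n + 1) x = (c (h n) * h n x - K (h n) x) / c (h n) := by
      rw [hsucc, sub_div, mul_div_cancel_left₀ _ hc0.ne']
    have hnum : |c (h n) * h n x - K (h n) x| ≤ (M - m) * δ⁻¹ := by
      have h1 := (hx x).1
      have h2 := (hx x).2
      have h3 := hpos n x
      have h4 := (hB n x).2
      have h5 : 0 ≤ M - m := by linarith [hmc.1, hmc.2]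
      have h6 : (M - m) * h n x ≤ (M - m) * δ⁻¹ := mul_le_mul_of_nonneg_left h4 h5
      rw [abs_le]
      constructor <;> nlinarith [hmc.1, hmc.2]
    rw [Real.dist_eq, e, abs_div, abs_of_pos hc0]
    calc |c (h n) * h n x - K (h n) x| / c (h n) ≤ ((M - m) * δ⁻¹) / a :=
          div_le_div₀ ((abs_nonneg _).trans hnum) hnum ha (hca n)
      _ = _ := by rw [hMm]; ring
  have hq : 1 - δ < 1 := by linarith
  have hlim : ∀ x, ∃ l, Tendsto (fun n => h n x) atTop (𝓝 l) := fun x =>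
    cauchySeq_tendsto_of_complete (cauchySeq_of_le_geometric _ _ hq (hcauchy x))
  choose Ψ hΨ using hlim
  have hΨm : Measurable Ψ := measurable_of_tendsto_metrizable hmeas (tendsto_pi_nhds.2 hΨ)
  have hΨb : ∀ x, δ ≤ Ψ x ∧ Ψ x ≤ δ⁻¹ := fun x =>
    ⟨ge_of_tendsto' (hΨ x) fun n => (hB n x).1, le_of_tendsto' (hΨ x) fun n => (hB n x).2⟩
  have hΨI : ∫ x, Ψ x ∂μ = 1 := by
    have := tendsto_integral_of_dominated_convergence (μ := μ) (F := h) (f := Ψ) (fun _ => δ⁻¹)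
      (fun n => (hmeas n).aestronglyMeasurable) (integrable_const _)
      (fun n => ae_of_all _ fun x => abs_le.2
        ⟨by linarith [(hB n x).1, (hB n x).2], (hB n x).2⟩) (ae_of_all _ hΨ)
    simp only [hI] at this
    exact tendsto_nhds_unique this tendsto_const_nhds |>.symm ▸ rfl
  have hKΨ : ∀ x, Tendsto (fun n => K (h n) x) atTop (𝓝 (K Ψ x)) := by
    intro x
    refine tendsto_integral_of_dominated_convergence (fun _ => b * δ⁻¹)
      (fun n => ((hkx x).mul (hmeas n)).aestronglyMeasurable) (integrable_const _)
      (fun n => ae_of_all _ fun y => ?_) (ae_of_all _ fun y => (hΨ y).const_mul _)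
    rw [Real.norm_eq_abs, abs_mul]
    exact mul_le_mul (abs_le.2 ⟨by linarith [(hab x y).1], (hab x y).2⟩)
      (abs_le.2 ⟨by linarith [(hB n y).1, (hB n y).2], (hB n y).2⟩) (abs_nonneg _) hb.le
  have hcΨ : Tendsto (fun n => c (h n)) atTop (𝓝 (c Ψ)) := by
    refine tendsto_integral_of_dominated_convergence (fun _ => b)
      (fun n => (Kmeas _ (hmeas n)).aestronglyMeasurable) (integrable_const _)
      (fun n => ae_of_all _ fun y => ?_) (ae_of_all _ hKΨ)
    exact abs_le.2 ⟨by linarith [(hKb n y).1], (hKb n y).2⟩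
  have hρ : 0 < c Ψ := ha.trans_le (ge_of_tendsto' hcΨ hca)
  have heig : ∀ x, K Ψ x = c Ψ * Ψ x := by
    intro x
    have t1 : Tendsto (fun n => c (h n) * h (n + 1) x) atTop (𝓝 (c Ψ * Ψ x)) :=
      hcΨ.mul ((hΨ x).comp (tendsto_add_atTop_nat 1))
    have t2 : (fun n => c (h n) * h (n + 1) x) = fun n => K (h n) x := by
      ext n
      rw [hsucc, mul_div_cancel₀ _ (ha.trans_le (hca n)).ne']
    rw [t2] at t1
    exact tendsto_nhds_unique (hKΨ x) t1

  have hΨbd : ∃ C, ∀ x, |Ψ x| ≤ C :=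
    ⟨δ⁻¹, fun x => abs_le.2 ⟨by linarith [(hΨb x).1, (hΨb x).2], (hΨb x).2⟩⟩
  have hΨpos : ∀ x, 0 < Ψ x := fun x => hδ0.trans_le (hΨb x).1
  refine ⟨c Ψ, Ψ, hρ, hΨm, ⟨δ, δ⁻¹, hδ0, hΨb⟩, hΨI, heig, ?_, ?_⟩
  · -- maximality: compare `|f|` with the smallest multiple of `Ψ` above it
    rintro r f hf ⟨C, hC⟩ ⟨x₀, hx₀⟩ hr
    have habs : ∃ C, ∀ x, |(|f x|)| ≤ C := ⟨C, fun x => by simpa using hC x⟩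
    have hbdd : BddAbove (Set.range fun x => |f x| / Ψ x) := by
      refine ⟨C / δ, ?_⟩
      rintro _ ⟨x, rfl⟩
      exact div_le_div₀ ((abs_nonneg _).trans (hC x)) (hC x) hδ0 (hΨb x).1
    set t := ⨆ x, |f x| / Ψ x with ht
    have hle : ∀ x, |f x| ≤ t * Ψ x := fun x =>
      (div_le_iff₀ (hΨpos x)).1 (le_ciSup hbdd x)
    have ht0 : 0 < t :=
      (div_pos (abs_pos.2 hx₀) (hΨpos x₀)).trans_le (le_ciSup hbdd x₀)
    have h1 : ∀ x, |r| * |f x| ≤ t * (c Ψ * Ψ x) := by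
      intro x
      rw [← abs_mul, ← hr x]
      calc |∫ y, k x y * f y ∂μ| ≤ ∫ y, |k x y * f y| ∂μ := abs_integral_le_integral_abs
        _ = K (fun y => |f y|) x := by
          refine integral_congr_ae (ae_of_all _ fun y => ?_)
          simp only [abs_mul, abs_of_nonneg (ha.le.trans (hab x y).1)]
        _ ≤ K (fun y => t * Ψ y) x := by
          refine Kmono _ _ (hf.abs) (hΨm.const_mul t) habs ?_ hle x
          obtain ⟨C', hC'⟩ := hΨbd
          exact ⟨|t| * C', fun x => by
            rw [abs_mul]; exact mul_le_mul_of_nonneg_left (hC' x) (abs_nonneg _)⟩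
        _ = t * (c Ψ * Ψ x) := by rw [Ksmul, heig]
    have h2 : t ≤ c Ψ * t / |r| ∨ |r| = 0 := by
      by_cases h0 : |r| = 0
      · exact Or.inr h0
      · left
        have hr0 : 0 < |r| := lt_of_le_of_ne (abs_nonneg _) (Ne.symm h0)
        refine ciSup_le fun x => ?_
        rw [div_le_div_iff₀ (hΨpos x) hr0]
        linarith [h1 x]
    rcases h2 with h2 | h2
    · by_cases h0 : |r| = 0
      · exact (le_abs_self r).trans (h0 ▸ hρ.le)
      · have hr0 : 0 < |r| := lt_of_le_of_ne (abs_nonneg _) (Ne.symm h0)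
        rw [le_div_iff₀ hr0] at h2
        refine (le_abs_self r).trans ?_
        nlinarith
    · exact (le_abs_self r).trans (h2 ▸ hρ.le)
  · -- simplicity: subtract the largest multiple of `Ψ` below `f`
    rintro f hf ⟨C, hC⟩ hr
    have hbdd : BddBelow (Set.range fun x => f x / Ψ x) := by
      refine ⟨-(C / δ), ?_⟩
      rintro _ ⟨x, rfl⟩
      have h1 : |f x / Ψ x| ≤ C / δ := by
        rw [abs_div, abs_of_pos (hΨpos x)]
        exact div_le_div₀ ((abs_nonneg _).trans (hC x)) (hC x) hδ0 (hΨb x).1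
      exact (abs_le.1 h1).1
    set t := ⨅ x, f x / Ψ x with ht
    set g : α → ℝ := fun x => f x - t * Ψ x with hg
    have hg0 : ∀ x, 0 ≤ g x := fun x =>
      sub_nonneg.2 ((le_div_iff₀ (hΨpos x)).1 (ciInf_le hbdd x))
    have hgm : Measurable g := hf.sub (hΨm.const_mul t)
    have hgbd : ∃ C, ∀ x, |g x| ≤ C := by
      obtain ⟨C', hC'⟩ := hΨbd
      refine ⟨C + |t| * C', fun x => (abs_sub _ _).trans (add_le_add (hC x) ?_)⟩
      rw [abs_mul]; exact mul_le_mul_of_nonneg_left (hC' x) (abs_nonneg _)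
    have hKg : ∀ x, K g x = c Ψ * g x := by
      intro x
      have e : K g x = K f x - t * K Ψ x := by
        rw [← Ksmul, hK]
        dsimp only
        rw [← integral_sub (kint f hf ⟨C, hC⟩ x)]
        · congr 1; ext y; simp only [hg]; ring
        · have := (kint Ψ hΨm hΨbd x).const_mul t
          refine this.congr (ae_of_all _ fun y => ?_)
          ring
      rw [e, heig, show K f x = c Ψ * f x from hr x]
      simp only [hg]; ring
    have hgK := Kbd g hgm hgbd hg0
    have hint : ∫ y, g y ∂μ = 0 := by
      by_contra hne
      have hp : 0 < ∫ y, g y ∂μ := lt_of_le_of_ne (integral_nonneg hg0) (Ne.symm hne)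
      set s := a * (∫ y, g y ∂μ) / (c Ψ * δ⁻¹) with hs
      have hs0 : 0 < s := by positivity
      have : t + s ≤ t := by
        conv_rhs => rw [ht]
        refine le_ciInf fun x => ?_
        rw [le_div_iff₀ (hΨpos x)]
        have h1 : a * ∫ y, g y ∂μ ≤ c Ψ * g x := hKg x ▸ (hgK x).1
        have h2 : s * (c Ψ * δ⁻¹) = a * ∫ y, g y ∂μ := by
          rw [hs]; field_simp
        have h3 : s * δ⁻¹ ≤ g x := by
          have : c Ψ * (s * δ⁻¹) ≤ c Ψ * g x := by linarith
          exact le_of_mul_le_mul_left this hρ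
        have h4 : s * Ψ x ≤ s * δ⁻¹ := mul_le_mul_of_nonneg_left (hΨb x).2 hs0.le
        have h5 : g x = f x - t * Ψ x := rfl
        nlinarith
      linarith
    refine ⟨t, fun x => ?_⟩
    have h1 := (hgK x).2
    rw [hint, mul_zero, hKg x] at h1
    have h2 : g x ≤ 0 := by
      by_contra h
      push Not at h
      nlinarith [mul_pos hρ h]
    have h5 : g x = f x - t * Ψ x := rfl
    linarith [hg0 x]

/-- The chosen principal eigenpair `(ρ, Ψ)` (the pair `(1, 1)` if there is none; by
`exists_isPrincipalEigenpair` this does not occur for bounded kernels bounded away from zero). -/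
noncomputable def principalEigenpair {α : Type*} [MeasurableSpace α] (μ : Measure α)
    (k : α → α → ℝ) : ℝ × (α → ℝ) :=
  open Classical in
  if h : ∃ q : ℝ × (α → ℝ), IsPrincipalEigenpair μ k q.1 q.2 then h.choose else (1, fun _ => 1)

theorem isPrincipalEigenpair_principalEigenpair {α : Type*} [MeasurableSpace α] (μ : Measure α)
    [IsProbabilityMeasure μ] (k : α → α → ℝ) (hk : Measurable (Function.uncurry k))
    (a b : ℝ) (ha : 0 < a) (hab : ∀ x y, a ≤ k x y ∧ k x y ≤ b) :
    IsPrincipalEigenpair μ k (principalEigenpair μ k).1 (principalEigenpair μ k).2 := by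
  have h : ∃ q : ℝ × (α → ℝ), IsPrincipalEigenpair μ k q.1 q.2 := by
    obtain ⟨ρ, Ψ, h⟩ := exists_isPrincipalEigenpair μ k hk a b ha hab
    exact ⟨(ρ, Ψ), h⟩
  rw [principalEigenpair, dif_pos h]
  exact h.choose_spec

/-! ### Path space and Wiener measure -/

/-- The plane `ℝ²` with its Euclidean norm. -/
abbrev Plane : Type := EuclideanSpace ℝ (Fin 2)

instance : MeasurableSpace C(unitInterval, Plane) := borel _

instance : BorelSpace C(unitInterval, Plane) := ⟨rfl⟩

/-- Continuous paths `[0, 1] → ℝ²` started at the origin, with the topology of uniform convergence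
and its Borel σ-algebra. -/
abbrev PathSpace : Type := {x : C(unitInterval, Plane) // x 0 = 0}

/-- `W` is the Wiener measure on `PathSpace`: the increments of the coordinate process over
disjoint intervals are independent, and the increment over `[s, t]` is centred Gaussian with
covariance matrix `(t - s) I`. -/
structure IsWienerMeasure (W : Measure PathSpace) : Prop where
  isProbabilityMeasure : IsProbabilityMeasure W
  hasIndepIncrements :
    HasIndepIncrements (fun (t : unitInterval) (x : PathSpace) => x.1 t) W
  map_increment : ∀ s t : unitInterval, s ≤ t →
    W.map (fun x : PathSpace => x.1 t - x.1 s) =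
      multivariateGaussian 0 (((t : ℝ) - (s : ℝ)) • (1 : Matrix (Fin 2) (Fin 2) ℝ))

/-! ### The covariance of the mollified noise -/

/-- The assumptions on the mollifiers in time and in space. -/
structure IsMollifierPair (φ : ℝ → ℝ) (ψ : Plane → ℝ) : Prop where
  smooth_time : ContDiff ℝ (⊤ : ℕ∞) φ
  smooth_space : ContDiff ℝ (⊤ : ℕ∞) ψ
  nonneg_time : ∀ t, 0 ≤ φ t
  nonneg_space : ∀ y, 0 ≤ ψ y
  support_time : Function.support φ ⊆ Icc 0 1
  support_space : ∀ y, 1 / 2 < ‖y‖ → ψ y = 0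
  symm_space : ∀ y, ψ (-y) = ψ y

/-- The correlation function `R(s, y) = (φ ⋆ φ̃)(s) (ψ ⋆ ψ)(y)`, where `φ̃(s) = φ(-s)`. -/
noncomputable def noiseCorrelation (φ : ℝ → ℝ) (ψ : Plane → ℝ) (s : ℝ) (y : Plane) : ℝ :=
  (φ ⋆[ContinuousLinearMap.mul ℝ ℝ, volume] fun t => φ (-t)) s *
    (ψ ⋆[ContinuousLinearMap.mul ℝ ℝ, volume] ψ) y

/-- The self-interaction `∫_{[0,1]²} R(s - u, x(s) - x(u)) ds du` of a path segment. -/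
noncomputable def selfInteraction (φ : ℝ → ℝ) (ψ : Plane → ℝ) (x : PathSpace) : ℝ :=
  ∫ s : unitInterval, ∫ u : unitInterval,
    noiseCorrelation φ ψ ((s : ℝ) - (u : ℝ)) (x.1 s - x.1 u)

/-- The interaction `∫_{[0,1]²} R(s - u + h, y(s) + x(1) - x(u)) ds du` of a path segment `x` with
the following segment `y`. The time offset `h` is `1` if the times of `y` are counted on the glued
path (`y` is run during `[1, 2]`), and `0` if they are counted within the segment. -/
noncomputable def crossInteraction (φ : ℝ → ℝ) (ψ : Plane → ℝ) (h : ℝ) (x y : PathSpace) : ℝ :=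
  ∫ s : unitInterval, ∫ u : unitInterval,
    noiseCorrelation φ ψ ((s : ℝ) - (u : ℝ) + h) (y.1 s + x.1 1 - x.1 u)

/-- The coupling constant `β_ε = β / √(log (1 / ε))`. -/
noncomputable def couplingConstant (β ε : ℝ) : ℝ := β / √(Real.log (1 / ε))

/-- The exponentially tilted Wiener measure on path segments of length one,
`exp (β_ε² / 2 ∫_{[0,1]²} R(s - u, x(s) - x(u)) ds du - ζ) W(dx)` with `ζ` the normalization. -/
noncomputable def tiltedWiener (φ : ℝ → ℝ) (ψ : Plane → ℝ) (W : Measure PathSpace) (β ε : ℝ) :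
    Measure PathSpace :=
  W.tilted fun x => couplingConstant β ε ^ 2 / 2 * selfInteraction φ ψ x

/-- The weight `exp (I(x, y))` with `I(x, y) = β_ε² ∫_{[0,1]²} R(s - u + h, y(s) + x(1) - x(u))`. -/
noncomputable def interactionWeight (φ : ℝ → ℝ) (ψ : Plane → ℝ) (h β ε : ℝ) (x y : PathSpace) :
    ℝ :=
  Real.exp (couplingConstant β ε ^ 2 * crossInteraction φ ψ h x y)

theorem continuous_noiseCorrelation {φ : ℝ → ℝ} {ψ : Plane → ℝ} (hm : IsMollifierPair φ ψ) :
    Continuous (fun q : ℝ × Plane => noiseCorrelation φ ψ q.1 q.2) := by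
  have hφc : HasCompactSupport φ := by
    refine HasCompactSupport.intro (isCompact_Icc (a := (0 : ℝ)) (b := 1)) fun t ht => ?_
    by_contra h
    exact ht (hm.support_time h)
  have hψc : HasCompactSupport ψ := by
    refine HasCompactSupport.intro (isCompact_closedBall (0 : Plane) (1 / 2)) fun y hy => ?_
    refine hm.support_space y ?_
    simpa [Metric.mem_closedBall, dist_zero_right] using hy
  have h1 : Continuous (φ ⋆[ContinuousLinearMap.mul ℝ ℝ, volume] fun t => φ (-t)) :=
    hφc.continuous_convolution_left _ hm.smooth_time.continuous
      ((hm.smooth_time.continuous.comp continuous_neg).locallyIntegrable)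
  have h2 : Continuous (ψ ⋆[ContinuousLinearMap.mul ℝ ℝ, volume] ψ) :=
    hψc.continuous_convolution_left _ hm.smooth_space.continuous
      hm.smooth_space.continuous.locallyIntegrable
  exact (h1.comp continuous_fst).mul (h2.comp continuous_snd)

theorem exists_bound_noiseCorrelation {φ : ℝ → ℝ} {ψ : Plane → ℝ} (hm : IsMollifierPair φ ψ) :
    ∃ B, ∀ s y, |noiseCorrelation φ ψ s y| ≤ B := by
  have hφc : HasCompactSupport φ := by
    refine HasCompactSupport.intro (isCompact_Icc (a := (0 : ℝ)) (b := 1)) fun t ht => ?_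
    by_contra h
    exact ht (hm.support_time h)
  have hψc : HasCompactSupport ψ := by
    refine HasCompactSupport.intro (isCompact_closedBall (0 : Plane) (1 / 2)) fun y hy => ?_
    refine hm.support_space y ?_
    simpa [Metric.mem_closedBall, dist_zero_right] using hy
  have hφc' : HasCompactSupport fun t => φ (-t) := hφc.comp_homeomorph (Homeomorph.neg ℝ)
  have h1 : Continuous (φ ⋆[ContinuousLinearMap.mul ℝ ℝ, volume] fun t => φ (-t)) :=
    hφc.continuous_convolution_left _ hm.smooth_time.continuous
      ((hm.smooth_time.continuous.comp continuous_neg).locallyIntegrable)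
  have h2 : Continuous (ψ ⋆[ContinuousLinearMap.mul ℝ ℝ, volume] ψ) :=
    hψc.continuous_convolution_left _ hm.smooth_space.continuous
      hm.smooth_space.continuous.locallyIntegrable
  obtain ⟨B₁, hB₁⟩ := (hφc.convolution (ContinuousLinearMap.mul ℝ ℝ) hφc' :
    HasCompactSupport _).exists_bound_of_continuous h1
  obtain ⟨B₂, hB₂⟩ := (hψc.convolution (ContinuousLinearMap.mul ℝ ℝ) hψc :
    HasCompactSupport _).exists_bound_of_continuous h2
  refine ⟨B₁ * B₂, fun s y => ?_⟩
  rw [noiseCorrelation, abs_mul]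
  exact mul_le_mul (hB₁ s) (hB₂ y) (abs_nonneg _) ((norm_nonneg _).trans (hB₁ s))

theorem measurable_selfInteraction {φ : ℝ → ℝ} {ψ : Plane → ℝ} (hm : IsMollifierPair φ ψ) :
    Measurable (selfInteraction φ ψ) := by
  have hc : Continuous (fun q : (PathSpace × unitInterval) × unitInterval =>
      noiseCorrelation φ ψ ((q.1.2 : ℝ) - (q.2 : ℝ)) (q.1.1.1 q.1.2 - q.1.1.1 q.2)) := by
    have e : Continuous (fun q : (PathSpace × unitInterval) × unitInterval =>
        (((q.1.2 : ℝ) - (q.2 : ℝ) : ℝ), q.1.1.1 q.1.2 - q.1.1.1 q.2)) := by fun_prop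
    exact (continuous_noiseCorrelation hm).comp e
  exact (hc.stronglyMeasurable.integral_prod_right' (ν := volume)).integral_prod_right'
    (ν := volume) |>.measurable

theorem measurable_crossInteraction {φ : ℝ → ℝ} {ψ : Plane → ℝ} (hm : IsMollifierPair φ ψ)
    (h : ℝ) : Measurable (Function.uncurry (crossInteraction φ ψ h)) := by
  have hc : Continuous (fun q : ((PathSpace × PathSpace) × unitInterval) × unitInterval =>
      noiseCorrelation φ ψ ((q.1.2 : ℝ) - (q.2 : ℝ) + h)
        (q.1.1.2.1 q.1.2 + q.1.1.1.1 1 - q.1.1.1.1 q.2)) := by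
    have e : Continuous (fun q : ((PathSpace × PathSpace) × unitInterval) × unitInterval =>
        (((q.1.2 : ℝ) - (q.2 : ℝ) + h : ℝ),
          q.1.1.2.1 q.1.2 + q.1.1.1.1 1 - q.1.1.1.1 q.2)) := by fun_prop
    exact (continuous_noiseCorrelation hm).comp e
  exact (hc.stronglyMeasurable.integral_prod_right' (ν := volume)).integral_prod_right'
    (ν := volume) |>.measurable

theorem abs_integral_integral_le {F : unitInterval → unitInterval → ℝ} {B : ℝ}
    (hF : ∀ s u, |F s u| ≤ B) : |∫ s, ∫ u, F s u| ≤ B := by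
  have h1 : ∀ s, ‖∫ u, F s u‖ ≤ B := fun s => by
    simpa using norm_integral_le_of_norm_le_const (μ := (volume : Measure unitInterval))
      (ae_of_all _ fun u => (Real.norm_eq_abs _).trans_le (hF s u))
  simpa using norm_integral_le_of_norm_le_const (μ := (volume : Measure unitInterval))
    (ae_of_all _ h1)

theorem isProbabilityMeasure_tiltedWiener {φ : ℝ → ℝ} {ψ : Plane → ℝ} (hm : IsMollifierPair φ ψ)
    (W : Measure PathSpace) [IsProbabilityMeasure W] (β ε : ℝ) :
    IsProbabilityMeasure (tiltedWiener φ ψ W β ε) := by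
  obtain ⟨B, hB⟩ := exists_bound_noiseCorrelation hm
  refine isProbabilityMeasure_tilted ?_
  refine Integrable.of_bound (C := Real.exp (couplingConstant β ε ^ 2 / 2 * B))
    (Real.measurable_exp.comp ((measurable_selfInteraction hm).const_mul _)).aestronglyMeasurable
    (ae_of_all _ fun x => ?_)
  rw [Real.norm_eq_abs, Real.abs_exp]
  refine Real.exp_le_exp.2 (mul_le_mul_of_nonneg_left ?_ (by positivity))
  exact (abs_le.1 (abs_integral_integral_le fun s u => hB _ _)).2

/-- For the path segments the principal eigenpair exists. -/
theorem isPrincipalEigenpair_interactionWeight {φ : ℝ → ℝ} {ψ : Plane → ℝ}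
    (hm : IsMollifierPair φ ψ) (W : Measure PathSpace) [IsProbabilityMeasure W] (h β ε : ℝ) :
    IsPrincipalEigenpair (tiltedWiener φ ψ W β ε) (interactionWeight φ ψ h β ε)
      (principalEigenpair (tiltedWiener φ ψ W β ε) (interactionWeight φ ψ h β ε)).1
      (principalEigenpair (tiltedWiener φ ψ W β ε) (interactionWeight φ ψ h β ε)).2 := by
  obtain ⟨B, hB⟩ := exists_bound_noiseCorrelation hm
  have := isProbabilityMeasure_tiltedWiener hm W β ε
  refine isPrincipalEigenpair_principalEigenpair _ _ ?_
    (Real.exp (couplingConstant β ε ^ 2 * -B)) (Real.exp (couplingConstant β ε ^ 2 * B))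
    (Real.exp_pos _) fun x y => ?_
  · exact Real.measurable_exp.comp ((measurable_crossInteraction hm h).const_mul _)
  · have h1 : |crossInteraction φ ψ h x y| ≤ B := abs_integral_integral_le fun s u => hB _ _
    exact ⟨Real.exp_le_exp.2 (mul_le_mul_of_nonneg_left (abs_le.1 h1).1 (by positivity)),
      Real.exp_le_exp.2 (mul_le_mul_of_nonneg_left (abs_le.1 h1).2 (by positivity))⟩

/-! ### The Markov chain of path segments -/

/-- The transition probability
`π̂(x, dy) = exp (I(x, y)) Ψ(y) P̂(dy) / (ρ Ψ(x))` on path segments, where `P̂` is the tilted Wiener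
measure and `(ρ, Ψ)` is the principal eigenpair of `exp (I)`. -/
noncomputable def pathTransition (φ : ℝ → ℝ) (ψ : Plane → ℝ) (W : Measure PathSpace)
    (h β ε : ℝ) (x : PathSpace) : Measure PathSpace :=
  let P := tiltedWiener φ ψ W β ε
  let k := interactionWeight φ ψ h β ε
  let ρ := (principalEigenpair P k).1
  let Ψ := (principalEigenpair P k).2
  P.withDensity fun y => ENNReal.ofReal (k x y * Ψ y / (ρ * Ψ x))

/-- The pairs of path segments up to step `n` together with the coins tossed in steps `1, …, n`. -/
def history {S E : Type*} (Z : ℕ → S → E) (η : ℕ → S → Bool) (n : ℕ) (ω : S) :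
    (Fin (n + 1) → E) × (Fin n → Bool) :=
  (fun i => Z (i : ℕ) ω, fun i => η ((i : ℕ) + 1) ω)

/-- One step of the coupled chain, given the history and the new coin: on success (`true`) sample
from `ν`, on failure sample from `r` started at the last position. -/
noncomputable def coupledStep {E : Type*} [MeasurableSpace E] (ν : Measure E) (r : Kernel E E)
    (n : ℕ) : Kernel (((Fin (n + 1) → E) × (Fin n → Bool)) × Bool) E :=
  Kernel.piecewise (s := {q | q.2 = true}) (measurableSet_eq_fun measurable_snd measurable_const)
    (Kernel.const _ ν)
    (r.comap (fun q => q.1.1 (Fin.last n))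
      ((measurable_pi_apply _).comp (measurable_fst.comp measurable_fst)))

/-- The chain `Z` with transition probability `Q` and initial law `ν`, coupled to coins `η` of
success probability `γ` through the decomposition `Q(z, ·) = γ ν + (1 - γ) r(z, ·)`: in every step a
coin, independent of the past, is tossed; on success the new position is sampled from `ν`, on
failure from `r(z, ·) = (Q(z, ·) - γ ν) / (1 - γ)`, where `z` is the current position. -/
structure IsRegenerativeCoupling {S E : Type*} [MeasurableSpace S] [MeasurableSpace E]
    (P : Measure S) (ν : Measure E) (Q : E → Measure E) (γ : ℝ) (Z : ℕ → S → E)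
    (η : ℕ → S → Bool) : Prop where
  measurable_chain : ∀ n, Measurable (Z n)
  measurable_coin : ∀ n, Measurable (η n)
  initial : P.map (Z 0) = ν
  coin : ∀ n, HasCondDistrib (η (n + 1)) (history Z η n)
    (Kernel.const _ (ENNReal.ofReal γ • Measure.dirac true +
      ENNReal.ofReal (1 - γ) • Measure.dirac false)) P
  step : ∃ r : Kernel E E, IsMarkovKernel r ∧
    (∀ z, Q z = ENNReal.ofReal γ • ν + ENNReal.ofReal (1 - γ) • r z) ∧
    ∀ n, HasCondDistrib (Z (n + 1)) (fun ω => (history Z η n ω, η (n + 1) ω))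
      (coupledStep ν r n) P

/-! ### The walk along regeneration times -/

/-- The path `[0, ∞) → ℝ²` obtained by gluing path segments of length one. -/
noncomputable def gluedPath (x : ℕ → PathSpace) (t : ℝ) : Plane :=
  ∑ k ∈ Finset.range ⌊t⌋₊, (x k).1 1 + (x ⌊t⌋₊).1 (projIcc 0 1 zero_le_one (t - ⌊t⌋₊))

/-- The regeneration times `T 0 = 0` and `T (i + 1) = inf {j > T i : η j = 1}`. -/
noncomputable def regenerationTime (η : ℕ → Bool) : ℕ → ℕ
  | 0 => 0
  | i + 1 => sInf {j | regenerationTime η i < j ∧ η j = true}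

/-- The walk `S n = ω_X(T n) - ω_Y(T n)`, for a chain of pairs of path segments. -/
noncomputable def regenerationWalk (z : ℕ → PathSpace × PathSpace) (η : ℕ → Bool) (n : ℕ) : Plane :=
  gluedPath (fun k => (z k).1) (regenerationTime η n) -
    gluedPath (fun k => (z k).2) (regenerationTime η n)

/-- The tuples of integers `1 ≤ k₁ < ⋯ < k_p ≤ N`. -/
noncomputable def increasingTuples (p N : ℕ) : Finset (Fin p → ℕ) :=
  open Classical in
  (Fintype.piFinset fun _ : Fin p => Finset.Icc 1 N).filter StrictMono

/-! At every success of the coin the pair of segments is redrawn from `W × W`, independently of the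
past. The path pieces between successive regeneration times are therefore i.i.d. cycles, and `S n`
is a planar random walk whose step is the sum of `pairIncrement` over one cycle
(`iIndepFun_cycleSum`, `map_cycleSum`). A cycle has length `m + 1` with probability `γ (1 - γ) ^ m`;
its first pair has law `W × W` and it then makes `m` moves by `r`.

As `ε → 0` the coupling constant vanishes, so `π̂`, and with it `r`, is squeezed between multiples
of `W × W` that tend to `1` (`pathTransition_bounds`, `mixture_component_bounds`). If `r` were equal
to `W × W`, the step law would be the geometric mixture of the laws `N(0, 2 (m + 1) I)`, of
covariance `(2 / γ) I`. The actual step law lies between two perturbed mixtures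
(`isStepLaw_cycleLaw`), and exchanging the two paths shows that it is symmetric.

Since the step law varies with `ε`, a local limit theorem uniform over all such laws is needed: on
bounded sets `S n` has density between `γ / (4π (1 + δ) n) - e n` and `γ / (4π (1 - δ) n) + e n`,
with `e` summable and the same for all laws (`exists_convPow_le`, `exists_le_convPow`; the upper
bound holds on the whole plane). It is proved by Fourier inversion. The component `γ N(0, 2 I)` of
the step law supplies an integrable factor, and the part of the convolution power without it has
mass `(1 - γ) ^ n`.

Written in terms of the gaps `l i` of the times, the joint density is a product of one-gap
densities. The sum over a box of gaps factors into the `p`-th power of `∑ γ / (4π n)`, which is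
asymptotic to `γ / (4π) · log (M / ε²)`, that is, to `γ log (1 / ε) / (2π)`. Increasing tuples up to
`N` have gaps in the box `[1, N] ^ p`, and all gaps in `[1, N / (p + 1)] ^ p` are admissible; the
two boxes agree to leading logarithmic order. Tightness of `H` enters only in the lower bound, where
positions are confined to a cube. Finally `δ → 0`. -/

/-! ### Planar Gaussian measures -/

/-- The density of the centred Gaussian law on the plane with covariance matrix `2 t I`. -/
noncomputable def planeGaussianPDF (t : ℝ) (x : Plane) : ℝ :=
  (4 * Real.pi * t)⁻¹ * Real.exp (-‖x‖ ^ 2 / (4 * t))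

/-- The centred Gaussian law on the plane with covariance matrix `2 t I`. -/
noncomputable def planeGaussian (t : ℝ) : Measure Plane :=
  volume.withDensity fun x => ENNReal.ofReal (planeGaussianPDF t x)

theorem continuous_planeGaussianPDF (t : ℝ) : Continuous (planeGaussianPDF t) := by
  unfold planeGaussianPDF; fun_prop

theorem planeGaussianPDF_nonneg {t : ℝ} (ht : 0 < t) (x : Plane) : 0 ≤ planeGaussianPDF t x := by
  unfold planeGaussianPDF; positivity

theorem planeGaussianPDF_le {t : ℝ} (ht : 0 < t) (x : Plane) :
    planeGaussianPDF t x ≤ (4 * Real.pi * t)⁻¹ := by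
  unfold planeGaussianPDF
  refine mul_le_of_le_one_right (by positivity) (Real.exp_le_one_iff.2 ?_)
  rw [neg_div]
  exact neg_nonpos.2 (by positivity)

theorem integral_exp_neg_mul_sq_plane {b : ℝ} (hb : 0 < b) :
    ∫ v : Plane, Real.exp (-b * ‖v‖ ^ 2) = Real.pi / b := by
  rw [GaussianFourier.integral_rexp_neg_mul_sq_norm hb]
  simp

theorem integrable_exp_neg_mul_sq_plane {b : ℝ} (hb : 0 < b) :
    Integrable fun v : Plane => Real.exp (-b * ‖v‖ ^ 2) := by
  -- A non-integrable function has Bochner integral zero, whereas the value here is `π / b > 0`.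
  by_contra h
  have h1 := integral_exp_neg_mul_sq_plane hb
  rw [integral_undef h] at h1
  exact (div_pos Real.pi_pos hb).ne h1

theorem integral_cexp_neg_mul_sq_inner {b : ℝ} (hb : 0 < b) (w : Plane) :
    ∫ v : Plane, Complex.exp (-b * ‖v‖ ^ 2 + Complex.I * (inner ℝ w v : ℝ)) =
      (Real.pi / b * Real.exp (-‖w‖ ^ 2 / (4 * b)) : ℝ) := by
  have h : 0 < (b : ℂ).re := hb
  have h1 := GaussianFourier.integral_cexp_neg_mul_sq_norm_add h Complex.I w
  rw [h1]
  simp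

theorem charFun_planeGaussian {t : ℝ} (ht : 0 < t) (θ : Plane) :
    charFun (planeGaussian t) θ = (Real.exp (-t * ‖θ‖ ^ 2) : ℝ) := by
  rw [charFun_apply, planeGaussian, integral_withDensity_eq_integral_toReal_smul
    (continuous_planeGaussianPDF t).measurable.ennreal_ofReal (by simp)]
  have h := integral_cexp_neg_mul_sq_inner (b := (4 * t)⁻¹) (by positivity) θ
  have e : ∀ x : Plane, (ENNReal.ofReal (planeGaussianPDF t x)).toReal •
      Complex.exp ((inner ℝ x θ : ℝ) * Complex.I) = ((4 * Real.pi * t)⁻¹ : ℝ) *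
      Complex.exp (-((4 * t)⁻¹ : ℝ) * ‖x‖ ^ 2 + Complex.I * (inner ℝ θ x : ℝ)) := by
    intro x
    rw [ENNReal.toReal_ofReal (planeGaussianPDF_nonneg ht x), planeGaussianPDF, Complex.exp_add,
      real_inner_comm, Complex.real_smul]
    push_cast
    rw [mul_assoc, mul_comm Complex.I]
    congr 3
    ring
  simp_rw [e]
  rw [integral_const_mul, h, ← Complex.ofReal_mul]
  congr 1
  rw [← mul_assoc]
  have : (4 * Real.pi * t)⁻¹ * (Real.pi / (4 * t)⁻¹) = 1 := by
    have := Real.pi_pos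
    field_simp
  rw [this, one_mul]
  congr 1
  field_simp

instance isFiniteMeasure_planeGaussian (t : ℝ) : IsFiniteMeasure (planeGaussian t) := by
  -- For `t ≤ 0` the density is nonpositive and `ENNReal.ofReal` truncates it to zero, so finiteness
  -- needs no condition on `t`.
  rcases le_or_gt t 0 with ht | ht
  · have : planeGaussian t = 0 := by
      rw [planeGaussian]
      have h : (fun x => ENNReal.ofReal (planeGaussianPDF t x)) = 0 := by
        ext x
        refine ENNReal.ofReal_eq_zero.2 (mul_nonpos_of_nonpos_of_nonneg (inv_nonpos.2 ?_)
          (Real.exp_pos _).le)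
        nlinarith [Real.pi_pos]
      rw [h, withDensity_zero]
    rw [this]
    infer_instance
  · refine isFiniteMeasure_withDensity_ofReal ?_
    refine Integrable.hasFiniteIntegral ?_
    refine ((integrable_exp_neg_mul_sq_plane (b := (4 * t)⁻¹) (by positivity)).const_mul
      (4 * Real.pi * t)⁻¹).congr (ae_of_all _ fun x => ?_)
    simp only [planeGaussianPDF]
    congr 2
    field_simp

theorem isProbabilityMeasure_planeGaussian {t : ℝ} (ht : 0 < t) :
    IsProbabilityMeasure (planeGaussian t) := by
  have h := charFun_planeGaussian ht 0
  rw [charFun_zero] at h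
  have h1 : (planeGaussian t).real univ = 1 := by
    have : ((planeGaussian t).real univ : ℂ) = (1 : ℝ) := by rw [h]; simp
    exact_mod_cast this
  rw [measureReal_def] at h1
  exact ⟨by rw [← ENNReal.toReal_eq_one_iff]; exact h1⟩

theorem planeGaussian_le {t : ℝ} (ht : 0 < t) :
    planeGaussian t ≤ ENNReal.ofReal (4 * Real.pi * t)⁻¹ • volume := by
  rw [← withDensity_const]
  exact withDensity_mono (ae_of_all _ fun x => ENNReal.ofReal_le_ofReal (planeGaussianPDF_le ht x))

theorem planeGaussian_conv {s t : ℝ} (hs : 0 < s) (ht : 0 < t) :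
    (planeGaussian s) ∗ (planeGaussian t) = planeGaussian (s + t) := by
  have := isProbabilityMeasure_planeGaussian hs
  have := isProbabilityMeasure_planeGaussian ht
  refine Measure.ext_of_charFun ?_
  ext θ
  rw [charFun_conv, charFun_planeGaussian hs, charFun_planeGaussian ht,
    charFun_planeGaussian (add_pos hs ht), ← Complex.ofReal_mul, ← Real.exp_add]
  congr 2
  ring

/-- The Fourier inversion formula for the standard heat kernel. -/
theorem planeGaussianPDF_one_eq (x : Plane) :
    planeGaussianPDF 1 x = (4 * Real.pi ^ 2)⁻¹ *
      ∫ θ : Plane, Real.exp (-‖θ‖ ^ 2) * Real.cos (inner ℝ x θ) := by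
  have h := integral_cexp_neg_mul_sq_inner (b := 1) one_pos x
  have h2 := congrArg Complex.re h
  rw [Complex.ofReal_re, ← RCLike.re_eq_complex_re, ← integral_re] at h2
  · rw [planeGaussianPDF]
    have e : ∀ θ : Plane, RCLike.re (Complex.exp (-(1 : ℝ) * ‖θ‖ ^ 2 +
        Complex.I * (inner ℝ x θ : ℝ))) = Real.exp (-‖θ‖ ^ 2) * Real.cos (inner ℝ x θ) := by
      intro θ
      rw [RCLike.re_eq_complex_re, Complex.exp_re]
      norm_cast
      simp [-Complex.ofReal_pow]
    simp_rw [e] at h2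
    rw [h2]
    have := Real.pi_pos
    field_simp
  · refine (integrable_exp_neg_mul_sq_plane one_pos).mono (by fun_prop)
      (ae_of_all _ fun θ => ?_)
    rw [Complex.norm_exp]
    norm_cast
    simp [-Complex.ofReal_pow]

theorem integral_planeGaussianPDF_one_sub (ρ : Measure Plane) [IsFiniteMeasure ρ] (x : Plane) :
    ∫ y, planeGaussianPDF 1 (x - y) ∂ρ = (4 * Real.pi ^ 2)⁻¹ *
      ∫ θ : Plane, Real.exp (-‖θ‖ ^ 2) * ∫ y, Real.cos (inner ℝ (x - y) θ) ∂ρ := by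
  simp_rw [planeGaussianPDF_one_eq]
  rw [integral_const_mul]
  congr 1
  rw [integral_integral_swap]
  · simp_rw [integral_const_mul]
  · have h1 : Integrable (fun p : Plane × Plane => (1 : ℝ) * Real.exp (-1 * ‖p.2‖ ^ 2))
        (ρ.prod volume) :=
      (integrable_const (1 : ℝ)).mul_prod (integrable_exp_neg_mul_sq_plane one_pos)
    refine h1.mono ?_ (ae_of_all _ fun p => ?_)
    · apply Continuous.aestronglyMeasurable
      unfold Function.uncurry
      fun_prop
    · simp only [Function.uncurry, Real.norm_eq_abs, abs_mul, Real.abs_exp, one_mul,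
        neg_mul]
      exact mul_le_of_le_one_right (Real.exp_pos _).le (Real.abs_cos_le_one _)

/-- A real characteristic function means that the sine average vanishes, so only one term of the
addition formula survives. -/
theorem integral_cos_inner_sub (ρ : Measure Plane) [IsFiniteMeasure ρ] {θ : Plane} {c : ℝ}
    (hc : charFun ρ θ = c) (x : Plane) :
    ∫ y, Real.cos (inner ℝ (x - y) θ) ∂ρ = Real.cos (inner ℝ x θ) * c := by
  have hi : Integrable (fun y : Plane => Complex.exp ((inner ℝ y θ : ℝ) * Complex.I)) ρ := by
    refine (integrable_const (1 : ℝ)).mono (by fun_prop) (ae_of_all _ fun y => ?_)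
    rw [Complex.norm_exp_ofReal_mul_I]
    simp
  have hcos : ∫ y, Real.cos (inner ℝ y θ) ∂ρ = c := by
    have := congrArg Complex.re hc
    rw [charFun_apply, ← RCLike.re_eq_complex_re, ← integral_re hi] at this
    simpa [Complex.exp_ofReal_mul_I_re] using this
  have hsin : ∫ y, Real.sin (inner ℝ y θ) ∂ρ = 0 := by
    have := congrArg Complex.im hc
    rw [charFun_apply, ← RCLike.im_eq_complex_im, ← integral_im hi] at this
    simpa [Complex.exp_ofReal_mul_I_im] using this
  simp_rw [inner_sub_left, Real.cos_sub]
  rw [integral_add, integral_const_mul, integral_const_mul, hcos, hsin, mul_zero, add_zero]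
  · refine Integrable.of_bound (C := 1) (by fun_prop) (ae_of_all _ fun y => ?_)
    rw [Real.norm_eq_abs, abs_mul]
    exact mul_le_one₀ (Real.abs_cos_le_one _) (abs_nonneg _) (Real.abs_cos_le_one _)
  · refine Integrable.of_bound (C := 1) (by fun_prop) (ae_of_all _ fun y => ?_)
    rw [Real.norm_eq_abs, abs_mul]
    exact mul_le_one₀ (Real.abs_sin_le_one _) (abs_nonneg _) (Real.abs_sin_le_one _)

/-- Gaussian smoothing of a measure with a real characteristic function. -/
theorem planeGaussian_one_conv (ρ : Measure Plane) [IsFiniteMeasure ρ] {g : Plane → ℝ}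
    (hg : ∀ θ, charFun ρ θ = g θ) :
    (planeGaussian 1) ∗ ρ = volume.withDensity fun x => ENNReal.ofReal
      ((4 * Real.pi ^ 2)⁻¹ * ∫ θ : Plane, Real.cos (inner ℝ x θ) * (Real.exp (-‖θ‖ ^ 2) * g θ)) := by
  have hd : Measurable fun x => ENNReal.ofReal (planeGaussianPDF 1 x) :=
    (continuous_planeGaussianPDF 1).measurable.ennreal_ofReal
  -- The Fourier integral equals the density of the convolution. It is therefore nonnegative, and
  -- `ENNReal.ofReal` truncates nothing.
  have key : ∀ x, ENNReal.ofReal ((4 * Real.pi ^ 2)⁻¹ *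
      ∫ θ : Plane, Real.cos (inner ℝ x θ) * (Real.exp (-‖θ‖ ^ 2) * g θ)) =
      ∫⁻ y, ENNReal.ofReal (planeGaussianPDF 1 (x - y)) ∂ρ := by
    intro x
    rw [← ofReal_integral_eq_lintegral_ofReal, integral_planeGaussianPDF_one_sub]
    · simp_rw [integral_cos_inner_sub ρ (hg _)]
      congr 3
      ext θ
      ring
    · refine Integrable.of_bound (C := (4 * Real.pi * 1)⁻¹) ?_ (ae_of_all _ fun y => ?_)
      · exact ((continuous_planeGaussianPDF 1).comp (by fun_prop)).aestronglyMeasurable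
      · rw [Real.norm_eq_abs, abs_of_nonneg (planeGaussianPDF_nonneg one_pos _)]
        exact planeGaussianPDF_le one_pos _
    · exact ae_of_all _ fun y => planeGaussianPDF_nonneg one_pos _
  simp_rw [key]
  ext A hA
  rw [withDensity_apply _ hA, Measure.conv_comm, ← lintegral_indicator_one hA,
    Measure.lintegral_conv (measurable_one.indicator hA),
    lintegral_lintegral_swap (μ := volume.restrict A)]
  · refine lintegral_congr fun y => ?_
    have hm : Measurable fun x => A.indicator (1 : Plane → ℝ≥0∞) (y + x) :=
      (measurable_one.indicator hA).comp (measurable_const_add y)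
    rw [planeGaussian, lintegral_withDensity_eq_lintegral_mul _ hd hm,
      ← lintegral_sub_right_eq_self _ y, ← lintegral_indicator hA]
    refine lintegral_congr fun x => ?_
    by_cases hx : x ∈ A <;> simp [hx]
  · refine Measurable.aemeasurable ?_
    exact hd.comp (measurable_fst.sub measurable_snd)

/-! ### Convolution powers -/

/-- The law of a sum of `n` independent variables of law `μ`. -/
noncomputable def convPow (μ : Measure Plane) : ℕ → Measure Plane
  | 0 => Measure.dirac 0
  | n + 1 => convPow μ n ∗ μ

instance isFiniteMeasure_convPow (μ : Measure Plane) [IsFiniteMeasure μ] (n : ℕ) :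
    IsFiniteMeasure (convPow μ n) := by
  induction n with
  | zero => rw [convPow]; infer_instance
  | succ n ih => rw [convPow]; infer_instance

theorem charFun_convPow (μ : Measure Plane) [IsFiniteMeasure μ] (n : ℕ) (θ : Plane) :
    charFun (convPow μ n) θ = charFun μ θ ^ n := by
  induction n with
  | zero => simp [convPow, charFun_dirac]
  | succ n ih => rw [convPow, charFun_conv, ih, pow_succ]

theorem conv_univ (μ ν : Measure Plane) [IsFiniteMeasure μ] [IsFiniteMeasure ν] :
    (μ ∗ ν) univ = μ univ * ν univ := by
  rw [← lintegral_one, Measure.lintegral_conv measurable_const]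
  simp [mul_comm]

theorem convPow_univ (μ : Measure Plane) [IsFiniteMeasure μ] (n : ℕ) :
    convPow μ n univ = μ univ ^ n := by
  induction n with
  | zero => simp [convPow]
  | succ n ih => rw [convPow, conv_univ, ih, pow_succ]

theorem conv_apply (μ ν : Measure Plane) [SFinite ν] {A : Set Plane} (hA : MeasurableSet A) :
    (μ ∗ ν) A = ∫⁻ x, ν ((fun y => x + y) ⁻¹' A) ∂μ := by
  rw [← lintegral_indicator_one hA, Measure.lintegral_conv (measurable_one.indicator hA)]
  refine lintegral_congr fun x => ?_
  rw [← lintegral_indicator_one ((measurable_const_add x) hA)]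
  rfl

theorem conv_mono {μ μ' ν ν' : Measure Plane} [SFinite ν] [SFinite ν'] (h : μ ≤ μ')
    (h' : ν ≤ ν') : μ ∗ ν ≤ μ' ∗ ν' := by
  refine Measure.le_iff.2 fun A hA => ?_
  rw [conv_apply _ _ hA, conv_apply _ _ hA]
  exact lintegral_mono' h fun x => h' _

/-- Translation invariance of Lebesgue measure: averaging translates of a bounded density preserves
the bound up to the total mass of the averaging measure. -/
theorem conv_le_smul_volume (μ ν : Measure Plane) [SFinite ν] {c : ℝ≥0∞} (h : ν ≤ c • volume) :
    μ ∗ ν ≤ (μ univ * c) • volume := by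
  refine Measure.le_iff.2 fun A hA => ?_
  rw [conv_apply _ _ hA]
  calc ∫⁻ x, ν ((fun y => x + y) ⁻¹' A) ∂μ ≤ ∫⁻ _, c * volume A ∂μ := by
        refine lintegral_mono fun x => (h _).trans ?_
        rw [Measure.smul_apply, smul_eq_mul, measure_preimage_add]
    _ = _ := by
        rw [lintegral_const, Measure.smul_apply, smul_eq_mul]
        ring

theorem convPow_succ_le (μ : Measure Plane) [IsFiniteMeasure μ] {c : ℝ≥0∞}
    (h : μ ≤ c • volume) (n : ℕ) : convPow μ (n + 1) ≤ (μ univ ^ n * c) • volume := by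
  rw [convPow, ← convPow_univ]
  exact conv_le_smul_volume _ _ h

theorem charFun_add_measure (μ ν : Measure Plane) [IsFiniteMeasure μ] [IsFiniteMeasure ν]
    (θ : Plane) : charFun (μ + ν) θ = charFun μ θ + charFun ν θ := by
  have hi : ∀ (ρ : Measure Plane) [IsFiniteMeasure ρ],
      Integrable (fun y : Plane => Complex.exp ((inner ℝ y θ : ℝ) * Complex.I)) ρ := by
    intro ρ _
    refine (integrable_const (1 : ℝ)).mono (by fun_prop) (ae_of_all _ fun y => ?_)
    rw [Complex.norm_exp_ofReal_mul_I]
    simp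
  exact integral_add_measure (hi μ) (hi ν)

theorem charFun_ofReal_smul_measure {c : ℝ} (hc : 0 ≤ c) (μ : Measure Plane) (θ : Plane) :
    charFun (ENNReal.ofReal c • μ) θ = c * charFun μ θ := by
  rw [charFun_apply, integral_smul_measure, ENNReal.toReal_ofReal hc, charFun_apply,
    Complex.real_smul]

/-! ### Step laws close to a geometric mixture of Gaussians -/

/-- `μ` is a symmetric probability measure on the plane which contains `γ N(0, 2 I)`, and which is
within `η` of the geometric mixture `∑ γ (1 - γ) ^ m N(0, 2 (m + 1) I)`. -/
structure IsStepLaw (γ η : ℝ) (μ μ' : Measure Plane) : Prop where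
  isProbabilityMeasure : IsProbabilityMeasure μ
  eq_add : μ = ENNReal.ofReal γ • planeGaussian 1 + μ'
  symm : μ.map (fun x => -x) = μ
  sum_le : Measure.sum (fun m : ℕ =>
    ENNReal.ofReal (γ * ((1 - η) * (1 - γ)) ^ m) • planeGaussian (m + 1)) ≤ μ
  le_sum : μ ≤ Measure.sum (fun m : ℕ =>
    ENNReal.ofReal (γ * ((1 + η) * (1 - γ)) ^ m) • planeGaussian (m + 1))

/-- The remainder of a convolution power after removing the power of the remainder `μ'` and
dividing by the Gaussian component. -/
noncomputable def mixedPow (μ μ' : Measure Plane) : ℕ → Measure Plane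
  | 0 => 0
  | n + 1 => convPow μ n + mixedPow μ μ' n ∗ μ'

instance isFiniteMeasure_mixedPow (μ μ' : Measure Plane) [IsFiniteMeasure μ] [IsFiniteMeasure μ']
    (n : ℕ) : IsFiniteMeasure (mixedPow μ μ' n) := by
  induction n with
  | zero => rw [mixedPow]; infer_instance
  | succ n ih => rw [mixedPow]; infer_instance

theorem smul_conv_left (c : ℝ≥0∞) (μ ν : Measure Plane) [SFinite ν] :
    (c • μ) ∗ ν = c • (μ ∗ ν) := by
  ext A hA
  rw [conv_apply _ _ hA, Measure.smul_apply, conv_apply _ _ hA, lintegral_smul_measure]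

/-- The convolution form of `x ^ n - y ^ n = (x - y) ∑ x ^ i y ^ (n - 1 - i)`: everything except the
pure power of `μ'` carries a factor `ν`. -/
theorem convPow_eq_add {ν μ μ' : Measure Plane} [IsFiniteMeasure ν] [IsFiniteMeasure μ]
    [IsFiniteMeasure μ'] (c : ℝ) (h : μ = ENNReal.ofReal c • ν + μ') (n : ℕ) :
    convPow μ n = ENNReal.ofReal c • (ν ∗ mixedPow μ μ' n) + convPow μ' n := by
  induction n with
  | zero => simp [convPow, mixedPow]
  | succ n ih =>
    have : IsFiniteMeasure (ENNReal.ofReal c • ν) := ν.smul_finite ENNReal.ofReal_ne_top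
    have e : convPow μ (n + 1) = convPow μ n ∗ (ENNReal.ofReal c • ν) + convPow μ n ∗ μ' := by
      rw [convPow, ← Measure.conv_add, ← h]
    rw [e, Measure.conv_comm (convPow μ n) (_ • ν), smul_conv_left]
    nth_rw 2 [ih]
    have : IsFiniteMeasure (ENNReal.ofReal c • (ν ∗ mixedPow μ μ' n)) :=
      Measure.smul_finite _ ENNReal.ofReal_ne_top
    rw [Measure.add_conv, smul_conv_left, mixedPow, Measure.conv_add, smul_add, convPow,
      Measure.conv_assoc]
    abel

namespace IsStepLaw

variable {γ η : ℝ} {μ μ' : Measure Plane}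

theorem isFiniteMeasure (h : IsStepLaw γ η μ μ') : IsFiniteMeasure μ' := by
  have := h.isProbabilityMeasure
  refine isFiniteMeasure_of_le μ ?_
  rw [h.eq_add]
  exact Measure.le_add_left le_rfl

/-- Reflection conjugates the characteristic function, so a symmetric law has a real one. -/
theorem charFun_eq (h : IsStepLaw γ η μ μ') (θ : Plane) :
    charFun μ θ = ((charFun μ θ).re : ℝ) := by
  have e : charFun μ θ = charFun μ (-θ) := by
    conv_lhs => rw [← h.symm]
    rw [charFun_apply, integral_map (by fun_prop) (by fun_prop), charFun_apply]
    simp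
  rw [charFun_neg] at e
  exact (Complex.conj_eq_iff_re.1 e.symm).symm

theorem charFun_remainder (h : IsStepLaw γ η μ μ') (hγ : 0 < γ) (θ : Plane) :
    charFun μ' θ = (((charFun μ θ).re - γ * Real.exp (-‖θ‖ ^ 2) : ℝ) : ℂ) := by
  have := h.isFiniteMeasure
  have : IsFiniteMeasure (ENNReal.ofReal γ • planeGaussian 1) :=
    Measure.smul_finite _ ENNReal.ofReal_ne_top
  have e : charFun μ θ = γ * (Real.exp (-‖θ‖ ^ 2) : ℝ) + charFun μ' θ := by
    conv_lhs => rw [h.eq_add]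
    rw [charFun_add_measure, charFun_ofReal_smul_measure hγ.le, charFun_planeGaussian one_pos,
      neg_one_mul]
  rw [Complex.ofReal_sub, ← h.charFun_eq, e]
  push_cast
  ring

theorem remainder_univ (h : IsStepLaw γ η μ μ') (hγ : 0 < γ) :
    μ' univ = ENNReal.ofReal (1 - γ) := by
  have h1 := h.isProbabilityMeasure
  have := isProbabilityMeasure_planeGaussian one_pos
  have := h.isFiniteMeasure
  have e : μ univ = ENNReal.ofReal γ + μ' univ := by
    conv_lhs => rw [h.eq_add]
    simp
  rw [measure_univ] at e
  rw [ENNReal.ofReal_sub _ hγ.le, ENNReal.ofReal_one, e]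
  exact (ENNReal.add_sub_cancel_left ENNReal.ofReal_ne_top).symm

theorem abs_re_charFun_le (h : IsStepLaw γ η μ μ') (θ : Plane) : |(charFun μ θ).re| ≤ 1 := by
  have := h.isProbabilityMeasure
  exact (Complex.abs_re_le_norm _).trans (norm_charFun_le_one θ)

/-- The difference is the characteristic function of the remainder `μ'`, whose mass is `1 - γ`. This
is the source of all exponential decay in the local limit theorem. -/
theorem abs_re_charFun_sub_le (h : IsStepLaw γ η μ μ') (hγ : 0 < γ) (hγ₁ : γ < 1) (θ : Plane) :
    |(charFun μ θ).re - γ * Real.exp (-‖θ‖ ^ 2)| ≤ 1 - γ := by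
  have h1 := h.isFiniteMeasure
  have h2 := norm_charFun_le (μ := μ') θ
  rwa [h.charFun_remainder hγ, Complex.norm_real, Real.norm_eq_abs, measureReal_def,
    h.remainder_univ hγ, ENNReal.toReal_ofReal (by linarith)] at h2

theorem ofReal_one_sub_re_charFun (μ : Measure Plane) [IsProbabilityMeasure μ] (θ : Plane) :
    ENNReal.ofReal (1 - (charFun μ θ).re) =
      ∫⁻ x, ENNReal.ofReal (1 - Real.cos (inner ℝ x θ)) ∂μ := by
  have hi : Integrable (fun y : Plane => Complex.exp ((inner ℝ y θ : ℝ) * Complex.I)) μ := by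
    refine (integrable_const (1 : ℝ)).mono (by fun_prop) (ae_of_all _ fun y => ?_)
    rw [Complex.norm_exp_ofReal_mul_I]
    simp
  have hcos : Integrable (fun y : Plane => Real.cos (inner ℝ y θ)) μ :=
    Integrable.of_bound (C := 1) (by fun_prop) (ae_of_all _ fun y => Real.abs_cos_le_one _)
  have e : (charFun μ θ).re = ∫ x, Real.cos (inner ℝ x θ) ∂μ := by
    rw [charFun_apply, ← RCLike.re_eq_complex_re, ← integral_re hi]
    simp [Complex.exp_ofReal_mul_I_re]
  have hsub : Integrable (fun x : Plane => 1 - Real.cos (inner ℝ x θ)) μ :=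
    (integrable_const _).sub hcos
  rw [← ofReal_integral_eq_lintegral_ofReal hsub
    (ae_of_all _ fun x => sub_nonneg.2 (Real.cos_le_one _)),
    integral_sub (integrable_const _) hcos, e]
  simp

/-- With `E = exp (-‖θ‖²)`, the component number `m` contributes `γ q ^ m (1 - E ^ (m + 1))`, and
two geometric series remain. -/
theorem lintegral_one_sub_cos_mixture {γ q : ℝ} (hγ : 0 ≤ γ) (hq₀ : 0 ≤ q) (hq₁ : q < 1)
    (θ : Plane) :
    ∫⁻ x, ENNReal.ofReal (1 - Real.cos (inner ℝ x θ)) ∂(Measure.sum (fun m : ℕ =>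
      ENNReal.ofReal (γ * q ^ m) • planeGaussian (m + 1))) =
    ENNReal.ofReal (γ * (1 - Real.exp (-‖θ‖ ^ 2)) /
      ((1 - q) * (1 - q * Real.exp (-‖θ‖ ^ 2)))) := by
  set E := Real.exp (-‖θ‖ ^ 2) with hE
  have hE0 : 0 < E := Real.exp_pos _
  have hE1 : E ≤ 1 := Real.exp_le_one_iff.2 (by nlinarith [sq_nonneg ‖θ‖])
  have hqE : q * E < 1 := by nlinarith
  have e : ∀ m : ℕ, ∫⁻ x, ENNReal.ofReal (1 - Real.cos (inner ℝ x θ))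
      ∂(ENNReal.ofReal (γ * q ^ m) • planeGaussian (m + 1)) =
      ENNReal.ofReal (γ * q ^ m - γ * E * (q * E) ^ m) := by
    intro m
    have hm : (0 : ℝ) < m + 1 := by positivity
    have := isProbabilityMeasure_planeGaussian hm
    rw [lintegral_smul_measure, ← ofReal_one_sub_re_charFun, charFun_planeGaussian hm,
      Complex.ofReal_re, smul_eq_mul, ← ENNReal.ofReal_mul (by positivity)]
    have : Real.exp (-(m + 1) * ‖θ‖ ^ 2) = E ^ m * E := by
      rw [hE, ← Real.exp_nat_mul, ← Real.exp_add]
      congr 1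
      ring
    rw [this, mul_pow]
    congr 1
    ring
  rw [lintegral_sum_measure]
  simp_rw [e]
  have s1 : HasSum (fun m : ℕ => γ * q ^ m - γ * E * (q * E) ^ m)
      (γ * (1 - q)⁻¹ - γ * E * (1 - q * E)⁻¹) :=
    ((hasSum_geometric_of_lt_one hq₀ hq₁).mul_left γ).sub
      ((hasSum_geometric_of_lt_one (by positivity) hqE).mul_left (γ * E))
  rw [← ENNReal.ofReal_tsum_of_nonneg _ s1.summable, s1.tsum_eq]
  · congr 1
    have : 1 - q ≠ 0 := by linarith
    have : 1 - q * E ≠ 0 := by linarith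
    field_simp
    ring
  · intro m
    have h1 : E * E ^ m ≤ 1 := mul_le_one₀ hE1 (by positivity) (pow_le_one₀ hE0.le hE1)
    have : γ * q ^ m - γ * E * (q * E) ^ m = γ * q ^ m * (1 - E * E ^ m) := by
      rw [mul_pow]; ring
    rw [this]
    exact mul_nonneg (by positivity) (by linarith)

/-- The bounding mixtures are not probability measures, so comparing characteristic functions
directly would leave a constant error at the origin. Integrating `1 - cos ≥ 0`, which vanishes
quadratically, against the measure inequalities avoids this. -/
theorem one_sub_re_charFun_bounds (h : IsStepLaw γ η μ μ') (hγ : 0 < γ) (hγ₁ : γ < 1)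
    (hη₀ : 0 ≤ η) (hη : η ≤ γ / 2) (θ : Plane) :
    γ * (‖θ‖ ^ 2 - (‖θ‖ ^ 2) ^ 2 ) / ((γ + η) * (γ + η + ‖θ‖ ^ 2)) ≤ 1 - (charFun μ θ).re ∧
    1 - (charFun μ θ).re ≤ γ * ‖θ‖ ^ 2 / (γ - η) ^ 2 := by
  have := h.isProbabilityMeasure
  have hφ : 0 ≤ 1 - (charFun μ θ).re := by linarith [(abs_le.1 (h.abs_re_charFun_le θ)).2]
  set s := ‖θ‖ ^ 2 with hs
  have hs0 : 0 ≤ s := sq_nonneg _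
  set E := Real.exp (-s) with hE
  have hE0 : 0 < E := Real.exp_pos _
  have hE1 : E ≤ 1 := Real.exp_le_one_iff.2 (by linarith)
  have hEl : 1 - s ≤ E := by linarith [Real.add_one_le_exp (-s)]
  have hEu : E * (1 + s) ≤ 1 := by
    have h1 : 1 + s ≤ Real.exp s := by linarith [Real.add_one_le_exp s]
    calc E * (1 + s) ≤ E * Real.exp s := by gcongr
      _ = 1 := by rw [hE, ← Real.exp_add]; simp
  -- From `E ≤ 1 / (1 + s)` and `(1 - s + s²) (1 + s) = 1 + s³ ≥ 1`.
  have hEu' : E ≤ 1 - s + s ^ 2 := by nlinarith [mul_nonneg hs0 (sq_nonneg s)]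
  constructor
  · have h1 := lintegral_mono' h.sum_le (le_refl fun x : Plane =>
      ENNReal.ofReal (1 - Real.cos (inner ℝ x θ)))
    rw [lintegral_one_sub_cos_mixture hγ.le (by nlinarith) (by nlinarith),
      ← ofReal_one_sub_re_charFun, ENNReal.ofReal_le_ofReal_iff hφ] at h1
    refine le_trans ?_ h1
    rw [← hs, ← hE]
    have q0 : 0 ≤ (1 - η) * (1 - γ) := by nlinarith
    have q1 : 1 - (1 - η) * (1 - γ) ≤ γ + η := by nlinarith
    have q2 : 0 < 1 - (1 - η) * (1 - γ) := by nlinarith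
    set q := (1 - η) * (1 - γ)
    have q3 : 1 - q * E ≤ γ + η + s := by nlinarith
    have q4 : 0 < 1 - q * E := by nlinarith
    refine div_le_div₀ (mul_nonneg hγ.le (by linarith)) ?_ (by positivity)
      (mul_le_mul q1 q3 q4.le (by linarith))
    exact mul_le_mul_of_nonneg_left (by linarith) hγ.le
  · have h1 := lintegral_mono' h.le_sum (le_refl fun x : Plane =>
      ENNReal.ofReal (1 - Real.cos (inner ℝ x θ)))
    have q0 : 0 ≤ (1 + η) * (1 - γ) := by nlinarith
    -- This gap, positive because `η ≤ γ / 2`, makes the upper mixture a convergent series.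
    have q1 : γ - η ≤ 1 - (1 + η) * (1 - γ) := by nlinarith
    have q2 : 0 < γ - η := by linarith
    set q := (1 + η) * (1 - γ)
    have q3 : γ - η ≤ 1 - q * E := by nlinarith
    rw [lintegral_one_sub_cos_mixture hγ.le q0 (by linarith),
      ← ofReal_one_sub_re_charFun, ← hs, ← hE] at h1
    have h2 : 0 ≤ γ * (1 - E) / ((1 - q) * (1 - q * E)) :=
      div_nonneg (mul_nonneg hγ.le (by linarith)) (mul_nonneg (by linarith) (by linarith))
    rw [ENNReal.ofReal_le_ofReal_iff h2] at h1
    refine h1.trans (div_le_div₀ (by positivity) ?_ (by positivity) ?_)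
    · exact mul_le_mul_of_nonneg_left (by linarith) hγ.le
    · rw [sq]
      exact mul_le_mul q1 q3 q2.le (by linarith)

/-- Each Gaussian in the upper mixture has density at most `1`, and the weights sum to `γ / (1 - q)
≤ 2` because `1 - q ≥ γ / 2`. -/
theorem le_two_smul_volume (h : IsStepLaw γ η μ μ') (hγ : 0 < γ) (hγ₁ : γ < 1)
    (hη₀ : 0 ≤ η) (hη : η ≤ γ / 2) : μ' ≤ ENNReal.ofReal 2 • volume := by
  have h1 : μ' ≤ μ := by
    rw [h.eq_add]
    exact Measure.le_add_left le_rfl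
  refine h1.trans (h.le_sum.trans (Measure.le_iff.2 fun A hA => ?_))
  have q0 : 0 ≤ (1 + η) * (1 - γ) := by nlinarith
  have q1 : γ / 2 ≤ 1 - (1 + η) * (1 - γ) := by nlinarith
  set q := (1 + η) * (1 - γ)
  have hg := hasSum_geometric_of_lt_one q0 (by linarith : q < 1)
  rw [Measure.sum_apply _ hA]
  calc ∑' m : ℕ, (ENNReal.ofReal (γ * q ^ m) • planeGaussian (m + 1)) A
      ≤ ∑' m : ℕ, ENNReal.ofReal (γ * q ^ m) * volume A := by
        refine ENNReal.tsum_le_tsum fun m => ?_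
        rw [Measure.smul_apply, smul_eq_mul]
        refine mul_le_mul_right ((planeGaussian_le (by positivity : (0 : ℝ) < m + 1) A).trans ?_) _
        rw [Measure.smul_apply, smul_eq_mul]
        refine mul_le_of_le_one_left bot_le (ENNReal.ofReal_le_one.2 (inv_le_one_of_one_le₀ ?_))
        nlinarith [Real.pi_gt_three, (Nat.cast_nonneg m : (0 : ℝ) ≤ m)]
    _ ≤ _ := by
        rw [ENNReal.tsum_mul_right, ← ENNReal.ofReal_tsum_of_nonneg (fun m => by positivity)
          (hg.summable.mul_left γ), tsum_mul_left, hg.tsum_eq, Measure.smul_apply, smul_eq_mul]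
        gcongr
        rw [← div_eq_mul_inv, div_le_iff₀ (by linarith)]
        linarith

end IsStepLaw

/-! ### The local limit theorem, uniformly in the step law -/

theorem exists_forall_of_continuousAt_lt {f g : ℝ × ℝ → ℝ} (hf : ContinuousAt f 0)
    (hg : ContinuousAt g 0) (h : f 0 < g 0) :
    ∃ τ > 0, ∀ a b : ℝ, 0 ≤ a → a ≤ τ → 0 ≤ b → b ≤ τ → f (a, b) < g (a, b) := by
  obtain ⟨e, he, H⟩ := Metric.eventually_nhds_iff.1 (hf.eventually_lt hg h)
  refine ⟨e / 2, by positivity, fun a b ha ha' hb hb' => H ?_⟩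
  rw [Prod.dist_eq, max_lt_iff]
  simp only [Prod.fst_zero, Prod.snd_zero, Real.dist_eq, sub_zero, abs_of_nonneg ha,
    abs_of_nonneg hb]
  exact ⟨by linarith, by linarith⟩

namespace IsStepLaw

/-- Near the origin the characteristic function is close to `exp (-‖θ‖² / γ)`. -/
theorem exists_exp_bounds {γ δ : ℝ} (hγ : 0 < γ) (hγ₁ : γ < 1) (hδ : 0 < δ) :
    ∃ τ > 0, τ ≤ γ / 2 ∧ ∀ η, 0 ≤ η → η ≤ τ → ∀ μ μ', IsStepLaw γ η μ μ' →
      ∀ θ, ‖θ‖ ^ 2 ≤ τ → Real.exp (-((1 + δ) / γ) * ‖θ‖ ^ 2) ≤ (charFun μ θ).re ∧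
        (charFun μ θ).re ≤ Real.exp (-((1 - δ) / γ) * ‖θ‖ ^ 2) := by
  -- The variables are `(η, ‖θ‖²)`. The lower bound for `(1 - charFun) / ‖θ‖²` equals `1 / γ` at the
  -- origin, hence stays above `(1 - δ) / γ` nearby.
  obtain ⟨τ₁, hτ₁, H₁⟩ := exists_forall_of_continuousAt_lt
    (f := fun z : ℝ × ℝ => (1 - δ) / γ) (g := fun z : ℝ × ℝ =>
      γ * (1 - z.2) / ((γ + z.1) * (γ + z.1 + z.2))) (by fun_prop)
    (by
      refine ContinuousAt.div (by fun_prop) (by fun_prop) ?_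
      simp [hγ.ne']) (by
      simp only [Prod.fst_zero, Prod.snd_zero, add_zero, sub_zero, mul_one]
      rw [div_mul_cancel_left₀ hγ.ne', ← one_div]
      exact div_lt_div_of_pos_right (by linarith) hγ)
  -- The right-hand function comes from `exp (-t) ≤ 1 - t + t²` with `t = (1 + δ) / γ · ‖θ‖²`. At
  -- the origin the comparison is `1 / γ < (1 + δ) / γ`.
  obtain ⟨τ₂, hτ₂, H₂⟩ := exists_forall_of_continuousAt_lt
    (f := fun z : ℝ × ℝ => γ / (γ - z.1) ^ 2) (g := fun z : ℝ × ℝ =>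
      (1 + δ) / γ * (1 - (1 + δ) / γ * z.2)) 
    (by
      refine ContinuousAt.div (by fun_prop) (by fun_prop) ?_
      simp [hγ.ne']) (by fun_prop) (by
      simp only [Prod.fst_zero, Prod.snd_zero, mul_zero, sub_zero, mul_one]
      rw [sq, div_mul_cancel_left₀ hγ.ne', ← one_div]
      exact div_lt_div_of_pos_right (by linarith) hγ)
  refine ⟨min (min τ₁ τ₂) (γ / 2), by positivity, min_le_right _ _, ?_⟩
  intro η hη₀ hη μ μ' h θ hθ
  have h0 : 0 ≤ ‖θ‖ ^ 2 := sq_nonneg _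
  have e1 : min (min τ₁ τ₂) (γ / 2) ≤ τ₁ := (min_le_left _ _).trans (min_le_left _ _)
  have e2 : min (min τ₁ τ₂) (γ / 2) ≤ τ₂ := (min_le_left _ _).trans (min_le_right _ _)
  obtain ⟨b1, b2⟩ := h.one_sub_re_charFun_bounds hγ hγ₁ hη₀ (hη.trans (min_le_right _ _)) θ
  have g1 := H₁ η _ hη₀ (hη.trans e1) h0 (hθ.trans e1)
  have g2 := H₂ η _ hη₀ (hη.trans e2) h0 (hθ.trans e2)
  set s := ‖θ‖ ^ 2
  simp only at g1 g2
  constructor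
  · set c := (1 + δ) / γ with hc
    have hc0 : 0 < c := by positivity
    have h3 : Real.exp (-c * s) * (1 + c * s) ≤ 1 := by
      have : 1 + c * s ≤ Real.exp (c * s) := by linarith [Real.add_one_le_exp (c * s)]
      calc Real.exp (-c * s) * (1 + c * s) ≤ Real.exp (-c * s) * Real.exp (c * s) := by gcongr
        _ = 1 := by rw [← Real.exp_add]; simp
    have hcs : 0 ≤ c * s := by positivity
    have h4 : Real.exp (-c * s) ≤ 1 - c * s + (c * s) ^ 2 := by
      nlinarith [mul_nonneg hcs (sq_nonneg (c * s)), Real.exp_pos (-c * s)]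
    have h5 : γ * s / (γ - η) ^ 2 = γ / (γ - η) ^ 2 * s := by ring
    have h6 := mul_le_mul_of_nonneg_right g2.le h0
    nlinarith
  · have h3 : γ * (s - s ^ 2) / ((γ + η) * (γ + η + s)) =
        γ * (1 - s) / ((γ + η) * (γ + η + s)) * s := by ring
    have h6 := mul_le_mul_of_nonneg_right g1.le h0
    linarith [Real.add_one_le_exp (-((1 - δ) / γ) * s)]

end IsStepLaw

/-- `∑_{i < n} x ^ i y ^ (n - 1 - i)`. -/
def geomMix (x y : ℝ) : ℕ → ℝ
  | 0 => 0
  | n + 1 => x ^ n + geomMix x y n * y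

theorem sub_mul_geomMix (x y : ℝ) (n : ℕ) : (x - y) * geomMix x y n = x ^ n - y ^ n := by
  induction n with
  | zero => simp [geomMix]
  | succ n ih => rw [geomMix, mul_add, ← mul_assoc, ih]; ring

theorem abs_geomMix_succ_le {x y q : ℝ} (hx : |x| ≤ q) (hy : |y| ≤ q) (n : ℕ) :
    |geomMix x y (n + 1)| ≤ (n + 1) * q ^ n := by
  have hq : 0 ≤ q := (abs_nonneg _).trans hx
  induction n with
  | zero => simp [geomMix]
  | succ n ih =>
    rw [geomMix]
    calc |x ^ (n + 1) + geomMix x y (n + 1) * y|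
        ≤ |x| ^ (n + 1) + |geomMix x y (n + 1)| * |y| := by
          rw [← abs_pow, ← abs_mul]; exact abs_add_le _ _
      _ ≤ q ^ (n + 1) + (n + 1) * q ^ n * q := by gcongr
      _ = _ := by push_cast; ring

theorem abs_geomMix_le {x y : ℝ} (hx : |x| ≤ 1) (hy : |y| ≤ 1) (n : ℕ) :
    |geomMix x y n| ≤ n := by
  cases n with
  | zero => simp [geomMix]
  | succ n => simpa using abs_geomMix_succ_le hx hy n

namespace IsStepLaw

variable {γ η : ℝ} {μ μ' : Measure Plane}

/-- The recursions of `mixedPow` and `geomMix` correspond under the Fourier transform. -/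
theorem charFun_mixedPow (h : IsStepLaw γ η μ μ') (hγ : 0 < γ) (n : ℕ) (θ : Plane) :
    charFun (mixedPow μ μ' n) θ = (geomMix (charFun μ θ).re
      ((charFun μ θ).re - γ * Real.exp (-‖θ‖ ^ 2)) n : ℝ) := by
  have := h.isProbabilityMeasure
  have := h.isFiniteMeasure
  induction n with
  | zero => simp [mixedPow, geomMix]
  | succ n ih =>
    rw [mixedPow, charFun_add_measure, charFun_conv, ih, charFun_convPow, h.charFun_eq,
      h.charFun_remainder hγ, geomMix]
    push_cast
    rfl

/-- The Fourier transform of the part of a convolution power that has a Gaussian factor. -/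
noncomputable def powDiff (γ : ℝ) (μ : Measure Plane) (n : ℕ) (θ : Plane) : ℝ :=
  (charFun μ θ).re ^ n - ((charFun μ θ).re - γ * Real.exp (-‖θ‖ ^ 2)) ^ n

theorem powDiff_eq (γ : ℝ) (μ : Measure Plane) (n : ℕ) (θ : Plane) :
    powDiff γ μ n θ = γ * (Real.exp (-‖θ‖ ^ 2) * geomMix (charFun μ θ).re
      ((charFun μ θ).re - γ * Real.exp (-‖θ‖ ^ 2)) n) := by
  rw [powDiff, ← sub_mul_geomMix]
  ring

/-- The `n`-th power of the characteristic function need not be integrable, so inversion is applied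
only to the part with a Gaussian factor. The power of the remainder is kept as a measure. -/
theorem convPow_eq (h : IsStepLaw γ η μ μ') (hγ : 0 < γ) (n : ℕ) :
    convPow μ n = volume.withDensity (fun x => ENNReal.ofReal ((4 * Real.pi ^ 2)⁻¹ *
      ∫ θ : Plane, Real.cos (inner ℝ x θ) * powDiff γ μ n θ)) + convPow μ' n := by
  have := h.isProbabilityMeasure
  have := h.isFiniteMeasure
  rw [convPow_eq_add γ h.eq_add, planeGaussian_one_conv _ (h.charFun_mixedPow hγ n),
    ← withDensity_smul' _ _ ENNReal.ofReal_ne_top]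
  congr 2
  ext x
  rw [Pi.smul_apply, smul_eq_mul, ← ENNReal.ofReal_mul hγ.le, mul_left_comm,
    ← integral_const_mul]
  simp_rw [powDiff_eq]
  congr 3
  ext θ
  ring

theorem integrable_cos_mul_powDiff (h : IsStepLaw γ η μ μ') (hγ : 0 < γ) (hγ₁ : γ < 1) (n : ℕ)
    (x : Plane) : Integrable fun θ : Plane => Real.cos (inner ℝ x θ) * powDiff γ μ n θ := by
  have := h.isProbabilityMeasure
  have hm : Measurable fun θ => (charFun μ θ).re := Complex.measurable_re.comp measurable_charFun
  refine ((integrable_exp_neg_mul_sq_plane one_pos).const_mul (γ * n)).mono ?_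
    (ae_of_all _ fun θ => ?_)
  · unfold powDiff
    fun_prop
  · rw [powDiff_eq]
    have h1 := abs_geomMix_le (h.abs_re_charFun_le θ)
      ((h.abs_re_charFun_sub_le hγ hγ₁ θ).trans (by linarith)) n
    simp only [Real.norm_eq_abs, abs_mul, Real.abs_exp, abs_of_pos hγ, Nat.abs_cast, neg_one_mul]
    calc _ ≤ 1 * (γ * (Real.exp (-‖θ‖ ^ 2) * n)) := by
          gcongr
          exact Real.abs_cos_le_one _
      _ = _ := by ring

end IsStepLaw

/-- An error term for the local limit theorem. -/
noncomputable def localError (γ τ : ℝ) (n : ℕ) : ℝ :=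
  Real.exp τ * (1 - γ) ^ n + γ * (n * (1 - γ + γ * Real.exp (-τ)) ^ (n - 1))

theorem localError_nonneg {γ τ : ℝ} (hγ : 0 < γ) (hγ₁ : γ < 1) (n : ℕ) :
    0 ≤ localError γ τ n := by
  have h1 : 0 ≤ 1 - γ := by linarith
  unfold localError
  positivity

theorem summable_localError {γ τ : ℝ} (hγ : 0 < γ) (hγ₁ : γ < 1) (hτ : 0 < τ) :
    Summable (localError γ τ) := by
  have h1 : 0 ≤ 1 - γ := by linarith
  refine ((summable_geometric_of_lt_one h1 (by linarith)).mul_left _).add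
    (Summable.mul_left _ ?_)
  have hE : Real.exp (-τ) < 1 := Real.exp_lt_one_iff.2 (by linarith)
  set q := 1 - γ + γ * Real.exp (-τ)
  have hq0 : 0 < q := by positivity
  have hq1 : q < 1 := by nlinarith
  -- Dividing `n q ^ n` by `q` gives `n q ^ (n - 1)`; at `n = 0` both vanish, so the truncated
  -- exponent is harmless.
  have := (summable_pow_mul_geometric_of_norm_lt_one 1
    (by rwa [Real.norm_eq_abs, abs_of_pos hq0] : ‖q‖ < 1)).mul_right q⁻¹
  refine this.congr fun n => ?_
  cases n with
  | zero => simp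
  | succ n =>
    rw [pow_one, Nat.add_sub_cancel, pow_succ]
    field_simp

namespace IsStepLaw

variable {γ η : ℝ} {μ μ' : Measure Plane}

/-- Away from the origin both factors of the difference of powers are at most `q = 1 - γ + γ exp
(-τ)`, which is less than `1` when `τ > 0`. The mixed sum is then at most `n q ^ (n - 1)`, and the
prefactor `γ exp (-‖θ‖²)` provides integrability. -/
theorem abs_powDiff_le_of_lt (h : IsStepLaw γ η μ μ') (hγ : 0 < γ) (hγ₁ : γ < 1) {τ : ℝ}
    {θ : Plane} (hθ : τ < ‖θ‖ ^ 2) (n : ℕ) :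
    |powDiff γ μ n θ| ≤ Real.exp (-‖θ‖ ^ 2) * localError γ τ n := by
  have h1 : 0 ≤ 1 - γ := by linarith
  set b := (charFun μ θ).re - γ * Real.exp (-‖θ‖ ^ 2) with hb
  have hb1 : |b| ≤ 1 - γ := h.abs_re_charFun_sub_le hγ hγ₁ θ
  have hE : Real.exp (-‖θ‖ ^ 2) ≤ Real.exp (-τ) := Real.exp_le_exp.2 (by linarith)
  have hq : 1 - γ ≤ 1 - γ + γ * Real.exp (-τ) := by
    have := mul_pos hγ (Real.exp_pos (-τ)); linarith
  have ha : |(charFun μ θ).re| ≤ 1 - γ + γ * Real.exp (-τ) := by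
    have e : (charFun μ θ).re = b + γ * Real.exp (-‖θ‖ ^ 2) := by rw [hb]; ring
    rw [e]
    refine (abs_add_le _ _).trans (add_le_add hb1 ?_)
    rw [abs_of_pos (mul_pos hγ (Real.exp_pos _))]
    gcongr
  have hg : |geomMix (charFun μ θ).re b n| ≤ n * (1 - γ + γ * Real.exp (-τ)) ^ (n - 1) := by
    cases n with
    | zero => simp [geomMix]
    | succ n => exact_mod_cast abs_geomMix_succ_le ha (hb1.trans hq) n
  rw [powDiff_eq, ← hb, abs_mul, abs_mul, Real.abs_exp, abs_of_pos hγ, mul_left_comm]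
  refine mul_le_mul_of_nonneg_left ?_ (Real.exp_pos _).le
  unfold localError
  have : 0 ≤ Real.exp τ * (1 - γ) ^ n := by positivity
  nlinarith [mul_le_mul_of_nonneg_left hg hγ.le]

/-- The power is at most `(1 - γ) ^ n`. The constant `exp τ` pays for the factor `exp (-‖θ‖²)`,
which gives the error the same shape near the origin as far from it. -/
theorem abs_remainder_pow_le (h : IsStepLaw γ η μ μ') (hγ : 0 < γ) (hγ₁ : γ < 1) {τ : ℝ}
    {θ : Plane} (hθ : ‖θ‖ ^ 2 ≤ τ) (n : ℕ) :
    |((charFun μ θ).re - γ * Real.exp (-‖θ‖ ^ 2)) ^ n| ≤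
      Real.exp (-‖θ‖ ^ 2) * localError γ τ n := by
  have h1 : 0 ≤ 1 - γ := by linarith
  rw [abs_pow]
  calc _ ≤ (1 - γ) ^ n := by
        gcongr
        exact h.abs_re_charFun_sub_le hγ hγ₁ θ
    _ ≤ Real.exp (-‖θ‖ ^ 2) * (Real.exp τ * (1 - γ) ^ n) := by
        rw [← mul_assoc, ← Real.exp_add]
        refine le_mul_of_one_le_left (by positivity) (Real.one_le_exp (by linarith))
    _ ≤ _ := by
        refine mul_le_mul_of_nonneg_left ?_ (Real.exp_pos _).le
        unfold localError
        have : 0 ≤ γ * (n * (1 - γ + γ * Real.exp (-τ)) ^ (n - 1)) := by positivity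
        linarith

/-- An integrable majorant valid in both regions of `θ`. Its first term integrates to the leading
term `π / (n c)`, its second to a summable error. -/
theorem cos_mul_powDiff_le (h : IsStepLaw γ η μ μ') (hγ : 0 < γ) (hγ₁ : γ < 1) {τ c c' : ℝ}
    (hc : ∀ θ, ‖θ‖ ^ 2 ≤ τ → Real.exp (-c' * ‖θ‖ ^ 2) ≤ (charFun μ θ).re ∧
        (charFun μ θ).re ≤ Real.exp (-c * ‖θ‖ ^ 2)) (n : ℕ) (x θ : Plane) :
    Real.cos (inner ℝ x θ) * powDiff γ μ n θ ≤
      Real.exp (-(n * c) * ‖θ‖ ^ 2) + localError γ τ n * Real.exp (-1 * ‖θ‖ ^ 2) := by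
  have h0 : Real.cos (inner ℝ x θ) * powDiff γ μ n θ ≤ |powDiff γ μ n θ| := by
    refine (le_abs_self _).trans ?_
    rw [abs_mul]
    exact mul_le_of_le_one_left (abs_nonneg _) (Real.abs_cos_le_one _)
  refine h0.trans ?_
  rw [mul_comm (localError γ τ n), neg_one_mul]
  rcases le_or_gt (‖θ‖ ^ 2) τ with hθ | hθ
  · obtain ⟨l, u⟩ := hc θ hθ
    have hp : 0 ≤ (charFun μ θ).re := (Real.exp_pos _).le.trans l
    refine (abs_sub _ _).trans (add_le_add ?_ (h.abs_remainder_pow_le hγ hγ₁ hθ n))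
    rw [abs_of_nonneg (pow_nonneg hp n)]
    refine (pow_le_pow_left₀ hp u n).trans_eq ?_
    rw [← Real.exp_nat_mul]
    congr 1
    ring
  · exact (h.abs_powDiff_le_of_lt hγ hγ₁ hθ n).trans
      (le_add_of_nonneg_left (Real.exp_pos _).le)

/-- Absorbs the factor `‖θ‖²` from the expansion of the cosine into a Gaussian of half the rate. -/
theorem mul_exp_neg_le {t : ℝ} (ht : 0 ≤ t) : t * Real.exp (-t) ≤ Real.exp (-(t / 2)) := by
  have h1 : t ≤ Real.exp (t / 2) := by
    have e : Real.exp (t / 2) = Real.exp (t / 4) ^ 2 := by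
      rw [← Real.exp_nat_mul]; congr 1; push_cast; ring
    rw [e]
    nlinarith [Real.add_one_le_exp (t / 4), sq_nonneg (1 - t / 4)]
  calc t * Real.exp (-t) ≤ Real.exp (t / 2) * Real.exp (-t) := by gcongr
    _ = _ := by rw [← Real.exp_add]; congr 1; ring

/-- For `‖x‖ ≤ L` the cosine costs at most `L² ‖θ‖² / 2`. Multiplied by the Gaussian of rate `n c`,
this integrates to a term of order `n⁻²`, which is summable. -/
theorem le_cos_mul_powDiff (h : IsStepLaw γ η μ μ') (hγ : 0 < γ) (hγ₁ : γ < 1) {τ c c' : ℝ}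
    (hc₀ : 0 < c) (hc' : 1 ≤ c')
    (hc : ∀ θ, ‖θ‖ ^ 2 ≤ τ → Real.exp (-c' * ‖θ‖ ^ 2) ≤ (charFun μ θ).re ∧
        (charFun μ θ).re ≤ Real.exp (-c * ‖θ‖ ^ 2)) {n : ℕ} (hn : 1 ≤ n) {L : ℝ} {x : Plane}
    (hx : ‖x‖ ≤ L) (θ : Plane) :
    Real.exp (-(n * c') * ‖θ‖ ^ 2) - L ^ 2 / (2 * (n * c)) * Real.exp (-(n * c / 2) * ‖θ‖ ^ 2) -
      (localError γ τ n + Real.exp τ * Real.exp (-(c' * τ)) ^ n) * Real.exp (-1 * ‖θ‖ ^ 2) ≤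
    Real.cos (inner ℝ x θ) * powDiff γ μ n θ := by
  have hn0 : (1 : ℝ) ≤ n := by exact_mod_cast hn
  have hnc : 0 < n * c := by positivity
  set s := ‖θ‖ ^ 2 with hs
  have hs0 : 0 ≤ s := sq_nonneg _
  have p1 : 0 ≤ Real.exp τ * Real.exp (-(c' * τ)) ^ n * Real.exp (-s) := by positivity
  have p2 : 0 ≤ L ^ 2 / (2 * (n * c)) * Real.exp (-(n * c / 2) * s) := by positivity
  have p3 := mul_nonneg (localError_nonneg (τ := τ) hγ hγ₁ n) (Real.exp_pos (-s)).le
  rw [neg_one_mul, add_mul]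
  rcases le_or_gt s τ with hθ | hθ
  · obtain ⟨l, u⟩ := hc θ hθ
    rw [← hs] at l u
    have hp : 0 ≤ (charFun μ θ).re := (Real.exp_pos _).le.trans l
    have h1 := (le_abs_self _).trans (h.abs_remainder_pow_le hγ hγ₁ hθ n)
    have h1' := (neg_le_abs _).trans (h.abs_remainder_pow_le hγ hγ₁ hθ n)
    rw [← hs] at h1 h1'
    have h2 : Real.exp (-(n * c') * s) ≤ (charFun μ θ).re ^ n := by
      refine le_trans (le_of_eq ?_) (pow_le_pow_left₀ (Real.exp_pos _).le l n)
      rw [← Real.exp_nat_mul]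
      congr 1
      ring
    have h3 : (charFun μ θ).re ^ n ≤ Real.exp (-(n * c * s)) := by
      refine (pow_le_pow_left₀ hp u n).trans_eq ?_
      rw [← Real.exp_nat_mul]
      congr 1
      ring
    have h4 : 1 - L ^ 2 * s / 2 ≤ Real.cos (inner ℝ x θ) := by
      have h5 : (inner ℝ x θ : ℝ) ^ 2 ≤ L ^ 2 * s := by
        rw [← sq_abs, hs, ← mul_pow]
        refine pow_le_pow_left₀ (abs_nonneg _) ((abs_real_inner_le_norm x θ).trans ?_) 2
        gcongr
      have h6 := Real.one_sub_sq_div_two_le_cos (x := (inner ℝ x θ : ℝ))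
      linarith
    have h5 : (charFun μ θ).re ^ n * (L ^ 2 * s / 2) ≤
        L ^ 2 / (2 * (n * c)) * Real.exp (-(n * c / 2) * s) := by
      have h6 := mul_exp_neg_le (t := n * c * s) (by positivity)
      calc _ ≤ Real.exp (-(n * c * s)) * (L ^ 2 * s / 2) := by gcongr
        _ = L ^ 2 / (2 * (n * c)) * (n * c * s * Real.exp (-(n * c * s))) := by
            field_simp
        _ ≤ L ^ 2 / (2 * (n * c)) * Real.exp (-(n * c * s / 2)) := by gcongr
        _ = _ := by congr 2; ring
    have h6 := mul_le_mul_of_nonneg_left h4 (pow_nonneg hp n)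
    set B := (charFun μ θ).re - γ * Real.exp (-s) with hB
    have h7 : Real.cos (inner ℝ x θ) * B ^ n ≤ Real.exp (-s) * localError γ τ n := by
      refine (le_abs_self _).trans ?_
      rw [abs_mul]
      exact (mul_le_of_le_one_left (abs_nonneg _) (Real.abs_cos_le_one _)).trans
        (h.abs_remainder_pow_le hγ hγ₁ hθ n)
    have h8 : Real.cos (inner ℝ x θ) * powDiff γ μ n θ =
      (charFun μ θ).re ^ n * Real.cos (inner ℝ x θ) - Real.cos (inner ℝ x θ) * B ^ n := by
      rw [powDiff, hB, hs]; ring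
    rw [h8]
    nlinarith
  · have h1 := h.abs_powDiff_le_of_lt hγ hγ₁ hθ n
    have h2 : -(Real.cos (inner ℝ x θ) * powDiff γ μ n θ) ≤ |powDiff γ μ n θ| := by
      refine (neg_le_abs _).trans ?_
      rw [abs_mul]
      exact mul_le_of_le_one_left (abs_nonneg _) (Real.abs_cos_le_one _)
    -- Far from the origin the Gaussian main term is not matched by the integrand and must be
    -- cancelled by the error. Since `n c' ≥ 1`, it decays beyond `s = τ` at least as fast as `exp
    -- (-s)`.
    have h3 : Real.exp (-(n * c') * s) ≤
        Real.exp τ * Real.exp (-(c' * τ)) ^ n * Real.exp (-s) := by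
      rw [← Real.exp_nat_mul, ← Real.exp_add, ← Real.exp_add]
      refine Real.exp_le_exp.2 ?_
      have : 1 ≤ n * c' := by nlinarith
      nlinarith
    rw [← hs] at h1
    linarith

/-- Upper bound in the local limit theorem, uniform in the step law. -/
theorem exists_convPow_le {γ δ : ℝ} (hγ : 0 < γ) (hγ₁ : γ < 1) (hδ : 0 < δ) (hδ₁ : δ < 1) :
    ∃ τ > 0, ∃ e : ℕ → ℝ, Summable e ∧ (∀ n, 0 ≤ e n) ∧
      ∀ η, 0 ≤ η → η ≤ τ → ∀ μ μ', IsStepLaw γ η μ μ' → ∀ n, 1 ≤ n →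
        convPow μ n ≤ ENNReal.ofReal (γ / (4 * Real.pi * (1 - δ)) / n + e n) • volume := by
  obtain ⟨τ, hτ, hτγ, H⟩ := exists_exp_bounds hγ hγ₁ hδ
  have h1γ : 0 ≤ 1 - γ := by linarith
  have h1γ' : 0 < 1 - γ := by linarith
  -- The first error comes from the Fourier integral. The second bounds the density of the `n`-th
  -- power of the remainder by `2 (1 - γ) ^ (n - 1)`, with the exponent rewritten to avoid
  -- subtraction.
  refine ⟨τ, hτ, fun n => (4 * Real.pi)⁻¹ * localError γ τ n + 2 * ((1 - γ)⁻¹ * (1 - γ) ^ n),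
    ?_, fun n => ?_, ?_⟩
  · exact ((summable_localError hγ hγ₁ hτ).mul_left _).add
      (((summable_geometric_of_lt_one h1γ (by linarith)).mul_left _).mul_left _)
  · have := localError_nonneg (τ := τ) hγ hγ₁ n
    have := Real.pi_pos
    positivity
  · intro η hη₀ hη μ μ' h n hn
    have hn0 : (1 : ℝ) ≤ n := by exact_mod_cast hn
    have := h.isFiniteMeasure
    have hl := localError_nonneg (τ := τ) hγ hγ₁ n
    have hpi := Real.pi_pos
    have hc : 0 < n * ((1 - δ) / γ) := by
      have : 0 < 1 - δ := by linarith
      positivity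
    rw [h.convPow_eq hγ]
    have h1 : convPow μ' n ≤ ENNReal.ofReal (2 * ((1 - γ)⁻¹ * (1 - γ) ^ n)) • volume := by
      obtain ⟨m, rfl⟩ := Nat.exists_eq_add_of_le' hn
      refine (convPow_succ_le μ' (h.le_two_smul_volume hγ hγ₁ hη₀ (hη.trans hτγ)) m).trans_eq ?_
      rw [h.remainder_univ hγ, ← ENNReal.ofReal_pow h1γ, ← ENNReal.ofReal_mul (by positivity)]
      congr 2
      rw [pow_succ]
      field_simp
    have h2 : ∀ x : Plane, (4 * Real.pi ^ 2)⁻¹ *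
        ∫ θ : Plane, Real.cos (inner ℝ x θ) * powDiff γ μ n θ ≤
        γ / (4 * Real.pi * (1 - δ)) / n + (4 * Real.pi)⁻¹ * localError γ τ n := by
      intro x
      have i1 := integrable_exp_neg_mul_sq_plane hc
      have i2 := (integrable_exp_neg_mul_sq_plane one_pos).const_mul (localError γ τ n)
      have := integral_mono (h.integrable_cos_mul_powDiff hγ hγ₁ n x) (i1.add i2)
        (fun θ => h.cos_mul_powDiff_le hγ hγ₁ (H η hη₀ hη μ μ' h) n x θ)
      rw [integral_add' i1 i2, integral_const_mul, integral_exp_neg_mul_sq_plane hc,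
        integral_exp_neg_mul_sq_plane one_pos] at this
      calc _ ≤ (4 * Real.pi ^ 2)⁻¹ * (Real.pi / (n * ((1 - δ) / γ)) +
            localError γ τ n * (Real.pi / 1)) := by gcongr
        _ = _ := by
          have : 1 - δ ≠ 0 := by linarith
          field_simp
    have h3 : volume.withDensity (fun x => ENNReal.ofReal ((4 * Real.pi ^ 2)⁻¹ *
        ∫ θ : Plane, Real.cos (inner ℝ x θ) * powDiff γ μ n θ)) ≤
        ENNReal.ofReal (γ / (4 * Real.pi * (1 - δ)) / n + (4 * Real.pi)⁻¹ * localError γ τ n) •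
          volume := by
      rw [← withDensity_const]
      exact withDensity_mono (ae_of_all _ fun x => ENNReal.ofReal_le_ofReal (h2 x))
    refine (add_le_add h3 h1).trans_eq ?_
    have : 0 < 1 - δ := by linarith
    rw [← add_smul, ← ENNReal.ofReal_add (by positivity) (by positivity), add_assoc]

/-- Lower bound in the local limit theorem, uniform in the step law. -/
theorem exists_le_convPow {γ δ : ℝ} (hγ : 0 < γ) (hγ₁ : γ < 1) (hδ : 0 < δ) (hδ₁ : δ < 1)
    (L : ℝ) :
    ∃ τ > 0, ∃ e : ℕ → ℝ, Summable e ∧ (∀ n, 0 ≤ e n) ∧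
      ∀ η, 0 ≤ η → η ≤ τ → ∀ μ μ', IsStepLaw γ η μ μ' → ∀ n, 1 ≤ n →
        ENNReal.ofReal (γ / (4 * Real.pi * (1 + δ)) / n - e n) •
          volume.restrict (Metric.closedBall 0 L) ≤ convPow μ n := by
  obtain ⟨τ, hτ, hτγ, H⟩ := exists_exp_bounds hγ hγ₁ hδ
  have h1γ : 0 ≤ 1 - γ := by linarith
  have hpi := Real.pi_pos
  have hd : 0 < 1 - δ := by linarith
  have hc' : 1 ≤ (1 + δ) / γ := by rw [le_div_iff₀ hγ]; linarith
  -- With `c = (1 - δ) / γ`, the cosine error integrates to `(4π²)⁻¹ · L² / (2 n c) · π / (n c / 2)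
  -- = L² / (4π c² n²)`.
  refine ⟨τ, hτ, fun n => (4 * Real.pi)⁻¹ * (L ^ 2 * (γ / (1 - δ)) ^ 2 * (1 / (n : ℝ) ^ 2)) +
    (4 * Real.pi)⁻¹ * (localError γ τ n + Real.exp τ * Real.exp (-((1 + δ) / γ * τ)) ^ n),
    ?_, fun n => ?_, ?_⟩
  · refine ((Summable.mul_left _ ?_).mul_left _).add (((summable_localError hγ hγ₁ hτ).add
      ((summable_geometric_of_lt_one (Real.exp_pos _).le ?_).mul_left _)).mul_left _)
    · exact Real.summable_one_div_nat_pow.2 (by norm_num)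
    · exact Real.exp_lt_one_iff.2 (by rw [neg_lt_zero]; positivity)
  · have := localError_nonneg (τ := τ) hγ hγ₁ n
    positivity
  · intro η hη₀ hη μ μ' h n hn
    have hn0 : (1 : ℝ) ≤ n := by exact_mod_cast hn
    have := h.isFiniteMeasure
    have hc : 0 < n * ((1 - δ) / γ) := by positivity
    have hc₁ : 0 < n * ((1 + δ) / γ) := by positivity
    rw [h.convPow_eq hγ]
    -- For a lower bound the power of the remainder is simply dropped.
    refine le_trans ?_ (Measure.le_add_right le_rfl)
    rw [← withDensity_const, ← withDensity_indicator measurableSet_closedBall]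
    refine withDensity_mono (ae_of_all _ fun x => ?_)
    by_cases hx : x ∈ Metric.closedBall (0 : Plane) L
    swap
    · rw [indicator_of_notMem hx]
      exact bot_le
    rw [indicator_of_mem hx]
    refine ENNReal.ofReal_le_ofReal ?_
    rw [mem_closedBall_zero_iff] at hx
    have i1 := integrable_exp_neg_mul_sq_plane hc₁
    have i2 := (integrable_exp_neg_mul_sq_plane (half_pos hc)).const_mul
      (L ^ 2 / (2 * (n * ((1 - δ) / γ))))
    have i3 := (integrable_exp_neg_mul_sq_plane one_pos).const_mul
      (localError γ τ n + Real.exp τ * Real.exp (-((1 + δ) / γ * τ)) ^ n)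
    have := integral_mono ((i1.sub i2).sub i3) (h.integrable_cos_mul_powDiff hγ hγ₁ n x)
      (fun θ => h.le_cos_mul_powDiff hγ hγ₁ (by positivity) hc' (H η hη₀ hη μ μ' h) hn hx θ)
    rw [integral_sub' (i1.sub i2) i3, integral_sub' i1 i2, integral_const_mul, integral_const_mul,
      integral_exp_neg_mul_sq_plane hc₁, integral_exp_neg_mul_sq_plane (half_pos hc),
      integral_exp_neg_mul_sq_plane one_pos] at this
    refine le_trans (le_of_eq ?_) (mul_le_mul_of_nonneg_left this
      (by positivity : 0 ≤ (4 * Real.pi ^ 2)⁻¹))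
    field_simp
    ring

end IsStepLaw

/-! ### Regeneration times of a coin sequence -/

/-- Expresses the length of a cycle through coins at the times following its start, so that fixing
the start turns it into a condition at deterministic times. -/
theorem regenerationTime_succ_eq_iff (η : ℕ → Bool) (n m : ℕ) :
    regenerationTime η (n + 1) = regenerationTime η n + m + 1 ↔
      (∀ j, regenerationTime η n < j → j ≤ regenerationTime η n + m → η j = false) ∧
        η (regenerationTime η n + m + 1) = true := by
  set t := regenerationTime η n with ht
  have e : regenerationTime η (n + 1) = sInf {j | t < j ∧ η j = true} := rfl
  rw [e]
  constructor
  · intro h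
    -- If there were no further success, the infimum would take the default value `0`, which is not
    -- `t + m + 1`.
    have hne : {j | t < j ∧ η j = true}.Nonempty := by
      by_contra hem
      rw [not_nonempty_iff_eq_empty.1 hem, Nat.sInf_empty] at h
      omega
    have hm := Nat.sInf_mem hne
    rw [h] at hm
    refine ⟨fun j hj hj' => ?_, hm.2⟩
    by_contra hη
    have := Nat.sInf_le (s := {j | t < j ∧ η j = true}) ⟨hj, by simpa using hη⟩
    omega
  · rintro ⟨h1, h2⟩
    have hmem : t + m + 1 ∈ {j | t < j ∧ η j = true} := ⟨by omega, h2⟩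
    refine le_antisymm (Nat.sInf_le hmem) (le_csInf ⟨_, hmem⟩ fun j hj => ?_)
    by_contra hlt
    have := h1 j hj.1 (by omega)
    rw [hj.2] at this
    cases this

theorem measurable_sInf_setOf {S : Type*} [MeasurableSpace S] {p : ℕ → S → Prop}
    (hp : ∀ j, MeasurableSet {ω | p j ω}) : Measurable fun ω => sInf {j | p j ω} := by
  refine measurable_to_countable' fun n => ?_
  -- The second set accounts for the default value `sInf ∅ = 0`.
  have e : (fun ω => sInf {j | p j ω}) ⁻¹' {n} =
      ({ω | p n ω} ∩ ⋂ j ∈ Finset.range n, {ω | p j ω}ᶜ) ∪ ({ω | n = 0} ∩ ⋂ j, {ω | p j ω}ᶜ) := by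
    ext ω
    simp only [mem_preimage, mem_singleton_iff, mem_union, mem_inter_iff, mem_ofPred_eq,
      mem_iInter, mem_compl_iff, Finset.mem_range]
    constructor
    · intro h
      by_cases hne : ∃ j, p j ω
      · left
        have hm : p (sInf {j | p j ω}) ω := Nat.sInf_mem hne
        rw [h] at hm
        refine ⟨hm, fun j hj hpj => ?_⟩
        have := Nat.sInf_le (s := {j | p j ω}) hpj
        omega
      · right
        push Not at hne
        refine ⟨?_, hne⟩
        rw [← h, eq_empty_of_forall_notMem (s := {j | p j ω}) hne, Nat.sInf_empty]
    · rintro (⟨h1, h2⟩ | ⟨rfl, h2⟩)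
      · refine le_antisymm (Nat.sInf_le h1) (le_csInf ⟨n, h1⟩ fun j hj => ?_)
        by_contra hlt
        exact h2 j (by omega) hj
      · rw [eq_empty_of_forall_notMem (s := {j | p j ω}) h2, Nat.sInf_empty]
  rw [e]
  refine ((hp n).inter (Finset.measurableSet_biInter _ fun j _ => (hp j).compl)).union
    (MeasurableSet.inter (MeasurableSet.const _) (MeasurableSet.iInter fun j => (hp j).compl))

theorem measurable_regenerationTime {S : Type*} [MeasurableSpace S] {η : ℕ → S → Bool}
    (hη : ∀ n, Measurable (η n)) (n : ℕ) :
    Measurable fun ω => regenerationTime (fun j => η j ω) n := by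
  induction n with
  | zero => exact measurable_const
  | succ n ih =>
    refine measurable_sInf_setOf (p := fun j ω =>
      regenerationTime (fun j => η j ω) n < j ∧ η j ω = true) fun j => ?_
    exact (measurableSet_lt ih measurable_const).inter
      (measurableSet_eq_fun (hη j) measurable_const)

/-! ### The cycles of a regenerative process -/

section Cycle

variable {S E : Type*} [MeasurableSpace S] [MeasurableSpace E]

/-- The law of `U (Z 0) + ⋯ + U (Z m)` for a Markov chain with transition kernel `r`. -/
noncomputable def cycleKernel (r : Kernel E E) (U : E → Plane) (hU : Measurable U) :
    ℕ → Kernel E Plane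
  | 0 => Kernel.deterministic U hU
  | m + 1 => (Kernel.deterministic U hU ×ₖ (cycleKernel r U hU m ∘ₖ r)).map fun p => p.1 + p.2

instance isMarkovKernel_cycleKernel (r : Kernel E E) [IsMarkovKernel r] (U : E → Plane)
    (hU : Measurable U) (m : ℕ) : IsMarkovKernel (cycleKernel r U hU m) := by
  induction m with
  | zero => rw [cycleKernel]; infer_instance
  | succ m ih =>
    rw [cycleKernel]
    exact Kernel.IsMarkovKernel.map _ (by fun_prop)

theorem lintegral_cycleKernel_succ (r : Kernel E E) [IsMarkovKernel r] {U : E → Plane}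
    (hU : Measurable U) (m : ℕ) (z : E) {f : Plane → ℝ≥0∞} (hf : Measurable f) :
    ∫⁻ x, f x ∂(cycleKernel r U hU (m + 1) z) =
      ∫⁻ z', ∫⁻ x, f (U z + x) ∂(cycleKernel r U hU m z') ∂(r z) := by
  have h1 : Measurable fun p : Plane × Plane => f (p.1 + p.2) := by fun_prop
  have h2 : Measurable fun x : Plane => f (U z + x) := by fun_prop
  rw [cycleKernel, Kernel.lintegral_map _ (by fun_prop) _ hf, Kernel.lintegral_prod _ _ _ h1,
    Kernel.lintegral_deterministic', Kernel.lintegral_comp _ _ _ h2]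
  exact Measurable.lintegral_prod_right' h1

/-- The law of the sum of `U` over one cycle of a regenerative process. -/
noncomputable def cycleLaw (γ : ℝ) (ν : Measure E) (r : Kernel E E) (U : E → Plane)
    (hU : Measurable U) : Measure Plane :=
  Measure.sum fun m : ℕ => ENNReal.ofReal (γ * (1 - γ) ^ m) • ν.bind (cycleKernel r U hU m)

/-- A process `Z` with coins `η` which restarts from `ν` on success and moves by `r` on failure. -/
structure IsRegenerativeProcess (P : Measure S) (ν : Measure E) (r : Kernel E E) (γ : ℝ)
    (Z : ℕ → S → E) (η : ℕ → S → Bool) : Prop where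
  measurable_chain : ∀ n, Measurable (Z n)
  measurable_coin : ∀ n, Measurable (η n)
  initial : P.map (Z 0) = ν
  coin : ∀ n, HasCondDistrib (η (n + 1)) (history Z η n)
    (Kernel.const _ (ENNReal.ofReal γ • Measure.dirac true +
      ENNReal.ofReal (1 - γ) • Measure.dirac false)) P
  step : ∀ n, HasCondDistrib (Z (n + 1)) (fun ω => (history Z η n ω, η (n + 1) ω))
      (coupledStep ν r n) P

namespace IsRegenerativeProcess

variable {P : Measure S} {ν : Measure E} {r : Kernel E E} {γ : ℝ} {Z : ℕ → S → E}
  {η : ℕ → S → Bool} {U : E → Plane}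

theorem measurable_history (h : IsRegenerativeProcess P ν r γ Z η) (n : ℕ) :
    Measurable (history Z η n) :=
  (measurable_pi_lambda (fun ω (i : Fin (n + 1)) => Z i ω) fun i => h.measurable_chain i).prodMk
    (measurable_pi_lambda (fun ω (i : Fin n) => η (i + 1) ω) fun i => h.measurable_coin (i + 1))

instance isMarkovKernel_coupledStep (ν : Measure E) [IsProbabilityMeasure ν] (r : Kernel E E)
    [IsMarkovKernel r] (n : ℕ) : IsMarkovKernel (coupledStep ν r n) := by
  unfold coupledStep
  infer_instance

/-- The two conditional laws are composed: first the new position given history and coin, then the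
coin given the history. Integrating the coin out leaves the weights `γ` and `1 - γ`. -/
theorem lintegral_step [IsProbabilityMeasure P] [IsProbabilityMeasure ν] [IsMarkovKernel r]
    (h : IsRegenerativeProcess P ν r γ Z η) (n : ℕ)
    {G : (((Fin (n + 1) → E) × (Fin n → Bool)) × Bool) × E → ℝ≥0∞} (hG : Measurable G) :
    ∫⁻ ω, G ((history Z η n ω, η (n + 1) ω), Z (n + 1) ω) ∂P =
      ∫⁻ ω, (ENNReal.ofReal γ * ∫⁻ z, G ((history Z η n ω, true), z) ∂ν +
        ENNReal.ofReal (1 - γ) * ∫⁻ z, G ((history Z η n ω, false), z) ∂(r (Z n ω))) ∂P := by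
  have hh := h.measurable_history n
  have hz := h.measurable_chain (n + 1)
  have hc := h.measurable_coin (n + 1)
  have hG1 : Measurable fun p => ∫⁻ z, G (p, z) ∂(coupledStep ν r n p) :=
    hG.lintegral_kernel_prod_right'
  have e1 := (h.step n).map_eq
  have e2 := (h.coin n).map_eq
  have : IsFiniteMeasure (ENNReal.ofReal γ • Measure.dirac true +
      ENNReal.ofReal (1 - γ) • Measure.dirac false) := by
    have h1 := (Measure.dirac true).smul_finite (ENNReal.ofReal_ne_top (r := γ))
    have h2 := (Measure.dirac false).smul_finite (ENNReal.ofReal_ne_top (r := 1 - γ))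
    infer_instance
  rw [← lintegral_map (f := G) hG ((hh.prodMk hc).prodMk hz), e1, Measure.lintegral_compProd hG,
    e2, Measure.lintegral_compProd hG1, lintegral_map (by
      refine Measurable.lintegral_kernel_prod_right' (κ := Kernel.const _ _) hG1) hh]
  refine lintegral_congr fun ω => ?_
  rw [Kernel.const_apply, lintegral_add_measure, lintegral_smul_measure, lintegral_smul_measure,
    lintegral_dirac, lintegral_dirac]
  simp [coupledStep, Kernel.piecewise_apply, history]

/-- The sum of `U` over a cycle of length `m + 1` started at time `t`. -/
theorem lintegral_cycle [IsProbabilityMeasure P] [IsProbabilityMeasure ν] [IsMarkovKernel r]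
    (h : IsRegenerativeProcess P ν r γ Z η) (hγ : 0 ≤ γ) (hγ₁ : γ ≤ 1) (hU : Measurable U)
    (m t : ℕ) {G : ((Fin (t + 1) → E) × (Fin t → Bool)) × Plane → ℝ≥0∞} (hG : Measurable G) :
    ∫⁻ ω, {ω | (∀ j, t < j → j ≤ t + m → η j ω = false) ∧ η (t + m + 1) ω = true}.indicator
      (fun ω => G (history Z η t ω, ∑ k ∈ Finset.Ico t (t + m + 1), U (Z k ω))) ω ∂P =
    ENNReal.ofReal (γ * (1 - γ) ^ m) *
      ∫⁻ ω, ∫⁻ x, G (history Z η t ω, x) ∂(cycleKernel r U hU m (Z t ω)) ∂P := by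
  induction m generalizing t with
  | zero =>
    set F : (((Fin (t + 1) → E) × (Fin t → Bool)) × Bool) × E → ℝ≥0∞ := fun p =>
      {p : (((Fin (t + 1) → E) × (Fin t → Bool)) × Bool) × E | p.1.2 = true}.indicator
        (fun p => G (p.1.1, U (p.1.1.1 (Fin.last t)))) p with hF
    have hFm : Measurable F := by
      refine Measurable.indicator ?_
        (measurableSet_eq_fun (measurable_snd.comp measurable_fst) measurable_const)
      refine hG.comp ((measurable_fst.comp measurable_fst).prodMk (hU.comp ?_))
      exact (measurable_pi_apply _).comp
        (measurable_fst.comp (measurable_fst.comp measurable_fst))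
    have e := h.lintegral_step t hFm
    have e1 : ∀ ω, {ω | (∀ j, t < j → j ≤ t + 0 → η j ω = false) ∧
        η (t + 0 + 1) ω = true}.indicator
        (fun ω => G (history Z η t ω, ∑ k ∈ Finset.Ico t (t + 0 + 1), U (Z k ω))) ω =
        F ((history Z η t ω, η (t + 1) ω), Z (t + 1) ω) := by
      intro ω
      have hp : ∀ j, t < j → j ≤ t + 0 → η j ω = false := fun j h1 h2 => by omega
      by_cases hη : η (t + 1) ω = true
      · simp only [hF]
        rw [indicator_of_mem, indicator_of_mem]
        · simp [history]
        · exact hη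
        · exact ⟨hp, hη⟩
      · simp only [hF]
        rw [indicator_of_notMem, indicator_of_notMem]
        · exact hη
        · exact fun hh => hη hh.2
    simp_rw [e1]
    rw [e, pow_zero, mul_one, ← lintegral_const_mul]
    · refine lintegral_congr fun ω => ?_
      have hGx : Measurable fun x => G (history Z η t ω, x) := hG.comp measurable_prodMk_left
      rw [cycleKernel, Kernel.lintegral_deterministic' _ hGx]
      simp [hF, history]
    · exact Measurable.lintegral_kernel_prod_right'
        (κ := (cycleKernel r U hU 0).comap (Z t) (h.measurable_chain t))
        (f := fun p : S × Plane => G (history Z η t p.1, p.2))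
        (hG.comp (((h.measurable_history t).comp measurable_fst).prodMk measurable_snd))
  | succ m ih =>
    -- The first step of the cycle moves into the test function: `G'` requires the coin at `t + 1`
    -- to fail and adds `U (Z t)` to the rest of the sum. The remaining `m` steps are then a cycle
    -- started at `t + 1`.
    set G' : ((Fin (t + 1 + 1) → E) × (Fin (t + 1) → Bool)) × Plane → ℝ≥0∞ := fun p =>
      {p : ((Fin (t + 1 + 1) → E) × (Fin (t + 1) → Bool)) × Plane |
        p.1.2 (Fin.last t) = false}.indicator
        (fun p => G ((fun i => p.1.1 i.castSucc, fun i => p.1.2 i.castSucc),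
          U (p.1.1 (Fin.last t).castSucc) + p.2)) p with hG'
    have hp1 : ∀ i, Measurable fun p : ((Fin (t + 1 + 1) → E) × (Fin (t + 1) → Bool)) × Plane =>
        p.1.1 i := fun i => (measurable_pi_apply _).comp (measurable_fst.comp measurable_fst)
    have hp2 : ∀ i, Measurable fun p : ((Fin (t + 1 + 1) → E) × (Fin (t + 1) → Bool)) × Plane =>
        p.1.2 i := fun i => (measurable_pi_apply _).comp (measurable_snd.comp measurable_fst)
    have hG'm : Measurable G' := by
      refine Measurable.indicator ?_ (measurableSet_eq_fun (hp2 _) measurable_const)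
      refine hG.comp (((measurable_pi_lambda _ fun i => hp1 _).prodMk
        (measurable_pi_lambda _ fun i => hp2 _)).prodMk ?_)
      exact (hU.comp (hp1 _)).add measurable_snd
    have e1 : ∀ ω, {ω | (∀ j, t < j → j ≤ t + (m + 1) → η j ω = false) ∧
        η (t + (m + 1) + 1) ω = true}.indicator
        (fun ω => G (history Z η t ω, ∑ k ∈ Finset.Ico t (t + (m + 1) + 1), U (Z k ω))) ω =
        {ω | (∀ j, t + 1 < j → j ≤ t + 1 + m → η j ω = false) ∧
        η (t + 1 + m + 1) ω = true}.indicator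
        (fun ω => G' (history Z η (t + 1) ω,
          ∑ k ∈ Finset.Ico (t + 1) (t + 1 + m + 1), U (Z k ω))) ω := by
      intro ω
      have a1 : t + (m + 1) + 1 = t + 1 + m + 1 := by ring
      have a2 : t + (m + 1) = t + 1 + m := by ring
      rw [a1, a2]
      by_cases hc : (∀ j, t + 1 < j → j ≤ t + 1 + m → η j ω = false) ∧
        η (t + 1 + m + 1) ω = true
      · rw [indicator_of_mem (s := {ω | (∀ j, t + 1 < j → j ≤ t + 1 + m → η j ω = false) ∧
          η (t + 1 + m + 1) ω = true}) hc]
        by_cases hη : η (t + 1) ω = false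
        · rw [indicator_of_mem]
          · simp only [hG']
            rw [indicator_of_mem]
            · rw [Finset.sum_eq_sum_Ico_succ_bot (by omega)]
              rfl
            · exact hη
          · refine ⟨fun j h1 h2 => ?_, hc.2⟩
            rcases Nat.eq_or_lt_of_le h1 with h3 | h3
            · rw [← h3]; exact hη
            · exact hc.1 j h3 h2
        · rw [indicator_of_notMem]
          · simp only [hG']
            rw [indicator_of_notMem]
            exact hη
          · exact fun hh => hη (hh.1 (t + 1) (by omega) (by omega))
      · rw [indicator_of_notMem, indicator_of_notMem (s := {ω | (∀ j, t + 1 < j →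
          j ≤ t + 1 + m → η j ω = false) ∧ η (t + 1 + m + 1) ω = true}) hc]
        exact fun hh => hc ⟨fun j h1 h2 => hh.1 j (by omega) h2, hh.2⟩
    simp_rw [e1]
    rw [ih (t + 1) hG'm]
    set F : (((Fin (t + 1) → E) × (Fin t → Bool)) × Bool) × E → ℝ≥0∞ := fun p =>
      {p : (((Fin (t + 1) → E) × (Fin t → Bool)) × Bool) × E | p.1.2 = false}.indicator
        (fun p => ∫⁻ x, G (p.1.1, U (p.1.1.1 (Fin.last t)) + x) ∂(cycleKernel r U hU m p.2)) p
      with hF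
    have hUl : Measurable fun p : (((Fin (t + 1) → E) × (Fin t → Bool)) × Bool) × E =>
        U (p.1.1.1 (Fin.last t)) := hU.comp ((measurable_pi_apply _).comp
        (measurable_fst.comp (measurable_fst.comp measurable_fst)))
    have hFm : Measurable F := by
      refine Measurable.indicator ?_
        (measurableSet_eq_fun (measurable_snd.comp measurable_fst) measurable_const)
      refine Measurable.lintegral_kernel_prod_right'
        (κ := (cycleKernel r U hU m).comap Prod.snd measurable_snd)
        (f := fun q : ((((Fin (t + 1) → E) × (Fin t → Bool)) × Bool) × E) × Plane =>
          G (q.1.1.1, U (q.1.1.1.1 (Fin.last t)) + q.2)) (hG.comp ?_)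
      exact (measurable_fst.comp (measurable_fst.comp measurable_fst)).prodMk
        ((hUl.comp measurable_fst).add measurable_snd)
    have e2 : ∀ ω, ∫⁻ x, G' (history Z η (t + 1) ω, x) ∂(cycleKernel r U hU m (Z (t + 1) ω)) =
        F ((history Z η t ω, η (t + 1) ω), Z (t + 1) ω) := by
      intro ω
      by_cases hη : η (t + 1) ω = false
      · simp only [hF]
        rw [indicator_of_mem]
        · refine lintegral_congr fun x => ?_
          simp only [hG']
          rw [indicator_of_mem]
          · rfl
          · exact hη
        · exact hη
      · simp only [hF]
        rw [indicator_of_notMem]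
        · rw [← lintegral_zero]
          refine lintegral_congr fun x => ?_
          simp only [hG']
          rw [indicator_of_notMem]
          exact hη
        · exact hη
    simp_rw [e2]
    have h1γ : 0 ≤ 1 - γ := by linarith
    -- `F` vanishes on success, so only the failure term remains. It supplies the additional factor
    -- `1 - γ` and the transition by `r` that turns the kernel for `m` into the one for `m + 1`.
    rw [h.lintegral_step t hFm, pow_succ, ← mul_assoc γ,
      ENNReal.ofReal_mul (by positivity : 0 ≤ γ * (1 - γ) ^ m), mul_assoc,
      ← lintegral_const_mul (ENNReal.ofReal (1 - γ))]
    · congr 1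
      refine lintegral_congr fun ω => ?_
      have hGx : Measurable fun x => G (history Z η t ω, x) := hG.comp measurable_prodMk_left
      rw [lintegral_cycleKernel_succ r hU m _ hGx]
      simp [hF, history]
    · exact Measurable.lintegral_kernel_prod_right'
        (κ := (cycleKernel r U hU (m + 1)).comap (Z t) (h.measurable_chain t))
        (f := fun p : S × Plane => G (history Z η t p.1, p.2))
        (hG.comp (((h.measurable_history t).comp measurable_fst).prodMk measurable_snd))

end IsRegenerativeProcess

end Cycle

/-! ### Independence of the cycles -/

section Renewal

variable {S E : Type*}

/-- The sum of `U` over the cycle number `i` of a process with coins `η`. -/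
noncomputable def cycleSum (U : E → Plane) (Z : ℕ → S → E) (η : ℕ → S → Bool) (i : ℕ) (ω : S) :
    Plane :=
  ∑ k ∈ Finset.Ico (regenerationTime (fun j => η j ω) i)
    (regenerationTime (fun j => η j ω) (i + 1)), U (Z k ω)

/-- The first `n` cycles are proper, have sums in `B 0, …, B (n - 1)`, and end at time `t`. -/
def cycleEvent (U : E → Plane) (Z : ℕ → S → E) (η : ℕ → S → Bool) (B : ℕ → Set Plane)
    (n t : ℕ) : Set S :=
  {ω | (∀ i < n, cycleSum U Z η i ω ∈ B i ∧ regenerationTime (fun j => η j ω) i <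
    regenerationTime (fun j => η j ω) (i + 1)) ∧ regenerationTime (fun j => η j ω) n = t}

/-- The coins fail at the times `t + 1, …, t + m`, succeed at `t + m + 1`, and the sum of `U` from
time `t` to time `t + m` is in `B`. -/
def singleCycleEvent (U : E → Plane) (Z : ℕ → S → E) (η : ℕ → S → Bool) (B : Set Plane)
    (t m : ℕ) : Set S :=
  {ω | ((∀ j, t < j → j ≤ t + m → η j ω = false) ∧ η (t + m + 1) ω = true) ∧
    ∑ k ∈ Finset.Ico t (t + m + 1), U (Z k ω) ∈ B}

/-- Once the first `n` cycles are known to end at `t`, the next cycle is described by coins and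
positions at fixed times. This replaces a strong Markov property at random times. -/
theorem cycleEvent_inter_singleCycleEvent (U : E → Plane) (Z : ℕ → S → E) (η : ℕ → S → Bool)
    (B : ℕ → Set Plane) (n t m : ℕ) :
    cycleEvent U Z η B n t ∩ singleCycleEvent U Z η (B n) t m =
      cycleEvent U Z η B n t ∩ cycleEvent U Z η B (n + 1) (t + m + 1) := by
  ext ω
  simp only [mem_inter_iff, and_congr_right_iff]
  rintro ⟨h1, rfl⟩
  have h := regenerationTime_succ_eq_iff (fun j => η j ω) n m
  constructor
  · rintro ⟨h2, h3⟩
    have h4 := h.2 h2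
    refine ⟨fun i hi => ?_, h4⟩
    rcases Nat.lt_succ_iff_lt_or_eq.1 hi with hi | rfl
    · exact h1 i hi
    · refine ⟨?_, by omega⟩
      rw [cycleSum, h4]
      exact h3
  · rintro ⟨h2, h3⟩
    refine ⟨h.1 h3, ?_⟩
    have := (h2 n (by omega)).1
    rwa [cycleSum, h3] at this

theorem cycleEvent_succ (U : E → Plane) (Z : ℕ → S → E) (η : ℕ → S → Bool)
    (B : ℕ → Set Plane) (n u : ℕ) :
    cycleEvent U Z η B (n + 1) (u + 1) = ⋃ t, ⋃ m, ⋃ (_ : t + m = u),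
      cycleEvent U Z η B n t ∩ singleCycleEvent U Z η (B n) t m := by
  ext ω
  simp only [mem_iUnion, exists_prop]
  constructor
  · intro h
    have hlt := (h.1 n (by omega)).2
    have h2 := h.2
    refine ⟨regenerationTime (fun j => η j ω) n, u - regenerationTime (fun j => η j ω) n,
      by omega, ?_⟩
    rw [cycleEvent_inter_singleCycleEvent]
    refine ⟨⟨fun i hi => h.1 i (by omega), rfl⟩, ?_⟩
    have e : regenerationTime (fun j => η j ω) n + (u - regenerationTime (fun j => η j ω) n) + 1
      = u + 1 := by omega
    rw [e]
    exact h
  · rintro ⟨t, m, rfl, h⟩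
    rw [cycleEvent_inter_singleCycleEvent] at h
    exact h.2

/-- A proper cycle has positive length, so at least one of them cannot end at time `0`. -/
theorem cycleEvent_succ_zero (U : E → Plane) (Z : ℕ → S → E) (η : ℕ → S → Bool)
    (B : ℕ → Set Plane) (n : ℕ) : cycleEvent U Z η B (n + 1) 0 = ∅ := by
  ext ω
  simp only [mem_empty_iff_false, iff_false]
  intro h
  have hlt := (h.1 n (by omega)).2
  rw [h.2] at hlt
  omega

theorem iUnion_cycleEvent_succ (U : E → Plane) (Z : ℕ → S → E) (η : ℕ → S → Bool)
    (B : ℕ → Set Plane) (n : ℕ) :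
    ⋃ t, cycleEvent U Z η B (n + 1) t = ⋃ q : ℕ × ℕ,
      cycleEvent U Z η B n q.1 ∩ singleCycleEvent U Z η (B n) q.1 q.2 := by
  ext ω
  simp only [mem_iUnion]
  constructor
  · rintro ⟨t, ht⟩
    cases t with
    | zero => rw [cycleEvent_succ_zero] at ht; exact ht.elim
    | succ u =>
      rw [cycleEvent_succ] at ht
      simp only [mem_iUnion] at ht
      obtain ⟨t, m, -, h⟩ := ht
      exact ⟨(t, m), h⟩
  · rintro ⟨⟨t, m⟩, h⟩
    rw [cycleEvent_inter_singleCycleEvent] at h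
    exact ⟨_, h.2⟩

theorem pairwise_disjoint_cycleEvent (U : E → Plane) (Z : ℕ → S → E) (η : ℕ → S → Bool)
    (B : ℕ → Set Plane) (n : ℕ) :
    Pairwise (Function.onFun Disjoint (cycleEvent U Z η B n)) := by
  intro s t hst
  refine disjoint_left.2 fun ω h1 h2 => hst ?_
  rw [← h1.2, h2.2]

theorem pairwise_disjoint_cycleEvent_inter (U : E → Plane) (Z : ℕ → S → E) (η : ℕ → S → Bool)
    (B : ℕ → Set Plane) (n : ℕ) :
    Pairwise (Function.onFun Disjoint fun q : ℕ × ℕ =>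
      cycleEvent U Z η B n q.1 ∩ singleCycleEvent U Z η (B n) q.1 q.2) := by
  rintro ⟨s, l⟩ ⟨t, m⟩ hst
  refine disjoint_left.2 fun ω h1 h2 => hst ?_
  dsimp only at h1 h2
  rw [cycleEvent_inter_singleCycleEvent] at h1 h2
  have e1 : s = t := by rw [← h1.1.2, h2.1.2]
  have e2 : s + l + 1 = t + m + 1 := by rw [← h1.2.2, h2.2.2]
  simp only [Prod.mk.injEq]
  omega

/-! ### The filtration generated by the histories -/

section History

variable [MeasurableSpace E] {Z : ℕ → S → E} {η : ℕ → S → Bool}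

theorem measurable_chain_history {k n : ℕ} (hk : k ≤ n) :
    Measurable[MeasurableSpace.comap (history Z η n) inferInstance] (Z k) := by
  have e : Z k = (fun q : (Fin (n + 1) → E) × (Fin n → Bool) => q.1 ⟨k, by omega⟩) ∘
    history Z η n := rfl
  rw [e]
  exact Measurable.comp ((measurable_pi_apply _).comp measurable_fst) (comap_measurable _)

theorem measurable_coin_history {k n : ℕ} (hk : 0 < k) (hkn : k ≤ n) :
    Measurable[MeasurableSpace.comap (history Z η n) inferInstance] (η k) := by
  obtain ⟨k, rfl⟩ := Nat.exists_eq_add_of_lt hk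
  simp only [zero_add] at *
  have e : η (k + 1) = (fun q : (Fin (n + 1) → E) × (Fin n → Bool) => q.2 ⟨k, by omega⟩) ∘
    history Z η n := rfl
  rw [e]
  exact Measurable.comp ((measurable_pi_apply _).comp measurable_snd) (comap_measurable _)

theorem comap_history_mono {m n : ℕ} (hmn : m ≤ n) :
    MeasurableSpace.comap (history Z η m) inferInstance ≤
      MeasurableSpace.comap (history Z η n) inferInstance := by
  let _ : MeasurableSpace S := MeasurableSpace.comap (history Z η n) inferInstance
  refine Measurable.comap_le ?_
  refine Measurable.prodMk ?_ ?_
  · exact measurable_pi_lambda _ fun i => measurable_chain_history (by omega)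
  · exact measurable_pi_lambda _ fun i => measurable_coin_history (by omega) (by omega)

end History

variable [MeasurableSpace S] [MeasurableSpace E]

namespace IsRegenerativeProcess

variable {P : Measure S} {ν : Measure E} {r : Kernel E E} {γ : ℝ} {Z : ℕ → S → E}
  {η : ℕ → S → Bool} {U : E → Plane}

/-- On success the new position is drawn from `ν` whatever the history, so it is independent of
every event that combines the past with this success. -/
theorem lintegral_success [IsProbabilityMeasure P] [IsProbabilityMeasure ν] [IsMarkovKernel r]
    (h : IsRegenerativeProcess P ν r γ Z η) (n : ℕ) {D : Set S}
    (hD : MeasurableSet[MeasurableSpace.comap (history Z η n) inferInstance] D)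
    {Φ : E → ℝ≥0∞} (hΦ : Measurable Φ) :
    ∫⁻ ω in D ∩ {ω | η (n + 1) ω = true}, Φ (Z (n + 1) ω) ∂P =
      P (D ∩ {ω | η (n + 1) ω = true}) * ∫⁻ z, Φ z ∂ν := by
  obtain ⟨A, hA, rfl⟩ := hD
  have hDm : MeasurableSet (history Z η n ⁻¹' A) := h.measurable_history n hA
  have hηm : MeasurableSet {ω | η (n + 1) ω = true} :=
    measurableSet_eq_fun (h.measurable_coin (n + 1)) measurable_const
  have key : ∀ Φ : E → ℝ≥0∞, Measurable Φ →
      ∫⁻ ω in history Z η n ⁻¹' A ∩ {ω | η (n + 1) ω = true}, Φ (Z (n + 1) ω) ∂P =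
        ENNReal.ofReal γ * (∫⁻ z, Φ z ∂ν) * P (history Z η n ⁻¹' A) := by
    intro Φ hΦ
    set F : (((Fin (n + 1) → E) × (Fin n → Bool)) × Bool) × E → ℝ≥0∞ := fun p =>
      {p : (((Fin (n + 1) → E) × (Fin n → Bool)) × Bool) × E | p.1.1 ∈ A ∧ p.1.2 = true}.indicator
        (fun p => Φ p.2) p with hF
    have hFm : Measurable F := (hΦ.comp measurable_snd).indicator
      (((measurable_fst.comp measurable_fst) hA).inter
        (measurableSet_eq_fun (measurable_snd.comp measurable_fst) measurable_const))
    rw [← lintegral_indicator (hDm.inter hηm)]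
    have e1 : ∀ ω, (history Z η n ⁻¹' A ∩ {ω | η (n + 1) ω = true}).indicator
        (fun ω => Φ (Z (n + 1) ω)) ω = F ((history Z η n ω, η (n + 1) ω), Z (n + 1) ω) :=
      fun ω => rfl
    simp_rw [e1]
    rw [h.lintegral_step n hFm, ← setLIntegral_const, ← lintegral_indicator hDm]
    refine lintegral_congr fun ω => ?_
    by_cases hω : history Z η n ω ∈ A
    · rw [indicator_of_mem (s := history Z η n ⁻¹' A) hω]
      simp [hF, indicator, hω]
    · rw [indicator_of_notMem (s := history Z η n ⁻¹' A) hω]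
      simp [hF, indicator, hω]
  rw [key Φ hΦ]
  -- The case `Φ = 1` identifies `γ P(D)` with the probability of `D` together with success.
  have h1 := key (fun _ => 1) measurable_const
  rw [setLIntegral_one, lintegral_one, measure_univ, mul_one] at h1
  rw [h1]
  ring

theorem measurable_cycleSum (h : IsRegenerativeProcess P ν r γ Z η) (hU : Measurable U) (i : ℕ) :
    Measurable (cycleSum U Z η i) := by
  have h1 : Measurable fun p : (ℕ × ℕ) × S => ∑ k ∈ Finset.Ico p.1.1 p.1.2, U (Z k p.2) := by
    refine measurable_from_prod_countable_right fun q => ?_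
    exact Finset.measurable_sum (Finset.Ico q.1 q.2) fun k _ => hU.comp (h.measurable_chain k)
  exact h1.comp (((measurable_regenerationTime h.measurable_coin i).prodMk
    (measurable_regenerationTime h.measurable_coin (i + 1))).prodMk measurable_id)

theorem measurableSet_cycleEvent (h : IsRegenerativeProcess P ν r γ Z η) (hU : Measurable U)
    {B : ℕ → Set Plane} (hB : ∀ i, MeasurableSet (B i)) (n t : ℕ) :
    MeasurableSet (cycleEvent U Z η B n t) := by
  have hT := measurable_regenerationTime h.measurable_coin
  have e : cycleEvent U Z η B n t = (⋂ i ∈ Finset.range n, (cycleSum U Z η i ⁻¹' B i ∩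
      {ω | regenerationTime (fun j => η j ω) i < regenerationTime (fun j => η j ω) (i + 1)})) ∩
      {ω | regenerationTime (fun j => η j ω) n = t} := by
    ext ω
    simp [cycleEvent]
  rw [e]
  refine MeasurableSet.inter (Finset.measurableSet_biInter _ fun i _ => ?_)
    (measurableSet_eq_fun (hT n) measurable_const)
  exact (h.measurable_cycleSum hU i (hB i)).inter (measurableSet_lt (hT i) (hT (i + 1)))

theorem measurableSet_singleCycleEvent (h : IsRegenerativeProcess P ν r γ Z η)
    (hU : Measurable U) {B : Set Plane} (hB : MeasurableSet B) (t m : ℕ) :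
    MeasurableSet (singleCycleEvent U Z η B t m) := by
  have e : singleCycleEvent U Z η B t m = ((⋂ j ∈ Finset.Ioc t (t + m), {ω | η j ω = false}) ∩
      {ω | η (t + m + 1) ω = true}) ∩
      (fun ω => ∑ k ∈ Finset.Ico t (t + m + 1), U (Z k ω)) ⁻¹' B := by
    ext ω
    simp [singleCycleEvent]
  rw [e]
  refine MeasurableSet.inter (MeasurableSet.inter (Finset.measurableSet_biInter _ fun i _ => ?_)
    ?_) ?_
  · exact measurableSet_eq_fun (h.measurable_coin i) measurable_const
  · exact measurableSet_eq_fun (h.measurable_coin _) measurable_const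
  · exact (Finset.measurable_sum _ fun k _ => hU.comp (h.measurable_chain k)) hB

/-- The position at the end of a cycle is independent of the cycles up to then. -/
theorem cycleEvent_fresh [IsProbabilityMeasure P] [IsProbabilityMeasure ν] [IsMarkovKernel r]
    (h : IsRegenerativeProcess P ν r γ Z η) (hU : Measurable U) {B : ℕ → Set Plane}
    (hB : ∀ i, MeasurableSet (B i)) (n t : ℕ) :
    MeasurableSet[MeasurableSpace.comap (history Z η t) inferInstance] (cycleEvent U Z η B n t) ∧
      ∀ Φ : E → ℝ≥0∞, Measurable Φ → ∫⁻ ω in cycleEvent U Z η B n t, Φ (Z t ω) ∂P =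
        P (cycleEvent U Z η B n t) * ∫⁻ z, Φ z ∂ν := by
  induction n generalizing t with
  | zero =>
    cases t with
    | zero =>
      have e : cycleEvent U Z η B 0 0 = univ := by
        ext ω
        simp [cycleEvent, regenerationTime]
      rw [e]
      refine ⟨MeasurableSet.univ, fun Φ hΦ => ?_⟩
      rw [setLIntegral_univ, measure_univ, one_mul, ← h.initial,
        lintegral_map hΦ (h.measurable_chain 0)]
    | succ t =>
      have e : cycleEvent U Z η B 0 (t + 1) = ∅ := by
        ext ω
        simp [cycleEvent, regenerationTime]
      rw [e]
      exact ⟨@MeasurableSet.empty _ (_), fun Φ hΦ => by simp⟩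
  | succ n ih =>
    cases t with
    | zero =>
      rw [cycleEvent_succ_zero]
      exact ⟨@MeasurableSet.empty _ (_), fun Φ hΦ => by simp⟩
    | succ u =>
      -- The event with its final success removed. The last cycle sums `U` only up to time `u`, so
      -- `D` belongs to the history up to `u`, as `lintegral_success` requires.
      set D : Set S := ⋃ t, ⋃ m, ⋃ (_ : t + m = u), cycleEvent U Z η B n t ∩
        ({ω | ∀ j, t < j → j ≤ t + m → η j ω = false} ∩
          {ω | ∑ k ∈ Finset.Ico t (t + m + 1), U (Z k ω) ∈ B n}) with hD
      have e : cycleEvent U Z η B (n + 1) (u + 1) = D ∩ {ω | η (u + 1) ω = true} := by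
        rw [cycleEvent_succ]
        ext ω
        simp only [hD, mem_iUnion, mem_inter_iff, exists_prop, singleCycleEvent, mem_ofPred_eq]
        constructor
        · rintro ⟨t, m, rfl, h1, ⟨h2, h3⟩, h4⟩
          exact ⟨⟨t, m, rfl, h1, h2, h4⟩, h3⟩
        · rintro ⟨⟨t, m, rfl, h1, h2, h4⟩, h3⟩
          exact ⟨t, m, rfl, h1, ⟨h2, h3⟩, h4⟩
      have hDm : MeasurableSet[MeasurableSpace.comap (history Z η u) inferInstance] D := by
        refine MeasurableSet.iUnion fun t => MeasurableSet.iUnion fun m =>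
          MeasurableSet.iUnion fun htm => ?_
        refine MeasurableSet.inter (comap_history_mono (by omega) _ (ih t).1)
          (MeasurableSet.inter ?_ ?_)
        · have e2 : {ω | ∀ j, t < j → j ≤ t + m → η j ω = false} =
              ⋂ j ∈ Finset.Ioc t (t + m), η j ⁻¹' {false} := by
            ext ω
            simp
          rw [e2]
          refine Finset.measurableSet_biInter _ fun j hj => ?_
          rw [Finset.mem_Ioc] at hj
          exact measurable_coin_history (by omega) (by omega) (measurableSet_singleton _)
        · have h3 : Measurable[MeasurableSpace.comap (history Z η u) inferInstance]
              fun ω => ∑ k ∈ Finset.Ico t (t + m + 1), U (Z k ω) := by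
            refine Finset.measurable_sum _ fun k hk => ?_
            rw [Finset.mem_Ico] at hk
            exact hU.comp (measurable_chain_history (by omega))
          exact h3 (hB n)
      rw [e]
      refine ⟨MeasurableSet.inter (comap_history_mono (by omega) _ hDm) ?_, fun Φ hΦ => ?_⟩
      · exact measurable_coin_history (n := u + 1) (by omega) le_rfl (measurableSet_singleton true)
      · exact h.lintegral_success u hDm hΦ

/-- `lintegral_cycle` gives the law of the next cycle started from `Z t`; by `cycleEvent_fresh`, `Z
t` has law `ν` independently of the earlier cycles, so the probability factors. -/
theorem measure_cycleEvent_inter [IsProbabilityMeasure P] [IsProbabilityMeasure ν]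
    [IsMarkovKernel r] (h : IsRegenerativeProcess P ν r γ Z η) (hγ : 0 ≤ γ) (hγ₁ : γ ≤ 1)
    (hU : Measurable U) {B : ℕ → Set Plane} (hB : ∀ i, MeasurableSet (B i)) (n t m : ℕ) :
    P (cycleEvent U Z η B n t ∩ singleCycleEvent U Z η (B n) t m) =
      P (cycleEvent U Z η B n t) * (ENNReal.ofReal (γ * (1 - γ) ^ m) *
        ν.bind (cycleKernel r U hU m) (B n)) := by
  obtain ⟨⟨A, hA, hAe⟩, hΦ⟩ := h.cycleEvent_fresh hU hB n t
  have hm := (h.measurableSet_cycleEvent hU hB n t).inter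
    (h.measurableSet_singleCycleEvent hU (hB n) t m)
  -- The past event is the preimage of `A` under the history, so this test function encodes past and
  -- new sum together.
  set G : ((Fin (t + 1) → E) × (Fin t → Bool)) × Plane → ℝ≥0∞ :=
    (A ×ˢ B n).indicator 1 with hG
  have hGm : Measurable G := measurable_one.indicator (hA.prod (hB n))
  have hl := h.lintegral_cycle hγ hγ₁ hU m t hGm
  have hk : Measurable fun z => cycleKernel r U hU m z (B n) :=
    (cycleKernel r U hU m).measurable_coe (hB n)
  have e1 : ∀ ω, {ω | (∀ j, t < j → j ≤ t + m → η j ω = false) ∧ η (t + m + 1) ω = true}.indicator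
      (fun ω => G (history Z η t ω, ∑ k ∈ Finset.Ico t (t + m + 1), U (Z k ω))) ω =
      (cycleEvent U Z η B n t ∩ singleCycleEvent U Z η (B n) t m).indicator 1 ω := by
    intro ω
    have hAω : ω ∈ cycleEvent U Z η B n t ↔ history Z η t ω ∈ A := by rw [← hAe]; rfl
    have hs : ω ∈ cycleEvent U Z η B n t ∩ singleCycleEvent U Z η (B n) t m ↔
        ((∀ j, t < j → j ≤ t + m → η j ω = false) ∧ η (t + m + 1) ω = true) ∧
        (history Z η t ω, ∑ k ∈ Finset.Ico t (t + m + 1), U (Z k ω)) ∈ A ×ˢ B n := by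
      rw [mem_inter_iff, hAω, mem_prod]
      exact and_left_comm
    by_cases hc : (∀ j, t < j → j ≤ t + m → η j ω = false) ∧ η (t + m + 1) ω = true
    · rw [indicator_of_mem (s := {ω | (∀ j, t < j → j ≤ t + m → η j ω = false) ∧
        η (t + m + 1) ω = true}) hc]
      by_cases hd : (history Z η t ω, ∑ k ∈ Finset.Ico t (t + m + 1), U (Z k ω)) ∈ A ×ˢ B n
      · rw [indicator_of_mem (hs.2 ⟨hc, hd⟩), hG, indicator_of_mem hd]
        rfl
      · rw [indicator_of_notMem (fun hh => hd (hs.1 hh).2), hG, indicator_of_notMem hd]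
    · rw [indicator_of_notMem (s := {ω | (∀ j, t < j → j ≤ t + m → η j ω = false) ∧
        η (t + m + 1) ω = true}) hc, indicator_of_notMem (fun hh => hc (hs.1 hh).1)]
  simp_rw [e1] at hl
  rw [lintegral_indicator_one hm] at hl
  have e2 : ∀ ω, ∫⁻ x, G (history Z η t ω, x) ∂(cycleKernel r U hU m (Z t ω)) =
      (cycleEvent U Z η B n t).indicator (fun ω => cycleKernel r U hU m (Z t ω) (B n)) ω := by
    intro ω
    have hAω : ω ∈ cycleEvent U Z η B n t ↔ history Z η t ω ∈ A := by rw [← hAe]; rfl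
    by_cases hω : ω ∈ cycleEvent U Z η B n t
    · rw [indicator_of_mem hω, ← lintegral_indicator_one (hB n)]
      refine lintegral_congr fun x => ?_
      have hA' := hAω.1 hω
      by_cases hx : x ∈ B n <;> simp [hG, hA', hx]
    · rw [indicator_of_notMem hω, ← lintegral_zero]
      refine lintegral_congr fun x => ?_
      have : history Z η t ω ∉ A := fun hh => hω (hAω.2 hh)
      simp [hG, this]
  simp_rw [e2] at hl
  rw [lintegral_indicator (h.measurableSet_cycleEvent hU hB n t), hΦ _ hk] at hl
  rw [hl, Measure.bind_apply (hB n) (cycleKernel r U hU m).aemeasurable]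
  ring

/-- Summing the factorization over all lengths of the last cycle produces `cycleLaw`; summing over
all start times of that cycle returns the event for the earlier ones. -/
theorem measure_iUnion_cycleEvent [IsProbabilityMeasure P] [IsProbabilityMeasure ν]
    [IsMarkovKernel r] (h : IsRegenerativeProcess P ν r γ Z η) (hγ : 0 ≤ γ) (hγ₁ : γ ≤ 1)
    (hU : Measurable U) {B : ℕ → Set Plane} (hB : ∀ i, MeasurableSet (B i)) (n : ℕ) :
    P (⋃ t, cycleEvent U Z η B n t) = ∏ i ∈ Finset.range n, cycleLaw γ ν r U hU (B i) := by
  induction n with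
  | zero =>
    have e : ⋃ t, cycleEvent U Z η B 0 t = univ := by
      ext ω
      simp [cycleEvent]
    rw [e]
    simp
  | succ n ih =>
    rw [iUnion_cycleEvent_succ, measure_iUnion (pairwise_disjoint_cycleEvent_inter U Z η B n)
      (fun q => (h.measurableSet_cycleEvent hU hB n q.1).inter
        (h.measurableSet_singleCycleEvent hU (hB n) q.1 q.2)), ENNReal.tsum_prod (f := fun t m =>
        P (cycleEvent U Z η B n t ∩ singleCycleEvent U Z η (B n) t m)),
      Finset.prod_range_succ, ← ih, measure_iUnion (pairwise_disjoint_cycleEvent U Z η B n)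
      (fun t => h.measurableSet_cycleEvent hU hB n t), ← ENNReal.tsum_mul_right]
    refine tsum_congr fun t => ?_
    simp_rw [h.measure_cycleEvent_inter hγ hγ₁ hU hB]
    rw [ENNReal.tsum_mul_left, cycleLaw, Measure.sum_apply _ (hB n)]
    simp only [Measure.smul_apply, smul_eq_mul]

theorem cycleLaw_univ [IsProbabilityMeasure ν] [IsMarkovKernel r] (hγ : 0 < γ) (hγ₁ : γ ≤ 1)
    (hU : Measurable U) : cycleLaw γ ν r U hU univ = 1 := by
  rw [cycleLaw, Measure.sum_apply _ MeasurableSet.univ]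
  have e : ∀ m, (ENNReal.ofReal (γ * (1 - γ) ^ m) • ν.bind (cycleKernel r U hU m)) univ =
      ENNReal.ofReal (γ * (1 - γ) ^ m) := by
    intro m
    rw [Measure.smul_apply, smul_eq_mul, measure_univ, mul_one]
  have h1 : 0 ≤ 1 - γ := by linarith
  have hs := hasSum_geometric_of_lt_one h1 (by linarith)
  simp_rw [e]
  rw [← ENNReal.ofReal_tsum_of_nonneg (fun m => by positivity) (hs.summable.mul_left γ),
    tsum_mul_left, hs.tsum_eq, sub_sub_cancel, mul_inv_cancel₀ hγ.ne', ENNReal.ofReal_one]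

/-- With every target set equal to the whole plane the product formula gives probability `1`. Hence
the default value of the infimum is almost surely never taken. -/
theorem ae_regenerationTime_lt [IsProbabilityMeasure P] [IsProbabilityMeasure ν]
    [IsMarkovKernel r] (h : IsRegenerativeProcess P ν r γ Z η) (hγ : 0 < γ) (hγ₁ : γ ≤ 1)
    (hU : Measurable U) : ∀ᵐ ω ∂P, ∀ i,
      regenerationTime (fun j => η j ω) i < regenerationTime (fun j => η j ω) (i + 1) := by
  rw [ae_all_iff]
  intro n
  have h1 := h.measure_iUnion_cycleEvent hγ.le hγ₁ hU (B := fun _ => univ)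
    (fun _ => MeasurableSet.univ) (n + 1)
  simp only [cycleLaw_univ hγ hγ₁ hU, Finset.prod_const_one] at h1
  have h2 := (prob_compl_eq_zero_iff (MeasurableSet.iUnion fun t =>
    h.measurableSet_cycleEvent hU (fun _ => MeasurableSet.univ) (n + 1) t)).2 h1
  have h3 : ∀ᵐ ω ∂P, ω ∈ ⋃ t, cycleEvent U Z η (fun _ => univ) (n + 1) t := h2
  filter_upwards [h3] with ω hω
  obtain ⟨t, ht⟩ := mem_iUnion.1 hω
  exact (ht.1 n (by omega)).2

theorem measure_cycleSum_mem [IsProbabilityMeasure P] [IsProbabilityMeasure ν]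
    [IsMarkovKernel r] (h : IsRegenerativeProcess P ν r γ Z η) (hγ : 0 < γ) (hγ₁ : γ ≤ 1)
    (hU : Measurable U) {B : ℕ → Set Plane} (hB : ∀ i, MeasurableSet (B i)) (n : ℕ) :
    P {ω | ∀ i < n, cycleSum U Z η i ω ∈ B i} =
      ∏ i ∈ Finset.range n, cycleLaw γ ν r U hU (B i) := by
  rw [← h.measure_iUnion_cycleEvent hγ.le hγ₁ hU hB n]
  refine measure_congr ?_
  filter_upwards [h.ae_regenerationTime_lt hγ hγ₁ hU] with ω hω
  refine propext ⟨fun hh => ?_, fun hh => ?_⟩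
  · exact mem_iUnion.2 ⟨_, fun i hi => ⟨hh i hi, hω i⟩, rfl⟩
  · obtain ⟨t', ht', -⟩ := mem_iUnion.1 hh
    exact fun i hi => (ht' i hi).1

theorem map_cycleSum [IsProbabilityMeasure P] [IsProbabilityMeasure ν]
    [IsMarkovKernel r] (h : IsRegenerativeProcess P ν r γ Z η) (hγ : 0 < γ) (hγ₁ : γ ≤ 1)
    (hU : Measurable U) (i : ℕ) : P.map (cycleSum U Z η i) = cycleLaw γ ν r U hU := by
  ext A hA
  rw [Measure.map_apply (h.measurable_cycleSum hU i) hA]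
  -- Only the sum number `i` is constrained; the other factors are total masses equal to `1`.
  have h1 := h.measure_cycleSum_mem hγ hγ₁ hU (B := fun j => if j = i then A else univ)
    (fun j => by split_ifs; exacts [hA, MeasurableSet.univ]) (i + 1)
  rw [Finset.prod_range_succ, Finset.prod_eq_one, one_mul, if_pos rfl] at h1
  · rw [← h1]
    congr 1
    ext ω
    constructor
    · intro hω j hj
      split_ifs with hji
      · rw [hji]; exact hω
      · exact mem_univ _
    · intro hω
      have := hω i (by omega)
      rwa [if_pos rfl] at this
  · intro j hj
    rw [Finset.mem_range] at hj
    rw [if_neg hj.ne, cycleLaw_univ hγ hγ₁ hU]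

/-- The sums over the cycles of a regenerative process are independent. -/
theorem iIndepFun_cycleSum [IsProbabilityMeasure P] [IsProbabilityMeasure ν]
    [IsMarkovKernel r] (h : IsRegenerativeProcess P ν r γ Z η) (hγ : 0 < γ) (hγ₁ : γ ≤ 1)
    (hU : Measurable U) : iIndepFun (cycleSum U Z η) P := by
  classical
  rw [iIndepFun_iff_measure_inter_preimage_eq_mul]
  intro s B hB
  obtain ⟨n, hn⟩ := s.exists_nat_subset_range
  have h1 := h.measure_cycleSum_mem hγ hγ₁ hU (B := fun j => if j ∈ s then B j else univ)
    (fun j => by split_ifs with hj; exacts [hB j hj, MeasurableSet.univ]) n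
  rw [← Finset.prod_subset hn] at h1
  · have e : {ω | ∀ i < n, cycleSum U Z η i ω ∈ if i ∈ s then B i else univ} =
        ⋂ i ∈ s, cycleSum U Z η i ⁻¹' B i := by
      ext ω
      simp only [mem_ofPred_eq, mem_iInter, mem_preimage]
      constructor
      · intro hω i hi
        have := hω i (Finset.mem_range.1 (hn hi))
        rwa [if_pos hi] at this
      · intro hω i _
        split_ifs with hi
        · exact hω i hi
        · exact mem_univ _
    rw [← e, h1]
    refine Finset.prod_congr rfl fun i hi => ?_
    rw [if_pos hi, ← h.map_cycleSum hγ hγ₁ hU i,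
      Measure.map_apply (h.measurable_cycleSum hU i) (hB i hi)]
  · intro i _ hi
    rw [if_neg hi, cycleLaw_univ hγ hγ₁ hU]

end IsRegenerativeProcess

end Renewal

theorem smul_measure_mono {α : Type*} [MeasurableSpace α] (c : ℝ≥0∞) {μ ν : Measure α}
    (h : μ ≤ ν) : c • μ ≤ c • ν := by
  refine Measure.le_iff.2 fun A _ => ?_
  rw [Measure.smul_apply, Measure.smul_apply]
  exact mul_le_mul_right (h A) _

/-! ### Comparison of the cycle law with geometric mixtures of Gaussians -/

section CycleLaw

variable {E : Type*} [MeasurableSpace E] {ν : Measure E} {r : Kernel E E} {γ : ℝ} {U : E → Plane}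

theorem bind_cycleKernel_zero (hU : Measurable U) :
    ν.bind (cycleKernel r U hU 0) = ν.map U := by
  rw [cycleKernel, Measure.deterministic_comp_eq_map]

theorem bind_cycleKernel_succ_apply [IsMarkovKernel r] (hU : Measurable U) (m : ℕ)
    {A : Set Plane} (hA : MeasurableSet A) :
    ν.bind (cycleKernel r U hU (m + 1)) A =
      ∫⁻ z, ∫⁻ z', cycleKernel r U hU m z' ((fun x => U z + x) ⁻¹' A) ∂(r z) ∂ν := by
  rw [Measure.bind_apply hA (Kernel.aemeasurable _)]
  refine lintegral_congr fun z => ?_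
  rw [← lintegral_indicator_one hA,
    lintegral_cycleKernel_succ r hU m z (measurable_one.indicator hA)]
  refine lintegral_congr fun z' => ?_
  rw [← lintegral_indicator_one ((measurable_const_add (U z)) hA)]
  rfl

/-- If the first transition is made by `ν` instead of `r`, the first increment is independent of the
rest. Together with the exact formula for `r` this shows what replacing `r` by `ν` does. -/
theorem map_conv_bind_cycleKernel_apply [SFinite ν] [IsMarkovKernel r] (hU : Measurable U) (m : ℕ)
    {A : Set Plane} (hA : MeasurableSet A) :
    (ν.map U ∗ ν.bind (cycleKernel r U hU m)) A =
      ∫⁻ z, ∫⁻ z', cycleKernel r U hU m z' ((fun x => U z + x) ⁻¹' A) ∂ν ∂ν := by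
  have hm : Measurable fun x => ν.bind (cycleKernel r U hU m) ((fun y => x + y) ⁻¹' A) :=
    measurable_measure_prodMk_left (measurable_add hA)
  rw [conv_apply _ _ hA, lintegral_map hm hU]
  refine lintegral_congr fun z => ?_
  rw [Measure.bind_apply ((measurable_const_add (U z)) hA) (Kernel.aemeasurable _)]

/-- Each of the `m` transitions is replaced by a draw from `ν` at the cost of a factor `c`. What
remains is a sum of `m + 1` independent Gaussians. -/
theorem bind_cycleKernel_le [IsProbabilityMeasure ν] [IsMarkovKernel r] (hU : Measurable U)
    (hg : ν.map U = planeGaussian 1) {c : ℝ} (hc : 0 ≤ c)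
    (hr : ∀ z, r z ≤ ENNReal.ofReal c • ν) (m : ℕ) :
    ν.bind (cycleKernel r U hU m) ≤ ENNReal.ofReal (c ^ m) • planeGaussian (m + 1) := by
  induction m with
  | zero => simp [bind_cycleKernel_zero, hg]
  | succ m ih =>
    have hm : (0 : ℝ) < m + 1 := by positivity
    have h1 : ν.bind (cycleKernel r U hU (m + 1)) ≤
        ENNReal.ofReal c • (planeGaussian 1 ∗ ν.bind (cycleKernel r U hU m)) := by
      refine Measure.le_iff.2 fun A hA => ?_
      rw [Measure.smul_apply, ← hg, map_conv_bind_cycleKernel_apply hU m hA,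
        bind_cycleKernel_succ_apply hU m hA, smul_eq_mul,
        ← lintegral_const_mul' _ _ ENNReal.ofReal_ne_top]
      refine lintegral_mono fun z => (lintegral_mono' (hr z) le_rfl).trans_eq ?_
      rw [lintegral_smul_measure, smul_eq_mul]
    have : IsFiniteMeasure (ENNReal.ofReal (c ^ m) • planeGaussian (m + 1)) :=
      Measure.smul_finite _ ENNReal.ofReal_ne_top
    calc _ ≤ _ := h1
      _ ≤ ENNReal.ofReal c • (planeGaussian 1 ∗
          (ENNReal.ofReal (c ^ m) • planeGaussian (m + 1))) :=
        smul_measure_mono _ (conv_mono le_rfl ih)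
      _ = _ := by
        rw [Measure.conv_comm, smul_conv_left, planeGaussian_conv hm one_pos, smul_smul,
          ← ENNReal.ofReal_mul hc, pow_succ']
        push_cast
        rfl

theorem le_bind_cycleKernel [IsProbabilityMeasure ν] [IsMarkovKernel r] (hU : Measurable U)
    (hg : ν.map U = planeGaussian 1) {c : ℝ} (hc : 0 ≤ c)
    (hr : ∀ z, ENNReal.ofReal c • ν ≤ r z) (m : ℕ) :
    ENNReal.ofReal (c ^ m) • planeGaussian (m + 1) ≤ ν.bind (cycleKernel r U hU m) := by
  induction m with
  | zero => simp [bind_cycleKernel_zero, hg]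
  | succ m ih =>
    have hm : (0 : ℝ) < m + 1 := by positivity
    have h1 : ENNReal.ofReal c • (planeGaussian 1 ∗ ν.bind (cycleKernel r U hU m)) ≤
        ν.bind (cycleKernel r U hU (m + 1)) := by
      refine Measure.le_iff.2 fun A hA => ?_
      rw [Measure.smul_apply, ← hg, map_conv_bind_cycleKernel_apply hU m hA,
        bind_cycleKernel_succ_apply hU m hA, smul_eq_mul,
        ← lintegral_const_mul' _ _ ENNReal.ofReal_ne_top]
      refine lintegral_mono fun z => le_trans (le_of_eq ?_) (lintegral_mono' (hr z) le_rfl)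
      rw [lintegral_smul_measure, smul_eq_mul]
    have : IsFiniteMeasure (ENNReal.ofReal (c ^ m) • planeGaussian (m + 1)) :=
      Measure.smul_finite _ ENNReal.ofReal_ne_top
    have e : ENNReal.ofReal (c ^ (m + 1)) • planeGaussian ((m + 1 : ℕ) + 1) =
        ENNReal.ofReal c • (planeGaussian 1 ∗
          (ENNReal.ofReal (c ^ m) • planeGaussian (m + 1))) := by
      rw [Measure.conv_comm, smul_conv_left, planeGaussian_conv hm one_pos, smul_smul,
        ← ENNReal.ofReal_mul hc, pow_succ']
      push_cast
      rfl
    rw [e]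
    calc _ ≤ ENNReal.ofReal c • (planeGaussian 1 ∗ ν.bind (cycleKernel r U hU m)) :=
        smul_measure_mono _ (conv_mono le_rfl ih)
      _ ≤ _ := h1

/-- A symmetry of the transition kernel that reverses the sign of `U` carries trajectories to
trajectories and negates their sums. It is applied to the exchange of the two paths. -/
theorem cycleKernel_involution [IsMarkovKernel r] (hU : Measurable U) {τ : E → E}
    (hτ : Measurable τ) (hτr : ∀ z, r (τ z) = (r z).map τ) (hτU : ∀ z, U (τ z) = -U z) (m : ℕ)
    (z : E) : cycleKernel r U hU m (τ z) = (cycleKernel r U hU m z).map fun x => -x := by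
  induction m generalizing z with
  | zero =>
    rw [cycleKernel, Kernel.deterministic_apply, Kernel.deterministic_apply,
      Measure.map_dirac' measurable_neg, hτU]
  | succ m ih =>
    ext A hA
    have hA' : MeasurableSet ((fun x : Plane => -x) ⁻¹' A) := measurable_neg hA
    have hm : Measurable fun z' => cycleKernel r U hU m z' ((fun x => U (τ z) + x) ⁻¹' A) :=
      (cycleKernel r U hU m).measurable_coe (measurable_const_add (U (τ z)) hA)
    have e : ∀ (z : E) {A : Set Plane}, MeasurableSet A → cycleKernel r U hU (m + 1) z A =
        ∫⁻ z', cycleKernel r U hU m z' ((fun x => U z + x) ⁻¹' A) ∂(r z) := by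
      intro z A hA
      rw [← lintegral_indicator_one hA,
        lintegral_cycleKernel_succ r hU m z (measurable_one.indicator hA)]
      refine lintegral_congr fun z' => ?_
      rw [← lintegral_indicator_one ((measurable_const_add (U z)) hA)]
      rfl
    rw [Measure.map_apply measurable_neg hA, e _ hA, e _ hA', hτr, lintegral_map hm hτ]
    refine lintegral_congr fun z' => ?_
    rw [ih, Measure.map_apply measurable_neg (measurable_const_add (U (τ z)) hA), hτU]
    congr 1
    ext x
    simp [add_comm]

theorem cycleLaw_map_neg [IsMarkovKernel r] (hU : Measurable U) {τ : E → E}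
    (hτ : Measurable τ) (hτr : ∀ z, r (τ z) = (r z).map τ) (hτU : ∀ z, U (τ z) = -U z)
    (hτν : ν.map τ = ν) :
    (cycleLaw γ ν r U hU).map (fun x => -x) = cycleLaw γ ν r U hU := by
  ext A hA
  have hA' : MeasurableSet ((fun x : Plane => -x) ⁻¹' A) := measurable_neg hA
  rw [Measure.map_apply measurable_neg hA, cycleLaw, Measure.sum_apply _ hA,
    Measure.sum_apply _ hA']
  refine tsum_congr fun m => ?_
  rw [Measure.smul_apply, Measure.smul_apply, Measure.bind_apply hA (Kernel.aemeasurable _),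
    Measure.bind_apply hA' (Kernel.aemeasurable _)]
  conv_rhs => rw [← hτν, lintegral_map ((cycleKernel r U hU m).measurable_coe hA) hτ]
  congr 1
  refine lintegral_congr fun z => ?_
  rw [cycleKernel_involution hU hτ hτr hτU, Measure.map_apply measurable_neg hA]

/-- Cycles of length one give the exact component `γ N(0, 2 I)`. In longer cycles the comparison
factors `(1 ± η) ^ m` merge with `(1 - γ) ^ m` into a geometric weight. -/
theorem isStepLaw_cycleLaw [IsProbabilityMeasure ν] [IsMarkovKernel r] (hγ : 0 < γ) (hγ₁ : γ < 1)
    (hU : Measurable U) (hg : ν.map U = planeGaussian 1) {τ : E → E}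
    (hτ : Measurable τ) (hτr : ∀ z, r (τ z) = (r z).map τ) (hτU : ∀ z, U (τ z) = -U z)
    (hτν : ν.map τ = ν) {η : ℝ} (hη₀ : 0 ≤ η) (hη₁ : η ≤ 1)
    (hr₁ : ∀ z, ENNReal.ofReal (1 - η) • ν ≤ r z) (hr₂ : ∀ z, r z ≤ ENNReal.ofReal (1 + η) • ν) :
    IsStepLaw γ η (cycleLaw γ ν r U hU) (Measure.sum fun m : ℕ =>
      ENNReal.ofReal (γ * (1 - γ) ^ (m + 1)) • ν.bind (cycleKernel r U hU (m + 1))) where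
  isProbabilityMeasure := ⟨IsRegenerativeProcess.cycleLaw_univ hγ hγ₁.le hU⟩
  eq_add := by
    ext A hA
    rw [cycleLaw, Measure.sum_apply _ hA, Measure.add_apply, Measure.sum_apply _ hA,
      tsum_eq_zero_add' ENNReal.summable, pow_zero, mul_one, bind_cycleKernel_zero, hg]
  symm := cycleLaw_map_neg hU hτ hτr hτU hτν
  sum_le := by
    have h1γ : 0 < 1 - γ := by linarith
    refine Measure.le_iff.2 fun A hA => ?_
    rw [cycleLaw, Measure.sum_apply _ hA, Measure.sum_apply _ hA]
    refine ENNReal.tsum_le_tsum fun m => ?_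
    have h := le_bind_cycleKernel hU hg (by linarith : 0 ≤ 1 - η) hr₁ m A
    rw [Measure.smul_apply, smul_eq_mul] at h
    have e : γ * ((1 - η) * (1 - γ)) ^ m = γ * (1 - γ) ^ m * (1 - η) ^ m := by
      rw [mul_pow]; ring
    rw [Measure.smul_apply, Measure.smul_apply, smul_eq_mul, smul_eq_mul, e,
      ENNReal.ofReal_mul (by positivity : 0 ≤ γ * (1 - γ) ^ m), mul_assoc]
    exact mul_le_mul_right h _
  le_sum := by
    have h1γ : 0 < 1 - γ := by linarith
    refine Measure.le_iff.2 fun A hA => ?_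
    rw [cycleLaw, Measure.sum_apply _ hA, Measure.sum_apply _ hA]
    refine ENNReal.tsum_le_tsum fun m => ?_
    have h := bind_cycleKernel_le hU hg (by linarith : 0 ≤ 1 + η) hr₂ m A
    rw [Measure.smul_apply, smul_eq_mul] at h
    have e : γ * ((1 + η) * (1 - γ)) ^ m = γ * (1 - γ) ^ m * (1 + η) ^ m := by
      rw [mul_pow]; ring
    rw [Measure.smul_apply, Measure.smul_apply, smul_eq_mul, smul_eq_mul, e,
      ENNReal.ofReal_mul (by positivity : 0 ≤ γ * (1 - γ) ^ m), mul_assoc]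
    exact mul_le_mul_right h _

end CycleLaw

/-! ### The transition probabilities of path segments -/

theorem withDensity_ofReal_bounds {α : Type*} [MeasurableSpace α] (μ : Measure α) {f : α → ℝ}
    {a b : ℝ} (hf : ∀ x, a ≤ f x ∧ f x ≤ b) :
    ENNReal.ofReal a • μ ≤ μ.withDensity (fun x => ENNReal.ofReal (f x)) ∧
      μ.withDensity (fun x => ENNReal.ofReal (f x)) ≤ ENNReal.ofReal b • μ := by
  rw [← withDensity_const, ← withDensity_const]
  exact ⟨withDensity_mono (ae_of_all _ fun x => ENNReal.ofReal_le_ofReal (hf x).1),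
    withDensity_mono (ae_of_all _ fun x => ENNReal.ofReal_le_ofReal (hf x).2)⟩

theorem integral_mem_bounds {α : Type*} [MeasurableSpace α] {μ : Measure α}
    [IsProbabilityMeasure μ] {f : α → ℝ} {a b : ℝ} (hi : Integrable f μ)
    (hf : ∀ x, a ≤ f x ∧ f x ≤ b) : a ≤ ∫ x, f x ∂μ ∧ ∫ x, f x ∂μ ≤ b := by
  have h1 := integral_mono (integrable_const a) hi fun x => (hf x).1
  have h2 := integral_mono hi (integrable_const b) fun x => (hf x).2
  simp only [integral_const, probReal_univ, one_smul] at h1 h2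
  exact ⟨h1, h2⟩

/-- The weight and its normalization each contribute at most a factor `exp (b / 2)`. -/
theorem tilted_bounds {α : Type*} [MeasurableSpace α] (μ : Measure α) [IsProbabilityMeasure μ]
    {f : α → ℝ} (hf : Measurable f) {b : ℝ} (hb : ∀ x, |f x| ≤ b / 2) :
    ENNReal.ofReal (Real.exp (-b)) • μ ≤ μ.tilted f ∧
      μ.tilted f ≤ ENNReal.ofReal (Real.exp b) • μ := by
  have h1 : ∀ x, Real.exp (-(b / 2)) ≤ Real.exp (f x) ∧ Real.exp (f x) ≤ Real.exp (b / 2) :=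
    fun x => ⟨Real.exp_le_exp.2 (abs_le.1 (hb x)).1, Real.exp_le_exp.2 (abs_le.1 (hb x)).2⟩
  have hi : Integrable (fun x => Real.exp (f x)) μ := by
    refine Integrable.of_bound (C := Real.exp (b / 2))
      (Real.measurable_exp.comp hf).aestronglyMeasurable (ae_of_all _ fun x => ?_)
    rw [Real.norm_eq_abs, Real.abs_exp]
    exact (h1 x).2
  obtain ⟨h2, h3⟩ := integral_mem_bounds hi h1
  refine withDensity_ofReal_bounds μ fun x => ⟨?_, ?_⟩
  · have e : Real.exp (-b) = Real.exp (-(b / 2)) / Real.exp (b / 2) := by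
      rw [← Real.exp_sub]; congr 1; ring
    rw [e]
    exact div_le_div₀ (Real.exp_pos _).le (h1 x).1 ((Real.exp_pos _).trans_le h2) h3
  · have e : Real.exp b = Real.exp (b / 2) / Real.exp (-(b / 2)) := by
      rw [← Real.exp_sub]; congr 1; ring
    rw [e]
    exact div_le_div₀ (Real.exp_pos _).le (h1 x).2 (Real.exp_pos _) h2

/-- Because `Ψ` has mass one, the eigenvalue equation places `ρ Ψ x` between `exp (-b)` and `exp b`,
and integrating it places `ρ` there too. No other information on the eigenpair is needed. -/
theorem IsPrincipalEigenpair.density_bounds {α : Type*} [MeasurableSpace α] {μ : Measure α}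
    [IsProbabilityMeasure μ] {k : α → α → ℝ} {ρ : ℝ} {Ψ : α → ℝ}
    (h : IsPrincipalEigenpair μ k ρ Ψ) (hk : Measurable (Function.uncurry k)) {b : ℝ}
    (hb : ∀ x y, Real.exp (-b) ≤ k x y ∧ k x y ≤ Real.exp b) (x y : α) :
    Real.exp (-(4 * b)) ≤ k x y * Ψ y / (ρ * Ψ x) ∧
      k x y * Ψ y / (ρ * Ψ x) ≤ Real.exp (4 * b) := by
  obtain ⟨c, C, hc, hcC⟩ := h.bounds
  have hΨ0 : ∀ x, 0 < Ψ x := fun x => hc.trans_le (hcC x).1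
  have hΨi : Integrable Ψ μ := by
    refine Integrable.of_bound (C := C) h.measurable.aestronglyMeasurable (ae_of_all _ fun x => ?_)
    rw [Real.norm_eq_abs, abs_of_pos (hΨ0 x)]
    exact (hcC x).2
  have hkx : ∀ x, Measurable (k x) := fun x => hk.comp measurable_prodMk_left
  have hki : ∀ x, Integrable (fun y => k x y * Ψ y) μ := by
    intro x
    refine Integrable.bdd_mul (c := Real.exp b) hΨi (hkx x).aestronglyMeasurable
      (ae_of_all _ fun y => ?_)
    rw [Real.norm_eq_abs, abs_of_nonneg ((Real.exp_pos _).le.trans (hb x y).1)]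
    exact (hb x y).2
  have h1 : ∀ x, Real.exp (-b) ≤ ρ * Ψ x ∧ ρ * Ψ x ≤ Real.exp b := by
    intro x
    rw [← h.eigen x]
    constructor
    · have := integral_mono (hΨi.const_mul (Real.exp (-b))) (hki x)
        fun y => mul_le_mul_of_nonneg_right (hb x y).1 (hΨ0 y).le
      rwa [integral_const_mul, h.total_mass, mul_one] at this
    · have := integral_mono (hki x) (hΨi.const_mul (Real.exp b))
        fun y => mul_le_mul_of_nonneg_right (hb x y).2 (hΨ0 y).le
      rwa [integral_const_mul, h.total_mass, mul_one] at this
  have h2 : Real.exp (-b) ≤ ρ ∧ ρ ≤ Real.exp b := by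
    have := integral_mem_bounds (hΨi.const_mul ρ) h1
    rwa [integral_const_mul, h.total_mass, mul_one] at this
  have hρ := h.eigenvalue_pos
  -- The density becomes a quotient of two products of two quantities, all four lying between `exp
  -- (-b)` and `exp b`.
  have e : k x y * Ψ y / (ρ * Ψ x) = k x y * (ρ * Ψ y) / (ρ * (ρ * Ψ x)) := by
    have := (hΨ0 x).ne'
    field_simp
  have e0 := Real.exp_pos (-b)
  have e1 := Real.exp_pos b
  rw [e]
  constructor
  · have e2 : Real.exp (-(4 * b)) =
        Real.exp (-b) * Real.exp (-b) / (Real.exp b * Real.exp b) := by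
      rw [← Real.exp_add, ← Real.exp_add, ← Real.exp_sub]; congr 1; ring
    rw [e2]
    refine div_le_div₀ (mul_nonneg (e0.le.trans (hb x y).1) (e0.le.trans (h1 y).1))
      (mul_le_mul (hb x y).1 (h1 y).1 e0.le (e0.le.trans (hb x y).1))
      (mul_pos hρ (mul_pos hρ (hΨ0 x))) ?_
    exact mul_le_mul h2.2 (h1 x).2 (e0.le.trans (h1 x).1) e1.le
  · have e2 : Real.exp (4 * b) =
        Real.exp b * Real.exp b / (Real.exp (-b) * Real.exp (-b)) := by
      rw [← Real.exp_add, ← Real.exp_add, ← Real.exp_sub]; congr 1; ring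
    rw [e2]
    refine div_le_div₀ (by positivity)
      (mul_le_mul (hb x y).2 (h1 y).2 (e0.le.trans (h1 y).1) e1.le) (by positivity) ?_
    exact mul_le_mul h2.1 (h1 x).1 e0.le hρ.le

/-- Four factors `exp b` come from the density with respect to the tilted measure and one from the
tilting itself. The bound is uniform in the starting segment. -/
theorem pathTransition_bounds {φ : ℝ → ℝ} {ψ : Plane → ℝ} (hm : IsMollifierPair φ ψ)
    (W : Measure PathSpace) [IsProbabilityMeasure W] (h β : ℝ) {B : ℝ}
    (hB : ∀ s y, |noiseCorrelation φ ψ s y| ≤ B) (ε : ℝ) (x : PathSpace) :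
    ENNReal.ofReal (Real.exp (-(5 * (couplingConstant β ε ^ 2 * B)))) • W ≤
        pathTransition φ ψ W h β ε x ∧
      pathTransition φ ψ W h β ε x ≤
        ENNReal.ofReal (Real.exp (5 * (couplingConstant β ε ^ 2 * B))) • W := by
  set b := couplingConstant β ε ^ 2 * B with hb
  have hP := isProbabilityMeasure_tiltedWiener hm W β ε
  have h1 := tilted_bounds W ((measurable_selfInteraction hm).const_mul
    (couplingConstant β ε ^ 2 / 2)) (b := b) fun x => by
      rw [abs_mul, abs_of_nonneg (by positivity : 0 ≤ couplingConstant β ε ^ 2 / 2), hb]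
      have : |selfInteraction φ ψ x| ≤ B := abs_integral_integral_le fun s u => hB _ _
      calc _ ≤ couplingConstant β ε ^ 2 / 2 * B := by gcongr
        _ = _ := by ring
  have hk : Measurable (Function.uncurry (interactionWeight φ ψ h β ε)) :=
    Real.measurable_exp.comp ((measurable_crossInteraction hm h).const_mul _)
  have hkb : ∀ x y, Real.exp (-b) ≤ interactionWeight φ ψ h β ε x y ∧
      interactionWeight φ ψ h β ε x y ≤ Real.exp b := by
    intro x y
    have h2 : |crossInteraction φ ψ h x y| ≤ B := abs_integral_integral_le fun s u => hB _ _
    have h3 : |couplingConstant β ε ^ 2 * crossInteraction φ ψ h x y| ≤ b := by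
      rw [abs_mul, abs_of_nonneg (sq_nonneg (couplingConstant β ε)), hb]
      gcongr
    exact ⟨Real.exp_le_exp.2 (abs_le.1 h3).1, Real.exp_le_exp.2 (abs_le.1 h3).2⟩
  have h2 := (isPrincipalEigenpair_interactionWeight hm W h β ε).density_bounds hk hkb x
  have h3 := withDensity_ofReal_bounds (tiltedWiener φ ψ W β ε) h2
  have e1 : Real.exp (-(5 * b)) = Real.exp (-(4 * b)) * Real.exp (-b) := by
    rw [← Real.exp_add]; congr 1; ring
  have e2 : Real.exp (5 * b) = Real.exp (4 * b) * Real.exp b := by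
    rw [← Real.exp_add]; congr 1; ring
  rw [e1, e2, ENNReal.ofReal_mul (Real.exp_pos _).le, ENNReal.ofReal_mul (Real.exp_pos _).le,
    mul_smul, mul_smul]
  exact ⟨(smul_measure_mono _ h1.1).trans h3.1, h3.2.trans (smul_measure_mono _ h1.2)⟩

theorem isFiniteMeasure_pathTransition {φ : ℝ → ℝ} {ψ : Plane → ℝ} (hm : IsMollifierPair φ ψ)
    (W : Measure PathSpace) [IsProbabilityMeasure W] (h β ε : ℝ) (x : PathSpace) :
    IsFiniteMeasure (pathTransition φ ψ W h β ε x) := by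
  obtain ⟨B, hB⟩ := exists_bound_noiseCorrelation hm
  have : IsFiniteMeasure (ENNReal.ofReal
      (Real.exp (5 * (couplingConstant β ε ^ 2 * B))) • W) :=
    Measure.smul_finite _ ENNReal.ofReal_ne_top
  exact isFiniteMeasure_of_le _ (pathTransition_bounds hm W h β hB ε x).2

theorem prod_bounds {α : Type*} [MeasurableSpace α] {μ π₁ π₂ : Measure α} [IsFiniteMeasure μ]
    [IsFiniteMeasure π₁] [IsFiniteMeasure π₂] {a b : ℝ} (ha : 0 ≤ a) (hb : 0 ≤ b)
    (h₁ : ENNReal.ofReal a • μ ≤ π₁ ∧ π₁ ≤ ENNReal.ofReal b • μ)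
    (h₂ : ENNReal.ofReal a • μ ≤ π₂ ∧ π₂ ≤ ENNReal.ofReal b • μ) :
    ENNReal.ofReal (a * a) • μ.prod μ ≤ π₁.prod π₂ ∧
      π₁.prod π₂ ≤ ENNReal.ofReal (b * b) • μ.prod μ := by
  have f : ∀ c : ℝ, IsFiniteMeasure (ENNReal.ofReal c • μ) := fun c =>
    Measure.smul_finite _ ENNReal.ofReal_ne_top
  have e : ∀ {c : ℝ}, 0 ≤ c → ENNReal.ofReal (c * c) • μ.prod μ =
      (ENNReal.ofReal c • μ).prod (ENNReal.ofReal c • μ) := by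
    intro c hc
    rw [Measure.prod_smul_left, Measure.prod_smul_right, smul_smul, ENNReal.ofReal_mul hc]
  rw [e ha, e hb]
  exact ⟨Measure.prod_mono h₁.1 h₂.1, Measure.prod_mono h₁.2 h₂.2⟩

/-- If `Q = γ ν + (1 - γ) r` is close to `ν`, then so is `r`. -/
theorem mixture_component_bounds {α : Type*} [MeasurableSpace α] {Q ν r : Measure α}
    [IsFiniteMeasure ν] [IsFiniteMeasure r] {γ η b : ℝ} (hγ : 0 < γ) (hγ₁ : γ < 1) (hη : η ≤ 1)
    (hη₀ : 0 ≤ η) (hb : Real.exp b ≤ 1 + η * (1 - γ))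
    (hQ : Q = ENNReal.ofReal γ • ν + ENNReal.ofReal (1 - γ) • r)
    (h₁ : ENNReal.ofReal (Real.exp (-b)) • ν ≤ Q) (h₂ : Q ≤ ENNReal.ofReal (Real.exp b) • ν) :
    ENNReal.ofReal (1 - η) • ν ≤ r ∧ r ≤ ENNReal.ofReal (1 + η) • ν := by
  have h1γ : 0 < 1 - γ := by linarith
  -- From `exp b + exp (-b) ≥ 2`: the upper bound on `exp b` already controls `exp (-b)` from below.
  have hb' : 1 - η * (1 - γ) ≤ Real.exp (-b) := by
    have h3 : Real.exp b * Real.exp (-b) = 1 := by rw [← Real.exp_add]; simp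
    nlinarith [sq_nonneg (Real.exp b - 1), Real.exp_pos b, Real.exp_pos (-b)]
  -- All masses are finite, so the comparison is made in `ℝ`, where `γ ν` can be subtracted.
  have key : ∀ A, Real.exp (-b) * (ν A).toReal ≤ γ * (ν A).toReal + (1 - γ) * (r A).toReal ∧
      γ * (ν A).toReal + (1 - γ) * (r A).toReal ≤ Real.exp b * (ν A).toReal := by
    intro A
    have hn := measure_ne_top ν A
    have hr := measure_ne_top r A
    have e : (Q A).toReal = γ * (ν A).toReal + (1 - γ) * (r A).toReal := by
      rw [hQ, Measure.add_apply, Measure.smul_apply, Measure.smul_apply, smul_eq_mul, smul_eq_mul,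
        ENNReal.toReal_add (by finiteness) (by finiteness), ENNReal.toReal_mul,
        ENNReal.toReal_mul, ENNReal.toReal_ofReal hγ.le, ENNReal.toReal_ofReal h1γ.le]
    have hQA : Q A ≠ ∞ := by
      refine ne_top_of_le_ne_top ?_ (h₂ A)
      rw [Measure.smul_apply, smul_eq_mul]
      finiteness
    have l := ENNReal.toReal_mono hQA (h₁ A)
    have u := ENNReal.toReal_mono (by rw [Measure.smul_apply, smul_eq_mul]; finiteness) (h₂ A)
    rw [Measure.smul_apply, smul_eq_mul, ENNReal.toReal_mul,
      ENNReal.toReal_ofReal (Real.exp_pos _).le, e] at l u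
    exact ⟨l, u⟩
  constructor
  · refine Measure.le_iff.2 fun A _ => ?_
    have hn := measure_ne_top ν A
    have hr := measure_ne_top r A
    have hn0 : 0 ≤ (ν A).toReal := ENNReal.toReal_nonneg
    rw [Measure.smul_apply, smul_eq_mul, ← ENNReal.toReal_le_toReal (by finiteness) hr,
      ENNReal.toReal_mul, ENNReal.toReal_ofReal (by linarith)]
    have h3 := mul_le_mul_of_nonneg_right hb' hn0
    have h4 := (key A).1
    have : (1 - γ) * ((1 - η) * (ν A).toReal) ≤ (1 - γ) * (r A).toReal := by nlinarith
    exact le_of_mul_le_mul_left this h1γ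
  · refine Measure.le_iff.2 fun A _ => ?_
    have hn := measure_ne_top ν A
    have hr := measure_ne_top r A
    have hn0 : 0 ≤ (ν A).toReal := ENNReal.toReal_nonneg
    rw [Measure.smul_apply, smul_eq_mul, ← ENNReal.toReal_le_toReal hr (by finiteness),
      ENNReal.toReal_mul, ENNReal.toReal_ofReal (by linarith)]
    have h3 := mul_le_mul_of_nonneg_right hb hn0
    have h4 := (key A).2
    have : (1 - γ) * (r A).toReal ≤ (1 - γ) * ((1 + η) * (ν A).toReal) := by nlinarith
    exact le_of_mul_le_mul_left this h1γ

theorem tendsto_log_one_div : Tendsto (fun ε : ℝ => Real.log (1 / ε)) (𝓝[>] 0) atTop := by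
  simp_rw [one_div]
  exact Real.tendsto_log_atTop.comp tendsto_inv_nhdsGT_zero

theorem tendsto_couplingConstant_sq (β : ℝ) :
    Tendsto (fun ε => couplingConstant β ε ^ 2) (𝓝[>] 0) (𝓝 0) := by
  have h : Tendsto (fun ε => couplingConstant β ε) (𝓝[>] 0) (𝓝 0) :=
    (Real.tendsto_sqrt_atTop.comp tendsto_log_one_div).const_div_atTop β
  simpa using h.pow 2

/-! ### The steps of the regeneration walk -/

/-- The increment of the difference of two paths over a unit time interval. -/
noncomputable def pairIncrement (z : PathSpace × PathSpace) : Plane := z.1.1 1 - z.2.1 1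

theorem continuous_pathEval (t : unitInterval) : Continuous fun x : PathSpace => x.1 t := by
  fun_prop

theorem measurable_pairIncrement : Measurable pairIncrement :=
  ((continuous_pathEval 1).measurable.comp measurable_fst).sub
    ((continuous_pathEval 1).measurable.comp measurable_snd)

/-- The endpoints of the two paths are independent standard Gaussians, and the characteristic
function of their difference is `exp (-‖θ‖² / 2)` squared. -/
theorem map_pairIncrement {W : Measure PathSpace} (hW : IsWienerMeasure W) :
    (W.prod W).map pairIncrement = planeGaussian 1 := by
  have hWp := hW.isProbabilityMeasure
  have hm : Measurable fun x : PathSpace => x.1 1 := (continuous_pathEval 1).measurable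
  have hmn : Measurable fun x : PathSpace => -x.1 1 := hm.neg
  have hlaw : W.map (fun x : PathSpace => x.1 1) =
      multivariateGaussian 0 (1 : Matrix (Fin 2) (Fin 2) ℝ) := by
    have h := hW.map_increment 0 1 zero_le_one
    have e : (fun x : PathSpace => x.1 1 - x.1 0) = fun x => x.1 1 := by
      funext x
      rw [x.2, sub_zero]
    rw [e] at h
    simpa using h
  have hch : ∀ θ : Plane, charFun (W.map (fun x : PathSpace => x.1 1)) θ =
      (Real.exp (-‖θ‖ ^ 2 / 2) : ℝ) := by
    intro θ
    rw [hlaw, charFun_multivariateGaussian Matrix.PosSemidef.one]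
    have : (‖θ‖ ^ 2 : ℝ) = θ.ofLp ⬝ᵥ θ.ofLp := by
      rw [EuclideanSpace.real_norm_sq_eq]
      simp [dotProduct, sq]
    rw [neg_div, this]
    simp
  have hconv : (W.prod W).map pairIncrement =
      (W.map fun x : PathSpace => x.1 1) ∗ (W.map fun x : PathSpace => -x.1 1) := by
    rw [Measure.conv, Measure.map_prod_map _ _ hm hmn,
      Measure.map_map (by fun_prop) (by fun_prop)]
    congr 1
  have : IsProbabilityMeasure (W.map fun x : PathSpace => x.1 1) :=
    Measure.isProbabilityMeasure_map hm.aemeasurable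
  have : IsProbabilityMeasure (W.map fun x : PathSpace => -x.1 1) :=
    Measure.isProbabilityMeasure_map hmn.aemeasurable
  have := Measure.isProbabilityMeasure_map (μ := W.prod W) measurable_pairIncrement.aemeasurable
  refine Measure.ext_of_charFun ?_
  ext θ
  have hneg : charFun (W.map fun x : PathSpace => -x.1 1) θ =
      charFun (W.map fun x : PathSpace => x.1 1) (-θ) := by
    rw [charFun_apply, charFun_apply, integral_map hmn.aemeasurable (by fun_prop),
      integral_map hm.aemeasurable (by fun_prop)]
    simp
  rw [hconv, charFun_conv, hneg, hch, hch, charFun_planeGaussian one_pos, ← Complex.ofReal_mul,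
    ← Real.exp_add, norm_neg]
  congr 2
  ring

/-- For small `ε` the law of the sum over a cycle is close to a geometric mixture of Gaussians. -/
theorem eventually_isStepLaw {φ : ℝ → ℝ} {ψ : Plane → ℝ} (hm : IsMollifierPair φ ψ) (h β : ℝ)
    {W : Measure PathSpace} (hW : IsWienerMeasure W) {γ : ℝ} (hγ : 0 < γ) (hγ₁ : γ < 1)
    {η : ℝ} (hη₀ : 0 < η) (hη₁ : η ≤ 1) :
    ∀ᶠ ε in 𝓝[>] (0 : ℝ), ∀ r : Kernel (PathSpace × PathSpace) (PathSpace × PathSpace),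
      IsMarkovKernel r → (∀ z, (pathTransition φ ψ W h β ε z.1).prod
        (pathTransition φ ψ W h β ε z.2) =
          ENNReal.ofReal γ • W.prod W + ENNReal.ofReal (1 - γ) • r z) →
      ∃ μ', IsStepLaw γ η (cycleLaw γ (W.prod W) r pairIncrement measurable_pairIncrement) μ' := by
  have hWp := hW.isProbabilityMeasure
  obtain ⟨B, hB⟩ := exists_bound_noiseCorrelation hm
  -- The exponent `5` of one path transition doubles for the product of two.
  have ht : Tendsto (fun ε => Real.exp (10 * (couplingConstant β ε ^ 2 * B))) (𝓝[>] 0) (𝓝 1) := by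
    have h1 := ((tendsto_couplingConstant_sq β).mul_const B).const_mul 10
    rw [zero_mul, mul_zero] at h1
    have h2 := (Real.continuous_exp.tendsto 0).comp h1
    rwa [Real.exp_zero] at h2
  have h1γ : 0 < 1 - γ := by linarith
  have hlt : (1 : ℝ) < 1 + η * (1 - γ) := by
    have := mul_pos hη₀ h1γ
    linarith
  filter_upwards [ht.eventually_le_const hlt] with ε hε r hr hQ
  have hfin := isFiniteMeasure_pathTransition hm W h β ε
  have hbd : ∀ z, ENNReal.ofReal (1 - η) • W.prod W ≤ r z ∧
      r z ≤ ENNReal.ofReal (1 + η) • W.prod W := by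
    intro z
    have h1 := prod_bounds (Real.exp_pos _).le (Real.exp_pos _).le
      (pathTransition_bounds hm W h β hB ε z.1) (pathTransition_bounds hm W h β hB ε z.2)
    rw [← Real.exp_add, ← Real.exp_add] at h1
    refine mixture_component_bounds hγ hγ₁ hη₁ hη₀.le hε (hQ z) ?_ ?_
    · convert h1.1 using 3
      ring_nf
    · convert h1.2 using 3
      ring_nf
  refine ⟨_, isStepLaw_cycleLaw hγ hγ₁ measurable_pairIncrement (map_pairIncrement hW)
    (τ := Prod.swap) measurable_swap (fun z => ?_) (fun z => ?_) Measure.prod_swap hη₀.le hη₁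
    (fun z => (hbd z).1) (fun z => (hbd z).2)⟩
  -- Both the product transition and `W × W` respect the exchange of the paths. Cancelling the
  -- finite term `γ W × W` and the nonzero factor `1 - γ` transfers this to `r`.
  · have e1 := hQ z.swap
    have e2 : (((pathTransition φ ψ W h β ε z.1).prod
        (pathTransition φ ψ W h β ε z.2))).map Prod.swap = _ := congrArg _ (hQ z)
    rw [Measure.prod_swap, Measure.map_add _ _ measurable_swap, Measure.map_smul,
      Measure.map_smul, Measure.prod_swap] at e2
    rw [Prod.fst_swap, Prod.snd_swap, e2] at e1
    ext A hA
    have e3 := congrArg (fun m : Measure (PathSpace × PathSpace) => m A) e1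
    simp only [Measure.add_apply, Measure.smul_apply, smul_eq_mul] at e3
    rw [ENNReal.add_right_inj (by finiteness), ENNReal.mul_right_inj (by simpa using hγ₁)
      ENNReal.ofReal_ne_top] at e3
    exact e3.symm
  · simp [pairIncrement]

/-! ### The walk at increasing times -/

/-- The partial sums of a tuple. -/
def gapSum {M : Type*} [Add M] : {p : ℕ} → (Fin p → M) → Fin p → M
  | 0, _ => Fin.elim0
  | _ + 1, l => Fin.cons (l 0) fun i => l 0 + gapSum (Fin.tail l) i

theorem gapSum_zero {M : Type*} [Add M] {p : ℕ} (l : Fin (p + 1) → M) : gapSum l 0 = l 0 := rfl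

theorem gapSum_succ {M : Type*} [Add M] {p : ℕ} (l : Fin (p + 1) → M) (i : Fin p) :
    gapSum l i.succ = l 0 + gapSum (Fin.tail l) i := rfl

theorem gapSum_injective {p : ℕ} : Function.Injective (gapSum (M := ℕ) (p := p)) := by
  induction p with
  | zero => exact fun _ _ _ => Subsingleton.elim _ _
  | succ p ih =>
    intro l l' h
    have h0 : l 0 = l' 0 := congrFun h 0
    have h1 : Fin.tail l = Fin.tail l' := by
      refine ih (funext fun i => ?_)
      have := congrFun h i.succ
      rw [gapSum_succ, gapSum_succ, h0] at this
      omega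
    rw [← Fin.cons_self_tail l, ← Fin.cons_self_tail l', h0, h1]

theorem exists_gapSum_eq {p : ℕ} {k : Fin p → ℕ} (hk : StrictMono k) {N : ℕ}
    (h : ∀ i, k i ∈ Finset.Icc 1 N) : ∃ l, (∀ i, l i ∈ Finset.Icc 1 N) ∧ gapSum l = k := by
  induction p generalizing N with
  | zero => exact ⟨k, h, Subsingleton.elim _ _⟩
  | succ p ih =>
    simp only [Finset.mem_Icc] at h ih ⊢
    have hlt : ∀ i : Fin p, k 0 < k i.succ := fun i => hk (Fin.succ_pos i)
    obtain ⟨l, hl, hle⟩ := ih (k := fun i => k i.succ - k 0) (N := N) (fun i j hij => by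
        have h1 := hk (Fin.succ_lt_succ_iff.2 hij)
        have h2 := hlt i
        dsimp only
        omega) (fun i => by
        have h2 := hlt i
        have h3 := (h i.succ).2
        omega)
    refine ⟨Fin.cons (k 0) l, fun i => ?_, funext fun i => ?_⟩
    · cases i using Fin.cases with
      | zero => exact h 0
      | succ i => exact hl i
    · cases i using Fin.cases with
      | zero => rfl
      | succ i =>
        rw [gapSum_succ, Fin.tail_cons, hle, Fin.cons_zero]
        exact Nat.add_sub_cancel' (hlt i).le

theorem gapSum_bounds {p n : ℕ} {l : Fin p → ℕ} (hl : ∀ i, l i ∈ Finset.Icc 1 n) :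
    StrictMono (gapSum l) ∧ ∀ i, gapSum l i ∈ Finset.Icc 1 (p * n) := by
  induction p with
  | zero => exact ⟨fun i => i.elim0, fun i => i.elim0⟩
  | succ p ih =>
    obtain ⟨h1, h2⟩ := ih (l := Fin.tail l) fun i => hl i.succ
    have h0 := hl 0
    simp only [Finset.mem_Icc] at h0 h2 ⊢
    have hpn : (p + 1) * n = p * n + n := by ring
    constructor
    · intro i j hij
      cases j using Fin.cases with
      | zero => exact absurd hij (Fin.not_lt_zero i)
      | succ j =>
        cases i using Fin.cases with
        | zero =>
          rw [gapSum_zero, gapSum_succ]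
          have := (h2 j).1
          omega
        | succ i =>
          rw [gapSum_succ, gapSum_succ]
          have := h1 (Fin.succ_lt_succ_iff.1 hij)
          omega
    · intro i
      cases i using Fin.cases with
      | zero => rw [gapSum_zero, hpn]; omega
      | succ i =>
        rw [gapSum_succ, hpn]
        have := h2 i
        omega

theorem mem_increasingTuples {p N : ℕ} {k : Fin p → ℕ} :
    k ∈ increasingTuples p N ↔ (∀ i, k i ∈ Finset.Icc 1 N) ∧ StrictMono k := by
  simp [increasingTuples, Fintype.mem_piFinset]

/-- The gaps of an increasing tuple are again between `1` and `N`. Summing over the whole box of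
gaps only adds nonnegative terms and makes product bounds factor. -/
theorem sum_increasingTuples_le {p N : ℕ} {F : (Fin p → ℕ) → ℝ} (hF : ∀ k, 0 ≤ F k) :
    ∑ k ∈ increasingTuples p N, F k ≤
      ∑ l ∈ Fintype.piFinset fun _ : Fin p => Finset.Icc 1 N, F (gapSum l) := by
  classical
  rw [← Finset.sum_image (g := gapSum) (f := F) gapSum_injective.injOn]
  refine Finset.sum_le_sum_of_subset_of_nonneg (fun k hk => ?_) fun k _ _ => hF k
  rw [mem_increasingTuples] at hk
  obtain ⟨l, hl, hlk⟩ := exists_gapSum_eq hk.2 hk.1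
  exact Finset.mem_image.2 ⟨l, Fintype.mem_piFinset.2 hl, hlk⟩

/-- Gaps up to `n` never lead beyond `p n ≤ N`. Shrinking the range by a constant factor does not
change the leading order of a logarithmic sum. -/
theorem le_sum_increasingTuples {p n N : ℕ} (hn : p * n ≤ N) {F : (Fin p → ℕ) → ℝ}
    (hF : ∀ k, 0 ≤ F k) :
    ∑ l ∈ Fintype.piFinset fun _ : Fin p => Finset.Icc 1 n, F (gapSum l) ≤
      ∑ k ∈ increasingTuples p N, F k := by
  classical
  rw [← Finset.sum_image (g := gapSum) (f := F) gapSum_injective.injOn]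
  refine Finset.sum_le_sum_of_subset_of_nonneg (fun k hk => ?_) fun k _ _ => hF k
  obtain ⟨l, hl, rfl⟩ := Finset.mem_image.1 hk
  obtain ⟨h1, h2⟩ := gapSum_bounds (Fintype.mem_piFinset.1 hl)
  refine mem_increasingTuples.2 ⟨fun i => ?_, h1⟩
  have := h2 i
  rw [Finset.mem_Icc] at this ⊢
  exact ⟨this.1, this.2.trans hn⟩

/-- The map `(x, y) ↦ (x, x + y₁, …, x + y_p)`. -/
def consShift {p : ℕ} (q : Plane × (Fin p → Plane)) : Fin (p + 1) → Plane :=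
  Fin.cons q.1 fun i => q.1 + q.2 i

/-- A shear: for each fixed first coordinate the others are merely translated. -/
theorem measurePreserving_consShift (p : ℕ) :
    MeasurePreserving (consShift (p := p)) (volume.prod volume) volume := by
  have h1 : MeasurePreserving (fun q : Plane × (Fin p → Plane) =>
      (q.1, (fun i => q.1 + q.2 i : Fin p → Plane))) (volume.prod volume)
      (volume.prod volume) := by
    refine (MeasurePreserving.id volume).skew_product (g := fun (x : Plane) (y : Fin p → Plane) (i : Fin p) => x + y i)
      (by fun_prop) (ae_of_all _ fun x => ?_)
    exact (measurePreserving_add_left volume (fun _ : Fin p => x)).map_eq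
  have h2 := (volume_preserving_piFinSuccAbove (fun _ : Fin (p + 1) => Plane) 0).symm
  have e : consShift (p := p) = (MeasurableEquiv.piFinSuccAbove (fun _ => Plane) 0).symm ∘
      fun q => (q.1, fun i => q.1 + q.2 i) := by
    funext q
    exact (Fin.insertNth_zero' q.1 fun i => q.1 + q.2 i).symm
  rw [e]
  exact h2.comp h1

/-- The joint law of a random walk with step law `μ` at the times `l₁, l₁ + l₂, …`. -/
noncomputable def walkLaw (μ : Measure Plane) : {p : ℕ} → (Fin p → ℕ) → Measure (Fin p → Plane)
  | 0, _ => Measure.dirac Fin.elim0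
  | _ + 1, l => ((convPow μ (l 0)).prod (walkLaw μ (Fin.tail l))).map consShift

instance isFiniteMeasure_walkLaw (μ : Measure Plane) [IsFiniteMeasure μ] {p : ℕ}
    (l : Fin p → ℕ) : IsFiniteMeasure (walkLaw μ l) := by
  induction p with
  | zero => rw [walkLaw]; infer_instance
  | succ p ih =>
    have := ih (Fin.tail l)
    rw [walkLaw]
    infer_instance

theorem prod_smul_smul {α β : Type*} [MeasurableSpace α] [MeasurableSpace β] (μ : Measure α)
    (ν : Measure β) [SFinite μ] [SFinite ν] (a b : ℝ≥0∞) :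
    (a • μ).prod (b • ν) = (a * b) • μ.prod ν := by
  rw [Measure.prod_smul_left, Measure.prod_smul_right, smul_smul]

theorem volume_fin_zero : (volume : Measure (Fin 0 → Plane)) = Measure.dirac Fin.elim0 :=
  Measure.volume_pi_eq_dirac _

theorem walkLaw_le {μ : Measure Plane} [IsFiniteMeasure μ] {c : ℕ → ℝ} (hc : ∀ n, 0 ≤ c n)
    (h : ∀ n, 1 ≤ n → convPow μ n ≤ ENNReal.ofReal (c n) • volume) {p : ℕ} {l : Fin p → ℕ}
    (hl : ∀ i, 1 ≤ l i) : walkLaw μ l ≤ ENNReal.ofReal (∏ i, c (l i)) • volume := by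
  induction p with
  | zero => simp [walkLaw, volume_fin_zero]
  | succ p ih =>
    have h1 := ih (l := Fin.tail l) fun i => hl i.succ
    have h2 := Measure.map_mono (f := consShift) (Measure.prod_mono (h _ (hl 0)) h1)
      (measurePreserving_consShift p).measurable
    rw [prod_smul_smul, Measure.map_smul, (measurePreserving_consShift p).map_eq,
      ← ENNReal.ofReal_mul (hc _)] at h2
    rw [walkLaw, Fin.prod_univ_succ]
    exact h2

/-- A local lower bound suffices, since positions confined to a cube have bounded increments. -/
theorem le_walkLaw {μ : Measure Plane} [IsFiniteMeasure μ] {d : ℕ → ℝ} (hd : ∀ n, 0 ≤ d n)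
    {p : ℕ} {L : ℝ} (hL : 0 ≤ L)
    (h : ∀ n, 1 ≤ n → ENNReal.ofReal (d n) •
      volume.restrict (Metric.closedBall 0 (2 ^ p * L)) ≤ convPow μ n) {l : Fin p → ℕ}
    (hl : ∀ i, 1 ≤ l i) : ENNReal.ofReal (∏ i, d (l i)) •
      volume.restrict {x : Fin p → Plane | ∀ i, ‖x i‖ ≤ L} ≤ walkLaw μ l := by
  induction p generalizing L with
  | zero =>
    simp only [Finset.univ_eq_empty, Finset.prod_empty, ENNReal.ofReal_one, one_smul, walkLaw,
      ← volume_fin_zero]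
    exact Measure.restrict_le_self
  | succ p ih =>
    have hset : MeasurableSet {x : Fin (p + 1) → Plane | ∀ i, ‖x i‖ ≤ L} := by
      have e : {x : Fin (p + 1) → Plane | ∀ i, ‖x i‖ ≤ L} =
          ⋂ i, {x : Fin (p + 1) → Plane | ‖x i‖ ≤ L} := by ext; simp
      rw [e]
      exact MeasurableSet.iInter fun i => measurableSet_le (by fun_prop) measurable_const
    -- Positions relative to the first one are differences of two vectors of norm at most `L`. The
    -- radius doubles at each stage, whence the `2 ^ p`.
    have h1 := ih (L := 2 * L) (by positivity) (fun n hn => by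
      have := h n hn
      rwa [pow_succ, mul_assoc] at this) (l := Fin.tail l) fun i => hl i.succ
    have h2 := Measure.map_mono (f := consShift) (Measure.prod_mono (h _ (hl 0)) h1)
      (measurePreserving_consShift p).measurable
    rw [prod_smul_smul, Measure.map_smul, Measure.prod_restrict, ← ENNReal.ofReal_mul (hd _)] at h2
    rw [walkLaw, Fin.prod_univ_succ]
    refine le_trans (smul_measure_mono _ ?_) h2
    rw [← (measurePreserving_consShift p).map_eq,
      Measure.restrict_map (measurePreserving_consShift p).measurable hset]
    refine Measure.map_mono (Measure.restrict_mono (fun q hq => ?_) le_rfl)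
      (measurePreserving_consShift p).measurable
    have h0 : ‖q.1‖ ≤ L := hq 0
    refine ⟨?_, fun i => ?_⟩
    · rw [mem_closedBall_zero_iff]
      have : (1 : ℝ) ≤ 2 ^ (p + 1) := one_le_pow₀ (by norm_num)
      nlinarith
    · have h3 : ‖q.1 + q.2 i‖ ≤ L := hq i.succ
      have e : q.2 i = (q.1 + q.2 i) - q.1 := by abel
      rw [e]
      exact (norm_sub_le _ _).trans (by linarith)

/-! ### Random walks with independent steps -/

section RandomWalk

variable {S : Type*} [MeasurableSpace S] {P : Measure S} [IsProbabilityMeasure P]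
  {Δ : ℕ → S → Plane} {μ : Measure Plane}

theorem map_sum_Ico (hm : ∀ i, Measurable (Δ i)) (hi : iIndepFun Δ P)
    (hμ : ∀ i, P.map (Δ i) = μ) (a n : ℕ) :
    P.map (fun ω => ∑ j ∈ Finset.Ico a (a + n), Δ j ω) = convPow μ n := by
  have : IsProbabilityMeasure μ := hμ 0 ▸ Measure.isProbabilityMeasure_map (hm 0).aemeasurable
  have hms : Measurable fun ω => ∑ j ∈ Finset.Ico a (a + n), Δ j ω :=
    Finset.measurable_sum _ fun j _ => hm j
  have := Measure.isProbabilityMeasure_map (μ := P) hms.aemeasurable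
  refine Measure.ext_of_charFun ?_
  rw [iIndepFun.charFun_map_fun_finsetSum_eq_prod (fun i _ => (hm i).aemeasurable)
    (hi.restrict _)]
  ext θ
  rw [charFun_convPow]
  simp [hμ]

/-- The joint law of the walk with independent steps at times `a + l₁, a + l₁ + l₂, …`. -/
theorem map_walk_gapSum (hm : ∀ i, Measurable (Δ i)) (hi : iIndepFun Δ P)
    (hμ : ∀ i, P.map (Δ i) = μ) {p : ℕ} (l : Fin p → ℕ) (a : ℕ) :
    P.map (fun ω i => ∑ j ∈ Finset.Ico a (a + gapSum l i), Δ j ω) = walkLaw μ l := by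
  have hμp : IsProbabilityMeasure μ :=
    hμ 0 ▸ Measure.isProbabilityMeasure_map (hm 0).aemeasurable
  induction p generalizing a with
  | zero =>
    have e : (fun ω (i : Fin 0) => ∑ j ∈ Finset.Ico a (a + gapSum l i), Δ j ω) =
        fun _ => Fin.elim0 := funext fun _ => Subsingleton.elim _ _
    rw [e, walkLaw, Measure.map_const, measure_univ, one_smul]
  | succ p ih =>
    set X : S → Plane := fun ω => ∑ j ∈ Finset.Ico a (a + l 0), Δ j ω with hX
    set Y : S → Fin p → Plane := fun ω i =>
      ∑ j ∈ Finset.Ico (a + l 0) (a + l 0 + gapSum (Fin.tail l) i), Δ j ω with hY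
    have hXm : Measurable X := Finset.measurable_sum _ fun j _ => hm j
    have hYm : Measurable Y :=
      measurable_pi_lambda _ fun i => Finset.measurable_sum _ fun j _ => hm j
    have e : (fun ω i => ∑ j ∈ Finset.Ico a (a + gapSum l i), Δ j ω) =
        fun ω => consShift (X ω, Y ω) := by
      funext ω i
      cases i using Fin.cases with
      | zero => rfl
      | succ i =>
        rw [gapSum_succ]
        have := Finset.sum_Ico_consecutive (fun j => Δ j ω) (Nat.le_add_right a (l 0))
          (Nat.le_add_right (a + l 0) (gapSum (Fin.tail l) i))
        rw [add_assoc] at this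
        rw [← this]
        simp [consShift, hX, hY, add_assoc]
    have hind : IndepFun X Y P := by
      set s := Finset.Ico a (a + l 0)
      -- A common end of all later time intervals, so that the later positions depend on one finite
      -- block of steps, disjoint from the first block.
      obtain ⟨b, hb⟩ : ∃ b, ∀ i, a + l 0 + gapSum (Fin.tail l) i ≤ b :=
        ⟨a + l 0 + ∑ i, gapSum (Fin.tail l) i, fun i => by
          have := Finset.single_le_sum (f := fun i => gapSum (Fin.tail l) i)
            (fun _ _ => Nat.zero_le _) (Finset.mem_univ i)
          omega⟩
      set t := Finset.Ico (a + l 0) b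
      have hst : Disjoint s t := by
        rw [Finset.disjoint_left]
        intro j h1 h2
        rw [Finset.mem_Ico] at h1 h2
        omega
      have h0 := hi.indepFun_finset s t hst hm
      have hX' : X = (fun v : s → Plane => ∑ j : s, v j) ∘ fun ω (j : s) => Δ j ω := by
        funext ω
        simp only [hX, Function.comp]
        rw [Finset.sum_coe_sort s (fun j => Δ j ω)]
      -- Each partial sum is written over the entire block with a cut-off, which exhibits `Y` as a
      -- function of that block.
      have hY' : Y = (fun (v : t → Plane) (i : Fin p) =>
          ∑ j : t, if (j : ℕ) < a + l 0 + gapSum (Fin.tail l) i then v j else 0) ∘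
          fun ω (j : t) => Δ j ω := by
        funext ω i
        simp only [hY, Function.comp]
        rw [Finset.sum_coe_sort t (fun j =>
          if j < a + l 0 + gapSum (Fin.tail l) i then Δ j ω else 0), ← Finset.sum_filter]
        refine Finset.sum_congr ?_ fun _ _ => rfl
        ext j
        have := hb i
        simp only [t, Finset.mem_filter, Finset.mem_Ico]
        omega
      rw [hX', hY']
      refine h0.comp (by fun_prop) (measurable_pi_lambda _ fun i => ?_)
      refine Finset.measurable_sum _ fun j _ => ?_
      split_ifs
      · exact measurable_pi_apply j
      · exact measurable_const
    have hlaw : P.map (fun ω => (X ω, Y ω)) =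
        (convPow μ (l 0)).prod (walkLaw μ (Fin.tail l)) := by
      rw [(indepFun_iff_map_prod_eq_prod_map_map hXm.aemeasurable hYm.aemeasurable).1 hind,
        ← ih (Fin.tail l) (a + l 0), ← map_sum_Ico hm hi hμ a (l 0)]
    rw [walkLaw, ← hlaw, Measure.map_map (measurePreserving_consShift p).measurable
      (hXm.prodMk hYm), e]
    rfl

end RandomWalk

/-! ### The walk along regeneration times as a random walk -/

/-- At an integer time the current segment is at its starting point, the origin. -/
theorem gluedPath_natCast (x : ℕ → PathSpace) (n : ℕ) :
    gluedPath x n = ∑ k ∈ Finset.range n, (x k).1 1 := by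
  have h : projIcc (0 : ℝ) 1 zero_le_one 0 = 0 := projIcc_left _
  rw [gluedPath, Nat.floor_natCast, sub_self, h, (x n).2, add_zero]

theorem regenerationWalk_eq_sum (z : ℕ → PathSpace × PathSpace) (η : ℕ → Bool) (n : ℕ) :
    regenerationWalk z η n =
      ∑ k ∈ Finset.Ico 0 (regenerationTime η n), pairIncrement (z k) := by
  rw [regenerationWalk, gluedPath_natCast, gluedPath_natCast, ← Finset.sum_sub_distrib,
    Finset.range_eq_Ico]
  rfl

theorem regenerationWalk_eq_sum_cycleSum {S : Type*} {Z : ℕ → S → PathSpace × PathSpace}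
    {η : ℕ → S → Bool} {ω : S}
    (h : ∀ i, regenerationTime (fun j => η j ω) i < regenerationTime (fun j => η j ω) (i + 1))
    (n : ℕ) : regenerationWalk (fun k => Z k ω) (fun k => η k ω) n =
      ∑ i ∈ Finset.range n, cycleSum pairIncrement Z η i ω := by
  induction n with
  | zero => simp [regenerationWalk_eq_sum, regenerationTime]
  | succ n ih =>
    rw [Finset.sum_range_succ, ← ih, regenerationWalk_eq_sum, regenerationWalk_eq_sum, cycleSum,
      Finset.sum_Ico_consecutive _ (Nat.zero_le _) (h n).le]

namespace IsRegenerativeProcess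

variable {S : Type*} [MeasurableSpace S] {P : Measure S} [IsProbabilityMeasure P]
  {ν : Measure (PathSpace × PathSpace)} [IsProbabilityMeasure ν]
  {r : Kernel (PathSpace × PathSpace) (PathSpace × PathSpace)} [IsMarkovKernel r] {γ : ℝ}
  {Z : ℕ → S → PathSpace × PathSpace} {η : ℕ → S → Bool}

/-- Almost surely all cycles are proper, and the walk is then the sequence of partial sums of the
i.i.d. cycle sums. -/
theorem integral_regenerationWalk (h : IsRegenerativeProcess P ν r γ Z η) (hγ : 0 < γ)
    (hγ₁ : γ ≤ 1) {p : ℕ} (l : Fin p → ℕ) {F : (Fin p → Plane) → ℝ}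
    (hF : AEStronglyMeasurable F
      (walkLaw (cycleLaw γ ν r pairIncrement measurable_pairIncrement) l)) :
    ∫ ω, F (fun i => regenerationWalk (fun n => Z n ω) (fun n => η n ω) (gapSum l i)) ∂P =
      ∫ x, F x ∂walkLaw (cycleLaw γ ν r pairIncrement measurable_pairIncrement) l := by
  have hm := h.measurable_cycleSum measurable_pairIncrement
  have e := map_walk_gapSum hm (h.iIndepFun_cycleSum hγ hγ₁ measurable_pairIncrement)
    (h.map_cycleSum hγ hγ₁ measurable_pairIncrement) l 0
  have hmw : Measurable fun ω (i : Fin p) =>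
      ∑ j ∈ Finset.Ico 0 (0 + gapSum l i), cycleSum pairIncrement Z η j ω :=
    measurable_pi_lambda _ fun i => Finset.measurable_sum _ fun j _ => hm j
  rw [← e] at hF ⊢
  rw [integral_map hmw.aemeasurable hF]
  refine integral_congr_ae ?_
  filter_upwards [h.ae_regenerationTime_lt hγ hγ₁ measurable_pairIncrement] with ω hω
  congr 1
  funext i
  rw [regenerationWalk_eq_sum_cycleSum hω, zero_add, Finset.range_eq_Ico]

/-- Each tuple of gaps contributes at most `∏ c (l i)` times the integral of `F`, and the sum of
these products over the box is a `p`-th power. -/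
theorem sum_integral_regenerationWalk_le (h : IsRegenerativeProcess P ν r γ Z η) (hγ : 0 < γ)
    (hγ₁ : γ ≤ 1) {c : ℕ → ℝ} (hc : ∀ n, 0 ≤ c n)
    (hle : ∀ n, 1 ≤ n → convPow (cycleLaw γ ν r pairIncrement measurable_pairIncrement) n ≤
      ENNReal.ofReal (c n) • volume) {p : ℕ} {F : (Fin p → Plane) → ℝ} (hF : Integrable F)
    (hF₀ : ∀ x, 0 ≤ F x) (N : ℕ) :
    ∑ k ∈ increasingTuples p N,
        ∫ ω, F (fun i => regenerationWalk (fun n => Z n ω) (fun n => η n ω) (k i)) ∂P ≤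
      (∑ n ∈ Finset.Icc 1 N, c n) ^ p * ∫ x, F x := by
  set μ := cycleLaw γ ν r pairIncrement measurable_pairIncrement with hμ
  have : IsProbabilityMeasure μ := by
    rw [hμ, ← h.map_cycleSum hγ hγ₁ measurable_pairIncrement 0]
    exact Measure.isProbabilityMeasure_map
      (h.measurable_cycleSum measurable_pairIncrement 0).aemeasurable
  refine (sum_increasingTuples_le fun k => integral_nonneg fun ω => hF₀ _).trans ?_
  have e : (∑ n ∈ Finset.Icc 1 N, c n) ^ p =
      ∑ l ∈ Fintype.piFinset fun _ : Fin p => Finset.Icc 1 N, ∏ i, c (l i) := by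
    rw [← Finset.prod_univ_sum]
    simp
  rw [e, Finset.sum_mul]
  refine Finset.sum_le_sum fun l hl => ?_
  have hl1 : ∀ i, 1 ≤ l i := fun i =>
    (Finset.mem_Icc.1 (Fintype.mem_piFinset.1 hl i)).1
  have hw := walkLaw_le hc hle hl1
  have hi : Integrable F (ENNReal.ofReal (∏ i, c (l i)) • volume) :=
    hF.smul_measure ENNReal.ofReal_ne_top
  -- Domination by Lebesgue measure transfers the almost everywhere measurability of `F` to the law
  -- of the walk.
  rw [h.integral_regenerationWalk hγ hγ₁ l (hi.mono_measure hw).aestronglyMeasurable]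
  refine (integral_mono_measure hw (ae_of_all _ hF₀) hi).trans ?_
  rw [integral_smul_measure, ENNReal.toReal_ofReal (Finset.prod_nonneg fun i _ => hc _),
    smul_eq_mul]

theorem le_sum_integral_regenerationWalk (h : IsRegenerativeProcess P ν r γ Z η) (hγ : 0 < γ)
    (hγ₁ : γ ≤ 1) {c d : ℕ → ℝ} (hd : ∀ n, 0 ≤ d n) {p : ℕ} {L : ℝ} (hL : 0 ≤ L)
    (hc : ∀ n, 0 ≤ c n)
    (hle : ∀ n, 1 ≤ n → convPow (cycleLaw γ ν r pairIncrement measurable_pairIncrement) n ≤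
      ENNReal.ofReal (c n) • volume)
    (hge : ∀ n, 1 ≤ n → ENNReal.ofReal (d n) •
      volume.restrict (Metric.closedBall 0 (2 ^ p * L)) ≤
        convPow (cycleLaw γ ν r pairIncrement measurable_pairIncrement) n)
    {F : (Fin p → Plane) → ℝ} (hF : Integrable F)
    (hF₀ : ∀ x, 0 ≤ F x) {n N : ℕ} (hn : p * n ≤ N) :
    (∑ j ∈ Finset.Icc 1 n, d j) ^ p * ∫ x in {x | ∀ i, ‖x i‖ ≤ L}, F x ≤
      ∑ k ∈ increasingTuples p N,
        ∫ ω, F (fun i => regenerationWalk (fun n => Z n ω) (fun n => η n ω) (k i)) ∂P := by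
  set μ := cycleLaw γ ν r pairIncrement measurable_pairIncrement with hμ
  have : IsProbabilityMeasure μ := by
    rw [hμ, ← h.map_cycleSum hγ hγ₁ measurable_pairIncrement 0]
    exact Measure.isProbabilityMeasure_map
      (h.measurable_cycleSum measurable_pairIncrement 0).aemeasurable
  refine le_trans ?_ (le_sum_increasingTuples hn fun k => integral_nonneg fun ω => hF₀ _)
  have e : (∑ j ∈ Finset.Icc 1 n, d j) ^ p =
      ∑ l ∈ Fintype.piFinset fun _ : Fin p => Finset.Icc 1 n, ∏ i, d (l i) := by
    rw [← Finset.prod_univ_sum]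
    simp
  rw [e, Finset.sum_mul]
  refine Finset.sum_le_sum fun l hl => ?_
  have hl1 : ∀ i, 1 ≤ l i := fun i =>
    (Finset.mem_Icc.1 (Fintype.mem_piFinset.1 hl i)).1
  -- The upper density bound serves here only to make `F` integrable under the law of the walk.
  have hi : Integrable F (walkLaw μ l) :=
    (hF.smul_measure ENNReal.ofReal_ne_top).mono_measure (walkLaw_le hc hle hl1)
  rw [h.integral_regenerationWalk hγ hγ₁ l hi.aestronglyMeasurable]
  refine le_trans ?_ (integral_mono_measure (le_walkLaw hd hL hge hl1) (ae_of_all _ hF₀) hi)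
  rw [integral_smul_measure, ENNReal.toReal_ofReal (Finset.prod_nonneg fun i _ => hd _),
    smul_eq_mul]

end IsRegenerativeProcess

/-! ### Logarithmic sums -/

theorem sum_Icc_div_add_le {a : ℝ} (ha : 0 ≤ a) {e : ℕ → ℝ} (he : Summable e)
    (he₀ : ∀ n, 0 ≤ e n) {x : ℝ} (hx : 1 ≤ x) :
    ∑ n ∈ Finset.Icc 1 ⌊x⌋₊, (a / n + e n) ≤ a * (1 + Real.log x) + ∑' n, e n := by
  rw [Finset.sum_add_distrib]
  refine add_le_add ?_ (he.sum_le_tsum _ fun n _ => he₀ n)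
  have h1 : ∑ n ∈ Finset.Icc 1 ⌊x⌋₊, a / (n : ℝ) = a * (harmonic ⌊x⌋₊ : ℚ) := by
    rw [harmonic_eq_sum_Icc]
    push_cast
    rw [Finset.mul_sum]
    simp [div_eq_mul_inv]
  rw [h1]
  refine mul_le_mul_of_nonneg_left ?_ ha
  exact harmonic_floor_le_one_add_log x hx

/-- The maximum with `0` keeps the factors nonnegative, as products of lower bounds require; it can
only increase the sum. Dividing by `p + 1` rather than `p` covers `p = 0`. -/
theorem le_sum_Icc_max {a : ℝ} (ha : 0 ≤ a) {e : ℕ → ℝ} (he : Summable e)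
    (he₀ : ∀ n, 0 ≤ e n) {x : ℝ} (hx : 0 < x) (p : ℕ) :
    a * (Real.log x - Real.log (p + 1)) - ∑' n, e n ≤
      ∑ n ∈ Finset.Icc 1 (⌊x⌋₊ / (p + 1)), max (a / n - e n) 0 := by
  set m := ⌊x⌋₊ / (p + 1) with hm
  have h1 : ∑ n ∈ Finset.Icc 1 m, a / (n : ℝ) = a * (harmonic m : ℚ) := by
    rw [harmonic_eq_sum_Icc]
    push_cast
    rw [Finset.mul_sum]
    simp [div_eq_mul_inv]
  have h2 : ∑ n ∈ Finset.Icc 1 m, (a / n - e n) ≤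
      ∑ n ∈ Finset.Icc 1 m, max (a / n - e n) 0 :=
    Finset.sum_le_sum fun n _ => le_max_left _ _
  refine le_trans ?_ h2
  rw [Finset.sum_sub_distrib, h1]
  refine sub_le_sub (mul_le_mul_of_nonneg_left ?_ ha) (he.sum_le_tsum _ fun n _ => he₀ n)
  refine le_trans ?_ (log_add_one_le_harmonic m)
  rw [← Real.log_div hx.ne' (by positivity)]
  refine Real.log_le_log (by positivity) ?_
  rw [div_le_iff₀ (by positivity)]
  -- Rounding down loses less than one unit of `m`, so `x / (p + 1) ≤ m + 1`, which suits `log (m +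
  -- 1) ≤ harmonic m`.
  have h3 : ⌊x⌋₊ + 1 ≤ (m + 1) * (p + 1) := by
    have := Nat.lt_mul_div_succ ⌊x⌋₊ (Nat.succ_pos p)
    rw [← hm] at this
    rw [mul_comm]
    exact this
  refine (Nat.lt_floor_add_one x).le.trans ?_
  exact_mod_cast h3

theorem tendsto_log_div_sq {M : ℝ → ℝ} (hM₀ : ∀ᶠ ε in 𝓝[>] (0 : ℝ), 0 < M ε)
    (hM : Tendsto (fun ε => Real.log (M ε) / Real.log (1 / ε)) (𝓝[>] 0) (𝓝 0)) :
    Tendsto (fun ε => Real.log (M ε / ε ^ 2) / Real.log (1 / ε)) (𝓝[>] 0) (𝓝 2) := by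
  have h := hM.add_const 2
  rw [zero_add] at h
  refine h.congr' ?_
  filter_upwards [hM₀, self_mem_nhdsWithin, tendsto_log_one_div.eventually_gt_atTop 0]
    with ε h1 (h2 : 0 < ε) h3
  have e : Real.log (M ε / ε ^ 2) = Real.log (M ε) + 2 * Real.log (1 / ε) := by
    rw [Real.log_div h1.ne' (by positivity), Real.log_pow, one_div, Real.log_inv]
    push_cast
    ring
  rw [e, add_div, mul_div_cancel_right₀ _ h3.ne']

/-- If `log x ~ 2 log (1 / ε)`, then `2π / (γ log (1 / ε)) (γ / (4πs) log x + C) → 1 / s`. -/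
theorem tendsto_const_div_log_mul {γ s : ℝ} (hγ : 0 < γ) (hs : 0 < s) (C : ℝ) {u : ℝ → ℝ}
    (hu : Tendsto (fun ε => u ε / Real.log (1 / ε)) (𝓝[>] 0) (𝓝 2)) :
    Tendsto (fun ε => 2 * Real.pi / (γ * Real.log (1 / ε)) * (γ / (4 * Real.pi * s) * u ε + C))
      (𝓝[>] 0) (𝓝 (1 / s)) := by
  have h1 := (hu.const_mul (1 / (2 * s))).add
    ((tendsto_log_one_div.inv_tendsto_atTop).const_mul (2 * Real.pi / γ * C))
  have e : 1 / (2 * s) * 2 + 2 * Real.pi / γ * C * 0 = 1 / s := by field_simp; ring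
  rw [e] at h1
  refine h1.congr' ?_
  filter_upwards [tendsto_log_one_div.eventually_gt_atTop 0] with ε h3
  have := Real.pi_pos
  simp only [Pi.inv_apply]
  field_simp
  ring

/-- A tight family of nonnegative functions has most of its mass on large cubes. -/
theorem exists_forall_le_setIntegral {ι : Type*} {p : ℕ} {H : ι → (Fin p → Plane) → ℝ} {A : ℝ}
    (hi : ∀ j, Integrable (H j)) (h₀ : ∀ j x, 0 ≤ H j x) (hA : ∀ j, ∫ x, H j x = A)
    (ht : Tendsto (fun L : ℝ => ⨆ j, ∫ x in {x | L ≤ √(∑ i, ‖x i‖ ^ 2)}, H j x) atTop (𝓝 0))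
    {δ : ℝ} (hδ : 0 < δ) :
    ∃ L, 0 ≤ L ∧ ∀ j, A - δ ≤ ∫ x in {x | ∀ i, ‖x i‖ ≤ L}, H j x := by
  obtain ⟨L, hL, hL0⟩ := ((ht.eventually_lt_const hδ).and (eventually_ge_atTop 0)).exists
  refine ⟨L, hL0, fun j => ?_⟩
  have hset : MeasurableSet {x : Fin p → Plane | ∀ i, ‖x i‖ ≤ L} := by
    have e : {x : Fin p → Plane | ∀ i, ‖x i‖ ≤ L} =
        ⋂ i, {x : Fin p → Plane | ‖x i‖ ≤ L} := by ext; simp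
    rw [e]
    exact MeasurableSet.iInter fun i => measurableSet_le (by fun_prop) measurable_const
  -- Without boundedness the real supremum would be a default value and would say nothing about its
  -- members. The common mass `A` is a bound.
  have hb : BddAbove (range fun j => ∫ x in {x | L ≤ √(∑ i, ‖x i‖ ^ 2)}, H j x) := by
    refine ⟨A, ?_⟩
    rintro _ ⟨j, rfl⟩
    rw [← hA j]
    exact setIntegral_le_integral (hi j) (ae_of_all _ (h₀ j))
  have h1 := (le_ciSup hb j).trans hL.le
  have h2 := integral_add_compl hset (hi j)
  have h3 : ∫ x in {x : Fin p → Plane | ∀ i, ‖x i‖ ≤ L}ᶜ, H j x ≤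
      ∫ x in {x | L ≤ √(∑ i, ‖x i‖ ^ 2)}, H j x := by
    refine setIntegral_mono_set (hi j).integrableOn (ae_of_all _ (h₀ j))
      (LE.le.eventuallyLE fun x hx => ?_)
    simp only [mem_compl_iff, mem_ofPred_eq, not_forall, not_le] at hx ⊢
    obtain ⟨i, hi⟩ := hx
    refine Real.le_sqrt_of_sq_le ?_
    refine le_trans (pow_le_pow_left₀ hL0 hi.le 2) ?_
    exact Finset.single_le_sum (f := fun i => ‖x i‖ ^ 2) (fun _ _ => by positivity)
      (Finset.mem_univ i)
  rw [hA] at h2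
  linarith

/-! ### The asymptotics of the sum over increasing times -/

theorem propositionB1
    (φ : ℝ → ℝ) (ψ : Plane → ℝ) (hφψ : IsMollifierPair φ ψ) (h β : ℝ)
    (W : Measure PathSpace) (hW : IsWienerMeasure W)
    (γ : ℝ) (hγ₀ : 0 < γ) (hγ₁ : γ < 1)
    (S : ℝ → Type*) [∀ ε, MeasurableSpace (S ε)]
    (P : ∀ ε, Measure (S ε)) [∀ ε, IsProbabilityMeasure (P ε)]
    (Z : ∀ ε, ℕ → S ε → PathSpace × PathSpace) (η : ∀ ε, ℕ → S ε → Bool)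
    (hZ : ∀ᶠ ε in 𝓝[>] (0 : ℝ), IsRegenerativeCoupling (P ε) (W.prod W)
      (fun z => (pathTransition φ ψ W h β ε z.1).prod (pathTransition φ ψ W h β ε z.2))
      γ (Z ε) (η ε))
    (M : ℝ → ℝ) (hM₀ : ∀ᶠ ε in 𝓝[>] (0 : ℝ), 0 < M ε)
    (hM : Tendsto (fun ε => Real.log (M ε) / Real.log (1 / ε)) (𝓝[>] 0) (𝓝 0))
    (p : ℕ) (H : ℝ → (Fin p → Plane) → ℝ) (A : ℝ)
    (hH_int : ∀ ε ∈ Ioo (0 : ℝ) 1, Integrable (H ε))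
    (hH_nonneg : ∀ ε ∈ Ioo (0 : ℝ) 1, ∀ x, 0 ≤ H ε x)
    (hH_bdd : ∀ ε ∈ Ioo (0 : ℝ) 1, ∃ C, ∀ x, H ε x ≤ C)
    (hH_norm : ∀ ε ∈ Ioo (0 : ℝ) 1, ∫ x, H ε x = A)
    (hH_tail : Tendsto
      (fun L : ℝ => ⨆ ε : Ioo (0 : ℝ) 1, ∫ x in {x | L ≤ √(∑ i, ‖x i‖ ^ 2)}, H ε x)
      atTop (𝓝 0)) :
    Tendsto
      (fun ε => (2 * Real.pi / (γ * Real.log (1 / ε))) ^ p *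
        ∑ k ∈ increasingTuples p ⌊M ε / ε ^ 2⌋₊,
          ∫ ω, H ε (fun i => regenerationWalk (fun n => Z ε n ω) (fun n => η ε n ω) (k i)) ∂P ε)
      (𝓝[>] 0) (𝓝 A) := by
  have hWp := hW.isProbabilityMeasure
  have hpi := Real.pi_pos
  have hlog := tendsto_log_div_sq hM₀ hM
  have hε₁ : ∀ᶠ ε in 𝓝[>] (0 : ℝ), ε ∈ Ioo (0 : ℝ) 1 := Ioo_mem_nhdsGT one_pos
  have hx : ∀ᶠ ε in 𝓝[>] (0 : ℝ), 1 ≤ M ε / ε ^ 2 := by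
    filter_upwards [hlog.eventually_const_lt two_pos, hM₀, hε₁,
      tendsto_log_one_div.eventually_gt_atTop 0] with ε h1 h2 h3 h4
    have h5 : 0 < Real.log (M ε / ε ^ 2) := by
      by_contra h6
      exact absurd h1 (not_lt.2 (div_nonpos_of_nonpos_of_nonneg (not_lt.1 h6) h4.le))
    exact ((Real.log_pos_iff (div_pos h2 (pow_pos h3.1 2)).le).1 h5).le
  -- For fixed `δ` the quantity lies between two functions of `ε` with explicit limits. Both limits
  -- tend to `A` as `δ → 0`.
  have hbounds : ∀ δ ∈ Ioo (0 : ℝ) 1, ∃ u v : ℝ → ℝ,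
      Tendsto u (𝓝[>] 0) (𝓝 ((1 / (1 - δ)) ^ p * A)) ∧
      Tendsto v (𝓝[>] 0) (𝓝 ((1 / (1 + δ)) ^ p * (A - δ))) ∧
      ∀ᶠ ε in 𝓝[>] 0, (2 * Real.pi / (γ * Real.log (1 / ε))) ^ p *
        ∑ k ∈ increasingTuples p ⌊M ε / ε ^ 2⌋₊,
          ∫ ω, H ε (fun i => regenerationWalk (fun n => Z ε n ω) (fun n => η ε n ω) (k i)) ∂P ε ∈
        Icc (v ε) (u ε) := by
    rintro δ ⟨hδ, hδ₁⟩
    obtain ⟨L, hL, hLA⟩ := exists_forall_le_setIntegral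
      (H := fun ε : Ioo (0 : ℝ) 1 => H ε) (fun ε => hH_int ε ε.2) (fun ε => hH_nonneg ε ε.2)
      (fun ε => hH_norm ε ε.2) hH_tail hδ
    obtain ⟨τ₁, hτ₁, e₁, he₁, he₁₀, hup⟩ := IsStepLaw.exists_convPow_le hγ₀ hγ₁ hδ hδ₁
    obtain ⟨τ₂, hτ₂, e₂, he₂, he₂₀, hlow⟩ :=
      IsStepLaw.exists_le_convPow hγ₀ hγ₁ hδ hδ₁ (2 ^ p * L)
    set a₁ := γ / (4 * Real.pi * (1 - δ)) with ha₁
    set a₂ := γ / (4 * Real.pi * (1 + δ)) with ha₂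
    have h1δ : 0 < 1 - δ := by linarith
    have ha₁0 : 0 ≤ a₁ := by positivity
    have ha₂0 : 0 ≤ a₂ := by positivity
    set x : ℝ → ℝ := fun ε => M ε / ε ^ 2 with hxdef
    set u : ℝ → ℝ := fun ε => 2 * Real.pi / (γ * Real.log (1 / ε)) *
      (a₁ * Real.log (x ε) + (a₁ + ∑' n, e₁ n)) with hu
    set v : ℝ → ℝ := fun ε => 2 * Real.pi / (γ * Real.log (1 / ε)) *
      (a₂ * Real.log (x ε) + (-(a₂ * Real.log (p + 1)) - ∑' n, e₂ n)) with hv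
    have hut : Tendsto u (𝓝[>] 0) (𝓝 (1 / (1 - δ))) :=
      tendsto_const_div_log_mul hγ₀ h1δ _ hlog
    have hvt : Tendsto v (𝓝[>] 0) (𝓝 (1 / (1 + δ))) :=
      tendsto_const_div_log_mul hγ₀ (by positivity) _ hlog
    refine ⟨fun ε => u ε ^ p * A, fun ε => v ε ^ p * (A - δ), (hut.pow p).mul_const A,
      (hvt.pow p).mul_const (A - δ), ?_⟩
    -- One closeness parameter that serves both local limit bounds; neither it nor the errors `e₁`,
    -- `e₂` depends on `ε`.
    have hη₀ : 0 < min (min τ₁ τ₂) 1 := by positivity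
    filter_upwards [hZ, hε₁, hx, eventually_isStepLaw hφψ h β hW hγ₀ hγ₁ hη₀ (min_le_right _ _),
      tendsto_log_one_div.eventually_gt_atTop 0,
      -- Positivity of `v` is what permits raising its lower bound to the power `p`.
      hvt.eventually_const_lt (show (0 : ℝ) < 1 / (1 + δ) by positivity)]
      with ε hZε hε hxε hstep hℓ hv0
    obtain ⟨r, hr, hdec, hrstep⟩ := hZε.step
    have hproc : IsRegenerativeProcess (P ε) (W.prod W) r γ (Z ε) (η ε) :=
      ⟨hZε.measurable_chain, hZε.measurable_coin, hZε.initial, hZε.coin, hrstep⟩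
    obtain ⟨μ', hμ'⟩ := hstep r hr hdec
    have hup' := hup _ hη₀.le ((min_le_left _ _).trans (min_le_left _ _)) _ _ hμ'
    have hlow' := hlow _ hη₀.le ((min_le_left _ _).trans (min_le_right _ _)) _ _ hμ'
    have hc : ∀ n : ℕ, 0 ≤ a₁ / n + e₁ n := fun n => add_nonneg (by positivity) (he₁₀ n)
    have hd : ∀ n : ℕ, 0 ≤ max (a₂ / n - e₂ n) 0 := fun n => le_max_right _ _
    have hk : 0 ≤ 2 * Real.pi / (γ * Real.log (1 / ε)) := by positivity
    have hA : 0 ≤ A := by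
      rw [← hH_norm ε hε]
      exact integral_nonneg (hH_nonneg ε hε)
    constructor
    · have h1 := hproc.le_sum_integral_regenerationWalk hγ₀ hγ₁.le hd hL hc hup'
        (fun n hn => by
          -- `ENNReal.ofReal` already truncates at zero, so the maximum leaves the local limit bound
          -- unchanged.
          rw [ENNReal.ofReal_max, ENNReal.ofReal_zero, max_eq_left zero_le]
          exact hlow' n hn) (hH_int ε hε) (hH_nonneg ε hε)
        (n := ⌊x ε⌋₊ / (p + 1)) (N := ⌊x ε⌋₊)
        ((Nat.mul_le_mul_right _ (Nat.le_succ p)).trans (Nat.mul_div_le _ _))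
      have h2 := le_sum_Icc_max ha₂0 he₂ he₂₀ (zero_lt_one.trans_le hxε) p
      have h3 : v ε ≤ 2 * Real.pi / (γ * Real.log (1 / ε)) *
          ∑ n ∈ Finset.Icc 1 (⌊x ε⌋₊ / (p + 1)), max (a₂ / n - e₂ n) 0 := by
        refine mul_le_mul_of_nonneg_left (le_trans (le_of_eq ?_) h2) hk
        ring
      calc v ε ^ p * (A - δ)
          ≤ v ε ^ p * ∫ x in {x | ∀ i, ‖x i‖ ≤ L}, H ε x :=
            mul_le_mul_of_nonneg_left (hLA ⟨ε, hε⟩) (pow_nonneg hv0.le _)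
        _ ≤ (2 * Real.pi / (γ * Real.log (1 / ε)) *
            ∑ n ∈ Finset.Icc 1 (⌊x ε⌋₊ / (p + 1)), max (a₂ / n - e₂ n) 0) ^ p *
              ∫ x in {x | ∀ i, ‖x i‖ ≤ L}, H ε x :=
            mul_le_mul_of_nonneg_right (pow_le_pow_left₀ hv0.le h3 p)
              (integral_nonneg (hH_nonneg ε hε))
        _ ≤ _ := by
            rw [mul_pow, mul_assoc]
            exact mul_le_mul_of_nonneg_left h1 (pow_nonneg hk p)
    · have h1 := hproc.sum_integral_regenerationWalk_le hγ₀ hγ₁.le hc hup' (hH_int ε hε)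
        (hH_nonneg ε hε) ⌊x ε⌋₊
      have h2 := sum_Icc_div_add_le ha₁0 he₁ he₁₀ hxε
      have h3 : 2 * Real.pi / (γ * Real.log (1 / ε)) *
          ∑ n ∈ Finset.Icc 1 ⌊x ε⌋₊, (a₁ / n + e₁ n) ≤ u ε := by
        refine mul_le_mul_of_nonneg_left (h2.trans (le_of_eq ?_)) hk
        ring
      rw [hH_norm ε hε] at h1
      refine (mul_le_mul_of_nonneg_left h1 (pow_nonneg hk p)).trans ?_
      rw [← mul_assoc, ← mul_pow]
      exact mul_le_mul_of_nonneg_right (pow_le_pow_left₀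
        (mul_nonneg hk (Finset.sum_nonneg fun n _ => hc n)) h3 p) hA
  have hδ0 : ∀ᶠ δ in 𝓝[>] (0 : ℝ), δ ∈ Ioo (0 : ℝ) 1 := hε₁
  -- For a target on either side of `A`, one `δ` is fixed whose limiting bound is still on the
  -- correct side; then `ε → 0`.
  refine tendsto_order.2 ⟨fun a ha => ?_, fun a ha => ?_⟩
  · have hcont : Tendsto (fun δ : ℝ => (1 / (1 + δ)) ^ p * (A - δ)) (𝓝[>] 0) (𝓝 A) := by
      have : ContinuousAt (fun δ : ℝ => (1 / (1 + δ)) ^ p * (A - δ)) 0 := by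
        fun_prop (disch := norm_num)
      have h2 := this.tendsto.mono_left (nhdsWithin_le_nhds (s := Ioi 0))
      simpa using h2
    obtain ⟨δ, h1, h2⟩ := ((hcont.eventually_const_lt ha).and hδ0).exists
    obtain ⟨u, v, -, hv, hE⟩ := hbounds δ h2
    filter_upwards [hv.eventually_const_lt h1, hE] with ε h3 h4
    exact h3.trans_le h4.1
  · have hcont : Tendsto (fun δ : ℝ => (1 / (1 - δ)) ^ p * A) (𝓝[>] 0) (𝓝 A) := by
      have : ContinuousAt (fun δ : ℝ => (1 / (1 - δ)) ^ p * A) 0 := by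
        fun_prop (disch := norm_num)
      have h2 := this.tendsto.mono_left (nhdsWithin_le_nhds (s := Ioi 0))
      simpa using h2
    obtain ⟨δ, h1, h2⟩ := ((hcont.eventually_lt_const ha).and hδ0).exists
    obtain ⟨u, v, hu, -, hE⟩ := hbounds δ h2
    filter_upwards [hu.eventually_lt_const h1, hE] with ε h3 h4
    exact h4.2.trans_lt h3
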